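/- **Theorem 3 (SCAFFOLD-M, partial participation).** Let $1\le S\le N$, $K\ge1$, $R\ge1$, $L>0$, $\sigma\ge0$, let $\mathcal D_1,\dots,\mathcal D_N$ be probability distributions of data points, $f_i(x)=\mathbb E_{\xi\sim\mathcal D_i}[F(x;\xi)]$ for $x\in\mathbb R^d$, and $f=\frac1N\sum_{i=1}^N f_i$. Assume that $f$ has a global minimum $f^*$, that each $f_i$ is differentiable with $\|\nabla f_i(x)-\nabla f_i(y)\|\le L\|x-y\|$ for all $x,y$, and that $\mathbb E_{\xi\sim\mathcal D_i}[\nabla F(x;\xi)]=\nabla f_i(x)$ and $\mathbb E_{\xi\sim\mathcal D_i}[\|\nabla F(x;\xi)-\nabla f_i(x)\|^2]\le\sigma^2$ for all $x$ and $i$. Put $\Delta=f(x^0)-f^*$. *Algorithm (SCAFFOLD-M).* Start from $x^0$, $g^0=0$, $c_i^0=\frac1B\sum_{b=1}^B\nabla F(x^0;\xi_i^b)$ and $c^0=\frac1N\sum_i c_i^0$. In round $r=0,\dots,R-1$, a set $\mathcal S_r$ of $S$ of the $N$ clients is drawn uniformly without replacement. Each $i\in\mathcal S_r$ sets $x_i^{r,0}=x^r$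 and, for $k=0,\dots,K-1$, $$x_i^{r,k+1}=x_i^{r,k}-\eta\left(\beta\left(\nabla F(x_i^{r,k};\xi_i^{r,k})-c_i^r+c^r\right)+(1-\beta)g^r\right),$$ and then $c_i^{r+1}=\frac1K\sum_{k=0}^{K-1}\nabla F(x_i^{r,k};\xi_i^{r,k})$, while $c_i^{r+1}=c_i^r$ for $i\notin\mathcal S_r$. Finally $g^{r+1}=\frac1{\eta SK}\sum_{i\in\mathcal S_r}(x^r-x_i^{r,K})$, $x^{r+1}=x^r-\gamma g^{r+1}$ and $c^{r+1}=c^r+\frac1N\sum_{i\in\mathcal S_r}(c_i^{r+1}-c_i^r)$. All data points $\xi_i^b,\xi_i^{r,k}\sim\mathcal D_i$ and all sets $\mathcal S_r$ are mutually independent. *Claim.* There is a numerical constant $c_1>0$, and for every constant $c\in(0,1]$ there is a constant $C$ depending only on $c$, such that with $$B=\left\lceil\frac{NK}{SR}\right\rceil,\qquad \beta=\min\left\{c,\ \frac S{N^{2/3}},\ \sqrt{\frac{L\Delta SK}{\sigma^2R}}\right\},\qquad \gamma=\frac{\beta}{24L},$$ $$\eta>0,\qquad \eta KL\le c_1\min\left\{\frac1{S^{1/2}},\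 \frac1{\beta K^{1/4}},\ \frac{S^{1/2}}N\right\}$$ (if $\sigma=0$, the last entry of the first minimum is $+\infty$; if $\beta=0$, the middle entry of the second minimum is $+\infty$), the expectations below are finite and $$\frac1R\sum_{r=0}^{R-1}\mathbb E\left[\|\nabla f(x^r)\|^2\right]\le C\left(\sqrt{\frac{L\Delta\sigma^2}{SKR}}+\frac{L\Delta}R\left(1+\frac{N^{2/3}}S\right)\right).$$ -/

import Mathlib

open MeasureTheory ProbabilityTheory

noncomputable section

namespace ScaffoldM

/-- The local objective `f_i(x) = 𝔼_{ξ ∼ D_i} [F(x; ξ)]`. -/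
def localObjective {d N : ℕ} {Z : Type*} [MeasurableSpace Z]
    (F : EuclideanSpace ℝ (Fin d) → Z → ℝ) (D : Fin N → Measure Z) (i : Fin N)
    (x : EuclideanSpace ℝ (Fin d)) : ℝ :=
  ∫ z, F x z ∂(D i)

/-- The global objective `f = (1/N) ∑ i, f_i`. -/
def globalObjective {d N : ℕ} {Z : Type*} [MeasurableSpace Z]
    (F : EuclideanSpace ℝ (Fin d) → Z → ℝ) (D : Fin N → Measure Z)
    (x : EuclideanSpace ℝ (Fin d)) : ℝ :=
  (1 / (N : ℝ)) * ∑ i, localObjective F D i x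

/-- The stochastic gradient `∇F(x; z)`, the gradient being taken in `x`. -/
def sampleGradient {d : ℕ} {Z : Type*} (F : EuclideanSpace ℝ (Fin d) → Z → ℝ)
    (x : EuclideanSpace ℝ (Fin d)) (z : Z) : EuclideanSpace ℝ (Fin d) :=
  gradient (fun y => F y z) x

/-- The losses and data distributions are regular enough for `f_i` and `∇F` to be meaningful:
`F(x; ·)` is integrable, `F(·; z)` is differentiable at `x` for almost every data point `z`, and
`∇F` is a jointly measurable function of the model and the data point. -/
structure WellPosed {d N : ℕ} {Z : Type*} [MeasurableSpace Z]
    (F : EuclideanSpace ℝ (Fin d) → Z → ℝ) (D : Fin N → Measure Z) : Prop where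
  isProbabilityMeasure : ∀ i, IsProbabilityMeasure (D i)
  integrable : ∀ i x, Integrable (F x) (D i)
  differentiable : ∀ i x, ∀ᵐ z ∂(D i), DifferentiableAt ℝ (fun y => F y z) x
  measurable_gradient :
    Measurable (fun p : EuclideanSpace ℝ (Fin d) × Z => sampleGradient F p.1 p.2)

/-- Standard smoothness: every local objective is differentiable with `L`-Lipschitz gradient. -/
def StandardSmoothness {d N : ℕ} {Z : Type*} [MeasurableSpace Z]
    (F : EuclideanSpace ℝ (Fin d) → Z → ℝ) (D : Fin N → Measure Z) (L : ℝ) : Prop :=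
  ∀ i, Differentiable ℝ (localObjective F D i) ∧
    ∀ x y, ‖gradient (localObjective F D i) x - gradient (localObjective F D i) y‖ ≤ L * ‖x - y‖

/-- The stochastic gradients are unbiased, with variance at most `σ ^ 2`. -/
def BoundedVariance {d N : ℕ} {Z : Type*} [MeasurableSpace Z]
    (F : EuclideanSpace ℝ (Fin d) → Z → ℝ) (D : Fin N → Measure Z) (σ : ℝ) : Prop :=
  ∀ i x,
    Integrable (sampleGradient F x) (D i) ∧
    ∫ z, sampleGradient F x z ∂(D i) = gradient (localObjective F D i) x ∧
    Integrable (fun z => ‖sampleGradient F x z - gradient (localObjective F D i) x‖ ^ 2) (D i) ∧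
    ∫ z, ‖sampleGradient F x z - gradient (localObjective F D i) x‖ ^ 2 ∂(D i) ≤ σ ^ 2

/-- What is kept between two rounds: the global model `x`, the momentum direction `g`, the control
variables `ctrl i` of the clients, and the control variable `serverCtrl` of the server. -/
structure State (d N : ℕ) where
  x : EuclideanSpace ℝ (Fin d)
  g : EuclideanSpace ℝ (Fin d)
  ctrl : Fin N → EuclideanSpace ℝ (Fin d)
  serverCtrl : EuclideanSpace ℝ (Fin d)

/-- The local model `x_i^{r,k}` of client `i` after `k` local steps with data points `ξ 0, ξ 1, …`,
in a round that begins in state `s`. -/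
def localModel {d N : ℕ} {Z : Type*} (F : EuclideanSpace ℝ (Fin d) → Z → ℝ) (β η : ℝ)
    (s : State d N) (i : Fin N) (ξ : ℕ → Z) : ℕ → EuclideanSpace ℝ (Fin d)
  | 0 => s.x
  | k + 1 =>
      localModel F β η s i ξ k -
        η • (β • (sampleGradient F (localModel F β η s i ξ k) (ξ k) - s.ctrl i + s.serverCtrl) +
          (1 - β) • s.g)

/-- The new control variable `(1/K) ∑_{k<K} ∇F(x_i^{r,k}; ξ_i^{r,k})` of a participating client. -/
def newCtrl {d N : ℕ} {Z : Type*} (F : EuclideanSpace ℝ (Fin d) → Z → ℝ) (β η : ℝ) (K : ℕ)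
    (s : State d N) (i : Fin N) (ξ : ℕ → Z) : EuclideanSpace ℝ (Fin d) :=
  (1 / (K : ℝ)) • ∑ k ∈ Finset.range K, sampleGradient F (localModel F β η s i ξ k) (ξ k)

/-- The aggregated direction `g^{r+1} = (1/(ηSK)) ∑_{i ∈ T} (x^r - x_i^{r,K})`. -/
def newDirection {d N : ℕ} {Z : Type*} (F : EuclideanSpace ℝ (Fin d) → Z → ℝ) (β η : ℝ)
    (S K : ℕ) (s : State d N) (T : Finset (Fin N)) (ξ : Fin N → ℕ → Z) :
    EuclideanSpace ℝ (Fin d) :=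
  (1 / (η * S * K)) • ∑ i ∈ T, (s.x - localModel F β η s i (ξ i) K)

/-- One communication round, with participating clients `T` and data points `ξ i k`. -/
def oneRound {d N : ℕ} {Z : Type*} (F : EuclideanSpace ℝ (Fin d) → Z → ℝ) (β γ η : ℝ)
    (S K : ℕ) (s : State d N) (T : Finset (Fin N)) (ξ : Fin N → ℕ → Z) : State d N where
  x := s.x - γ • newDirection F β η S K s T ξ
  g := newDirection F β η S K s T ξ
  ctrl := fun i => if i ∈ T then newCtrl F β η K s i (ξ i) else s.ctrl i
  serverCtrl :=
    s.serverCtrl + (1 / (N : ℝ)) • ∑ i ∈ T, (newCtrl F β η K s i (ξ i) - s.ctrl i)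

/-- The initial state: `g^0 = 0`, `c_i^0 = (1/B) ∑_{b<B} ∇F(x^0; ξ_i^b)` and
`c^0 = (1/N) ∑ i, c_i^0`. -/
def initialState {d N : ℕ} {Z : Type*} (F : EuclideanSpace ℝ (Fin d) → Z → ℝ) (B : ℕ)
    (x₀ : EuclideanSpace ℝ (Fin d)) (ξ₀ : Fin N → ℕ → Z) : State d N where
  x := x₀
  g := 0
  ctrl := fun i => (1 / (B : ℝ)) • ∑ b ∈ Finset.range B, sampleGradient F x₀ (ξ₀ i b)
  serverCtrl :=
    (1 / (N : ℝ)) • ∑ i, (1 / (B : ℝ)) • ∑ b ∈ Finset.range B, sampleGradient F x₀ (ξ₀ i b)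

/-- The state of SCAFFOLD-M at the beginning of round `r`, as a function of the draws: `ξ₀ i b` for
the initialization, the client sets `T r`, and the data points `ξ r i k` of the local steps. -/
def run {d N : ℕ} {Z : Type*} (F : EuclideanSpace ℝ (Fin d) → Z → ℝ) (β γ η : ℝ)
    (S K B : ℕ) (x₀ : EuclideanSpace ℝ (Fin d)) (ξ₀ : Fin N → ℕ → Z)
    (T : ℕ → Finset (Fin N)) (ξ : ℕ → Fin N → ℕ → Z) : ℕ → State d N
  | 0 => initialState F B x₀ ξ₀
  | r + 1 => oneRound F β γ η S K (run F β γ η S K B x₀ ξ₀ T ξ r) (T r) (ξ r)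

/-- The randomness of a run with `R` rounds on a probability space `(Ω, μ)`: all data points of
client `i` have law `D i`, each client set is uniformly distributed among the subsets of size `S`
of the `N` clients, and all these draws are mutually independent. -/
structure Draws {N : ℕ} {Z Ω : Type*} [MeasurableSpace Z] [MeasurableSpace Ω] (μ : Measure Ω)
    (D : Fin N → Measure Z) (S K R B : ℕ) (ξ₀ : Fin N → ℕ → Ω → Z)
    (T : ℕ → Ω → Finset (Fin N)) (ξ : ℕ → Fin N → ℕ → Ω → Z) : Prop where
  measurable_init : ∀ i, ∀ b < B, Measurable (ξ₀ i b)
  law_init : ∀ i, ∀ b < B, μ.map (ξ₀ i b) = D i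
  measurable_step : ∀ r < R, ∀ i, ∀ k < K, Measurable (ξ r i k)
  law_step : ∀ r < R, ∀ i, ∀ k < K, μ.map (ξ r i k) = D i
  measurable_clients : ∀ r < R, ∀ A : Finset (Fin N), MeasurableSet {ω | T r ω = A}
  card_clients : ∀ r < R, ∀ ω, (T r ω).card = S
  uniform_clients : ∀ r < R, ∀ A : Finset (Fin N), A.card = S →
    μ {ω | T r ω = A} = ((N.choose S : ENNReal))⁻¹
  indep : iIndep (fun j : (Fin N × Fin B) ⊕ ((Fin R × Fin N × Fin K) ⊕ Fin R) =>
    match j with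
    | .inl (i, b) => MeasurableSpace.comap (ξ₀ i b) inferInstance
    | .inr (.inl (r, i, k)) => MeasurableSpace.comap (ξ r i k) inferInstance
    | .inr (.inr r) => MeasurableSpace.comap (T r) ⊤) μ

/-- The momentum `β = min {c, S / N^{2/3}, √(LΔSK / (σ²R))}`; for `σ = 0` the last entry is `+∞`
and is left out. -/
def momentum (c L Δ σ : ℝ) (N S K R : ℕ) : ℝ :=
  if σ = 0 then min c (S / (N : ℝ) ^ (2 / 3 : ℝ))
  else min (min c (S / (N : ℝ) ^ (2 / 3 : ℝ))) (Real.sqrt (L * Δ * S * K / (σ ^ 2 * R)))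

/-- The number `B = ⌈NK / (SR)⌉` of initial data points per client. -/
def initialBatch (N S K R : ℕ) : ℕ := ⌈((N : ℝ) * K) / ((S : ℝ) * R)⌉₊

end ScaffoldM

end

/-!
The proof follows the Lyapunov function
`Φ(s) = (f(x) - f*) + (γ/β) ‖g - ∇f(x + γ g)‖² + (12 γ β N / S²) (1/N) ∑ i, ‖∇f_i(x) - c_i‖²`
(`lyapunov`) of the state `s = (x, g, c_1, …, c_N)`. Note that `x + γ g` is the previous model, so
the middle term measures how well the momentum direction estimates the gradient.

For a fixed state `s` and a fixed set `A` of participating clients, the error of the new direction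
`g⁺` splits (`newDirection_sub_gradient_eq`) into the old error damped by `1 - β`, the sampling
error of the mean of `∇f_i(x) - c_i` over `A`, the noise of the stochastic gradients, and the bias
caused by the drift of the local models. The noise is a sum of martingale differences, so its second
moment is of order `β² σ² / (SK)` (`integral_add_smul_sum_localNoise_sq_le`). The drift of a local
model is controlled by a discrete Grönwall argument (`lintegral_localModel_sub_le`), and the bias is
negligible because `η K L √S` is small. The descent lemma bounds the first term of `Φ`, and a client
that takes part replaces its control variable by a mean of fresh gradients, so that the third term
shrinks by a factor `1 - S / (2N)`, up to noise, bias and the motion of the model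
(`ctrlVariance_oneRound_le`).

Averaging over `A` uses that sampling without replacement is no worse than sampling with replacement
(`subsetMean_norm_sum_sq_le`). The weights in `Φ` are chosen so that the sampling error, of size
`β² / S` times the variance of the control variables, is paid by the decrease of the third term; the
motion of the model in the third term costs `β³ N² / S³ ≤ 1` times the squared gradient, which is
where `β ≤ S / N^{2/3}` enters. The result (`subsetMean_roundBound_le`, with the arithmetic in
`round_decrease_arith`) is
`𝔼 Φ(s⁺) + (γ/4) ‖∇f(x)‖² ≤ Φ(s) + 42 γ β σ² / (SK)`.

Since the draws of a round are independent of the past, Fubini's theorem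
(`lintegral_eq_lintegral_lintegral_of_indep`) lets this be applied to the random state at the
beginning of the round. Summing over the rounds, bounding `Φ` at the initial state by
`f(x⁰) - f*` and `σ² / B`, and inserting the choices of `B` and `β` (`div_momentum_le`,
`momentum_mul_sq_le`) gives the claim. All expectations of nonnegative quantities are first taken
in `ℝ≥0∞`, so finiteness comes out of the bound and need not be known beforehand. If `β = 0` then
`f(x⁰) = f*` and the model never moves.
-/

noncomputable section

namespace ScaffoldM

/-! ### Smooth functions and squared norms -/

section Smooth
variable {E : Type*} [NormedAddCommGroup E] [InnerProductSpace ℝ E] [CompleteSpace E]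

/-- The descent lemma. -/
theorem le_quadratic_of_lipschitz_gradient {f : E → ℝ} {L : ℝ} (hf : Differentiable ℝ f)
    (hL : ∀ x y, ‖gradient f x - gradient f y‖ ≤ L * ‖x - y‖) (x v : E) :
    f (x + v) ≤ f x + inner ℝ (gradient f x) v + L / 2 * ‖v‖ ^ 2 := by
  have hd : ∀ t : ℝ, HasDerivAt (fun t : ℝ => f (x + t • v))
      (inner ℝ (gradient f (x + t • v)) v) t := by
    intro t
    have h1 : HasDerivAt (fun t : ℝ => x + t • v) v t := by
      simpa using ((hasDerivAt_id t).smul_const v).const_add x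
    have h2 := (hf (x + t • v)).hasFDerivAt.comp_hasDerivAt t h1
    rwa [← inner_gradient_left] at h2
  have hB : ∀ t : ℝ, HasDerivAt
      (fun t : ℝ => f x + t * inner ℝ (gradient f x) v + L / 2 * ‖v‖ ^ 2 * t ^ 2)
      (inner ℝ (gradient f x) v + L * ‖v‖ ^ 2 * t) t := by
    intro t
    have h1 := ((hasDerivAt_id t).mul_const (inner ℝ (gradient f x) v)).const_add (f x)
    have h2 := ((hasDerivAt_id t).pow 2).const_mul (L / 2 * ‖v‖ ^ 2)
    refine (h1.add h2).congr_deriv ?_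
    simp
    ring
  have key := image_le_of_deriv_right_le_deriv_boundary (a := 0) (b := 1)
    (f := fun t : ℝ => f (x + t • v))
    (HasDerivAt.continuousOn fun t _ => hd t) (fun t _ => (hd t).hasDerivWithinAt)
    (B := fun t : ℝ => f x + t * inner ℝ (gradient f x) v + L / 2 * ‖v‖ ^ 2 * t ^ 2)
    (by simp) (HasDerivAt.continuousOn fun t _ => hB t)
    (fun t _ => (hB t).hasDerivWithinAt) (by
      intro t ht
      have h1 : inner ℝ (gradient f (x + t • v) - gradient f x) v ≤ L * (t * ‖v‖) * ‖v‖ := by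
        refine (real_inner_le_norm _ _).trans ?_
        gcongr
        have := hL (x + t • v) x
        simpa [norm_smul, abs_of_nonneg ht.1] using this
      rw [inner_sub_left] at h1
      nlinarith)
    (x := 1) (by simp)
  simpa using key

/-- Near the infimum of a smooth function the gradient is small: a gradient step of length `1 / L`
cannot go below the lower bound `m`. -/
theorem norm_gradient_sq_le {f : E → ℝ} {L m : ℝ} (hLpos : 0 < L) (hf : Differentiable ℝ f)
    (hL : ∀ x y, ‖gradient f x - gradient f y‖ ≤ L * ‖x - y‖) (hm : ∀ x, m ≤ f x) (x : E) :
    ‖gradient f x‖ ^ 2 ≤ 2 * L * (f x - m) := by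
  have h := le_quadratic_of_lipschitz_gradient hf hL x (-(1 / L) • gradient f x)
  have h2 := hm (x + -(1 / L) • gradient f x)
  rw [inner_smul_right, real_inner_self_eq_norm_sq, norm_smul, mul_pow, Real.norm_eq_abs,
    sq_abs] at h
  have h3 : L / 2 * ((-(1 / L)) ^ 2 * ‖gradient f x‖ ^ 2) = 1 / (2 * L) * ‖gradient f x‖ ^ 2 := by
    field_simp
  have h4 : -(1 / L) * ‖gradient f x‖ ^ 2 = - (2 * (1 / (2 * L) * ‖gradient f x‖ ^ 2)) := by
    field_simp
  rw [h3, h4] at h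
  have h5 : 1 / (2 * L) * ‖gradient f x‖ ^ 2 ≤ f x - m := by linarith
  calc ‖gradient f x‖ ^ 2 = 2 * L * (1 / (2 * L) * ‖gradient f x‖ ^ 2) := by field_simp
    _ ≤ _ := by gcongr

/-- Young's inequality for `‖a + b‖ ^ 2`. -/
theorem norm_add_sq_le_young {E : Type*} [SeminormedAddCommGroup E] (a b : E) {t : ℝ}
    (ht : 0 < t) : ‖a + b‖ ^ 2 ≤ (1 + t) * ‖a‖ ^ 2 + (1 + 1 / t) * ‖b‖ ^ 2 := by
  have h := norm_add_le a b
  have h1 : ‖a + b‖ ^ 2 ≤ (‖a‖ + ‖b‖) ^ 2 := by gcongr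
  have h2 : 0 ≤ (t * ‖a‖ - ‖b‖) ^ 2 / t := by positivity
  have h3 : (t * ‖a‖ - ‖b‖) ^ 2 / t = t * ‖a‖ ^ 2 - 2 * ‖a‖ * ‖b‖ + 1 / t * ‖b‖ ^ 2 := by
    field_simp
    ring
  nlinarith

theorem norm_add_sq_le_two {E : Type*} [SeminormedAddCommGroup E] (a b : E) :
    ‖a + b‖ ^ 2 ≤ 2 * ‖a‖ ^ 2 + 2 * ‖b‖ ^ 2 := by
  have := norm_add_sq_le_young a b one_pos
  norm_num at this ⊢
  linarith

/-- Jensen's inequality for the squared norm of a mean. -/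
theorem norm_mean_sq_le {E ι : Type*} [SeminormedAddCommGroup E] [NormedSpace ℝ E]
    (A : Finset ι) {n : ℕ} (hn : A.card = n) (v : ι → E) :
    ‖(1 / (n : ℝ)) • ∑ i ∈ A, v i‖ ^ 2 ≤ (1 / (n : ℝ)) * ∑ i ∈ A, ‖v i‖ ^ 2 := by
  rcases Nat.eq_zero_or_pos n with h0 | hpos
  · subst h0; simp
  have h1 : ‖∑ i ∈ A, v i‖ ^ 2 ≤ n * ∑ i ∈ A, ‖v i‖ ^ 2 := by
    calc ‖∑ i ∈ A, v i‖ ^ 2 ≤ (∑ i ∈ A, ‖v i‖) ^ 2 := by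
          gcongr; exact norm_sum_le _ _
      _ ≤ n * ∑ i ∈ A, ‖v i‖ ^ 2 := by
          rw [← hn]; exact sq_sum_le_card_mul_sum_sq
  have hn' : (0 : ℝ) < n := by exact_mod_cast hpos
  rw [norm_smul, mul_pow, Real.norm_eq_abs, sq_abs]
  calc (1 / (n : ℝ)) ^ 2 * ‖∑ i ∈ A, v i‖ ^ 2
      ≤ (1 / (n : ℝ)) ^ 2 * (n * ∑ i ∈ A, ‖v i‖ ^ 2) := by gcongr
    _ = _ := by field_simp

end Smooth

/-! ### Sampling without replacement -/

section Sampling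
open Finset
variable {ι : Type*} [Fintype ι]

/-- The mean of `φ A` over a uniformly drawn subset `A` of size `S`; it is `0` if there is no such
subset. -/
def subsetMean (ι : Type*) [Fintype ι] (S : ℕ) (φ : Finset ι → ℝ) : ℝ :=
  (((Fintype.card ι).choose S : ℕ) : ℝ)⁻¹ * ∑ A ∈ powersetCard S (univ : Finset ι), φ A

theorem subsetMean_mono {S : ℕ} {φ ψ : Finset ι → ℝ}
    (h : ∀ A : Finset ι, A.card = S → φ A ≤ ψ A) :
    subsetMean ι S φ ≤ subsetMean ι S ψ := by
  unfold subsetMean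
  gcongr with A hA
  exact h A (mem_powersetCard.1 hA).2

theorem subsetMean_add (S : ℕ) (φ ψ : Finset ι → ℝ) :
    subsetMean ι S (fun A => φ A + ψ A) = subsetMean ι S φ + subsetMean ι S ψ := by
  simp only [subsetMean, sum_add_distrib, mul_add]

theorem subsetMean_const_mul (S : ℕ) (a : ℝ) (φ : Finset ι → ℝ) :
    subsetMean ι S (fun A => a * φ A) = a * subsetMean ι S φ := by
  simp only [subsetMean, ← mul_sum]
  ring

theorem subsetMean_const {S : ℕ} (hS : S ≤ Fintype.card ι) (a : ℝ) :
    subsetMean ι S (fun _ => a) = a := by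
  have : (((Fintype.card ι).choose S : ℕ) : ℝ) ≠ 0 := by
    exact_mod_cast (Nat.choose_pos hS).ne'
  simp only [subsetMean, sum_const, card_powersetCard, card_univ, nsmul_eq_mul]
  field_simp

variable [DecidableEq ι]

/-- The number of subsets of size `S` containing a given set depends only on its cardinality. -/
theorem sum_powersetCard_ite_subset (S : ℕ) (s : Finset ι) :
    ∑ A ∈ powersetCard S (univ : Finset ι), (if s ⊆ A then (1 : ℝ) else 0) =
      if s.card ≤ S then (((Fintype.card ι - s.card).choose (S - s.card) : ℕ) : ℝ) else 0 := by
  rw [sum_boole]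
  split_ifs with h
  · rw [card_filter_powersetCard_subset s univ S (subset_univ _) h, card_univ]
  · rw [Nat.cast_eq_zero, card_eq_zero, filter_eq_empty_iff]
    intro A hA hs
    exact h ((card_le_card hs).trans (mem_powersetCard.1 hA).2.le)

theorem subsetMean_sum [Nonempty ι] {S : ℕ} (hS : S ≤ Fintype.card ι) (φ : ι → ℝ) :
    subsetMean ι S (fun A => ∑ i ∈ A, φ i) = S / Fintype.card ι * ∑ i, φ i := by
  have hN : (Fintype.card ι : ℝ) ≠ 0 := by simp
  have hc : (((Fintype.card ι).choose S : ℕ) : ℝ) ≠ 0 := by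
    exact_mod_cast (Nat.choose_pos hS).ne'
  -- all elements are drawn equally often, say `q` times; the function `1` determines `q`
  obtain ⟨q, hq⟩ : ∃ q : ℝ, ∀ i : ι,
      ∑ A ∈ powersetCard S (univ : Finset ι), (if i ∈ A then (1 : ℝ) else 0) = q :=
    ⟨_, fun i => by simpa using sum_powersetCard_ite_subset S ({i} : Finset ι)⟩
  have key : ∀ ψ : ι → ℝ,
      ∑ A ∈ powersetCard S (univ : Finset ι), ∑ i ∈ A, ψ i = q * ∑ i, ψ i := by
    intro ψ
    calc ∑ A ∈ powersetCard S (univ : Finset ι), ∑ i ∈ A, ψ i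
        = ∑ A ∈ powersetCard S (univ : Finset ι), ∑ i, (if i ∈ A then (1 : ℝ) else 0) * ψ i := by
          refine sum_congr rfl fun A _ => ?_
          simp [ite_mul]
      _ = ∑ i, (∑ A ∈ powersetCard S (univ : Finset ι), (if i ∈ A then (1 : ℝ) else 0)) * ψ i := by
          rw [sum_comm]; simp only [sum_mul]
      _ = q * ∑ i, ψ i := by simp only [hq, mul_sum]
  have h1 := key (fun _ => 1)
  have h2 : ∑ A ∈ powersetCard S (univ : Finset ι), ∑ i ∈ A, (1 : ℝ)
      = ((Fintype.card ι).choose S : ℕ) * S := by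
    rw [sum_congr rfl (g := fun _ => (S : ℝ))]
    · simp [card_powersetCard]
    · intro A hA; simp [(mem_powersetCard.1 hA).2]
  rw [h2] at h1
  simp only [sum_const, card_univ, nsmul_eq_mul, mul_one] at h1
  rw [subsetMean, key φ]
  field_simp
  linear_combination -(∑ i, φ i) * h1

variable {E : Type*} [NormedAddCommGroup E] [InnerProductSpace ℝ E]

/-- Sampling without replacement does not increase the variance of a sum of centered vectors:
the pairs `i ≠ j` all have the same probability of being drawn together, and their
contributions add up to a nonpositive number. -/
theorem subsetMean_norm_sum_sq_le [Nonempty ι] {S : ℕ} (hS : S ≤ Fintype.card ι) (u : ι → E)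
    (hu : ∑ i, u i = 0) :
    subsetMean ι S (fun A => ‖∑ i ∈ A, u i‖ ^ 2) ≤ S / Fintype.card ι * ∑ i, ‖u i‖ ^ 2 := by
  rw [← subsetMean_sum hS]
  unfold subsetMean
  refine mul_le_mul_of_nonneg_left ?_ (by positivity)
  -- all pairs of distinct elements are drawn together equally often, namely `q` times
  obtain ⟨q, hq0, hq⟩ : ∃ q : ℝ, 0 ≤ q ∧ ∀ i j : ι, i ≠ j →
      ∑ A ∈ powersetCard S (univ : Finset ι), (if i ∈ A ∧ j ∈ A then (1 : ℝ) else 0) = q := by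
    refine ⟨if 2 ≤ S then (((Fintype.card ι - 2).choose (S - 2) : ℕ) : ℝ) else 0, ?_,
      fun i j hij => ?_⟩
    · split_ifs <;> positivity
    · have := sum_powersetCard_ite_subset S ({i, j} : Finset ι)
      rw [card_pair hij] at this
      rw [← this]
      refine sum_congr rfl fun A _ => ?_
      simp [insert_subset_iff]
  have hexp : ∀ A : Finset ι, ‖∑ i ∈ A, u i‖ ^ 2 =
      ∑ i, ∑ j, (if i ∈ A ∧ j ∈ A then (1 : ℝ) else 0) * inner ℝ (u i) (u j) := by
    intro A
    rw [← real_inner_self_eq_norm_sq, sum_inner]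
    simp only [inner_sum]
    have : ∀ i j : ι, (if i ∈ A ∧ j ∈ A then (1 : ℝ) else 0) * inner ℝ (u i) (u j) =
        if i ∈ A then (if j ∈ A then inner ℝ (u i) (u j) else 0) else 0 := by
      intro i j
      split_ifs <;> simp_all
    simp only [this, sum_ite_irrel, sum_const_zero, sum_ite_mem, univ_inter]
  have hdiag : ∀ A : Finset ι, ∑ i ∈ A, ‖u i‖ ^ 2 =
      ∑ i, (if i ∈ A ∧ i ∈ A then (1 : ℝ) else 0) * inner ℝ (u i) (u i) := by
    intro A
    simp [ite_mul]
  have hcomm : ∑ A ∈ powersetCard S (univ : Finset ι), ‖∑ i ∈ A, u i‖ ^ 2 =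
      ∑ i, ∑ j, (∑ A ∈ powersetCard S (univ : Finset ι),
        (if i ∈ A ∧ j ∈ A then (1 : ℝ) else 0)) * inner ℝ (u i) (u j) := by
    simp only [hexp]
    rw [sum_comm]
    refine sum_congr rfl fun i _ => ?_
    rw [sum_comm]
    simp only [sum_mul]
  have hcomm' : ∑ A ∈ powersetCard S (univ : Finset ι), ∑ i ∈ A, ‖u i‖ ^ 2 =
      ∑ i, (∑ A ∈ powersetCard S (univ : Finset ι),
        (if i ∈ A ∧ i ∈ A then (1 : ℝ) else 0)) * inner ℝ (u i) (u i) := by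
    simp only [hdiag]
    rw [sum_comm]
    simp only [sum_mul]
  rw [hcomm, hcomm']
  refine sum_le_sum fun i _ => ?_
  rw [← add_sum_erase univ _ (mem_univ i)]
  -- the sum over `j ≠ i` is `-q ‖u i‖²`, because the vectors add up to `0`
  have h0 : ∑ j, inner ℝ (u i) (u j) = 0 := by rw [← inner_sum, hu, inner_zero_right]
  rw [← add_sum_erase univ _ (mem_univ i)] at h0
  have h1 : ∑ j ∈ univ.erase i, (∑ A ∈ powersetCard S (univ : Finset ι),
        (if i ∈ A ∧ j ∈ A then (1 : ℝ) else 0)) * inner ℝ (u i) (u j)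
      = q * ∑ j ∈ univ.erase i, inner ℝ (u i) (u j) := by
    rw [mul_sum]
    refine sum_congr rfl fun j hj => ?_
    rw [hq i j (ne_of_mem_erase hj).symm]
  rw [h1]
  have h2 : 0 ≤ inner ℝ (u i) (u i) := real_inner_self_nonneg
  nlinarith

/-- Second moment of a vector perturbed by the sampling error of the mean of `v`. The sampling error
is centered, so there is no cross term. -/
theorem subsetMean_norm_add_sampling_sq_le [Nonempty ι] {S : ℕ} (hS0 : 1 ≤ S)
    (hS : S ≤ Fintype.card ι) (a : E) (t : ℝ) (v : ι → E) :
    subsetMean ι S (fun A => ‖a + t • ((1 / (S : ℝ)) • ∑ i ∈ A, v i -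
        (1 / (Fintype.card ι : ℝ)) • ∑ i, v i)‖ ^ 2) ≤
      ‖a‖ ^ 2 + t ^ 2 / S * ((1 / (Fintype.card ι : ℝ)) * ∑ i, ‖v i‖ ^ 2) := by
  set N := Fintype.card ι with hN
  have hNpos : (0 : ℝ) < N := by simp [hN, Fintype.card_pos]
  have hSpos : (0 : ℝ) < S := by exact_mod_cast hS0
  set m : E := (1 / (N : ℝ)) • ∑ i, v i with hm
  set u : ι → E := fun i => v i - m with hu_def
  have hsum : ∑ i, v i = (N : ℝ) • m := by rw [hm, smul_smul]; field_simp; simp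
  have hu : ∑ i, u i = 0 := by
    simp only [hu_def, sum_sub_distrib, sum_const, card_univ, ← hN]
    rw [hsum, Nat.cast_smul_eq_nsmul, sub_self]
  have huv : ∑ i, ‖u i‖ ^ 2 ≤ ∑ i, ‖v i‖ ^ 2 := by
    have : ∑ i, ‖u i‖ ^ 2 = ∑ i, ‖v i‖ ^ 2 - N * ‖m‖ ^ 2 := by
      simp only [hu_def, norm_sub_sq_real, sum_add_distrib, sum_sub_distrib, ← mul_sum]
      rw [← sum_inner, hsum, inner_smul_left, real_inner_self_eq_norm_sq]
      simp [← hN]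
      ring
    have h2 : 0 ≤ N * ‖m‖ ^ 2 := by positivity
    linarith
  have hA : ∀ A : Finset ι, A.card = S →
      ‖a + t • ((1 / (S : ℝ)) • ∑ i ∈ A, v i - m)‖ ^ 2 =
        ‖a‖ ^ 2 + (∑ i ∈ A, 2 * (t / S) * inner ℝ a (u i) +
          (t / S) ^ 2 * ‖∑ i ∈ A, u i‖ ^ 2) := by
    intro A hA
    have : t • ((1 / (S : ℝ)) • ∑ i ∈ A, v i - m) = (t / S) • ∑ i ∈ A, u i := by
      simp only [hu_def, sum_sub_distrib, sum_const, hA]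
      rw [← Nat.cast_smul_eq_nsmul ℝ, smul_sub t, smul_sub (t / (S : ℝ)),
        smul_smul t (1 / (S : ℝ)), smul_smul (t / (S : ℝ)) (S : ℝ) m,
        div_mul_cancel₀ t hSpos.ne', mul_one_div]
    rw [this, norm_add_sq_real, inner_smul_right, norm_smul, mul_pow, Real.norm_eq_abs, sq_abs,
      inner_sum, ← mul_sum]
    ring
  calc _ ≤ subsetMean ι S (fun A => ‖a‖ ^ 2 + (∑ i ∈ A, 2 * (t / S) * inner ℝ a (u i) +
          (t / S) ^ 2 * ‖∑ i ∈ A, u i‖ ^ 2)) := subsetMean_mono fun A h => (hA A h).le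
    _ = ‖a‖ ^ 2 + (S / N * ∑ i, 2 * (t / S) * inner ℝ a (u i) +
          (t / S) ^ 2 * subsetMean ι S (fun A => ‖∑ i ∈ A, u i‖ ^ 2)) := by
        rw [subsetMean_add, subsetMean_const hS, subsetMean_add, subsetMean_sum hS,
          subsetMean_const_mul]
    _ = ‖a‖ ^ 2 + (t / S) ^ 2 * subsetMean ι S (fun A => ‖∑ i ∈ A, u i‖ ^ 2) := by
        rw [← mul_sum, ← inner_sum, hu]; simp
    _ ≤ ‖a‖ ^ 2 + (t / S) ^ 2 * (S / N * ∑ i, ‖v i‖ ^ 2) := by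
        gcongr
        refine (subsetMean_norm_sum_sq_le hS u hu).trans ?_
        gcongr
    _ = _ := by field_simp

end Sampling

/-! ### Expectations over independent random elements -/

section Independence
open scoped ENNReal
variable {Ω : Type*} {m₁ m₂ : MeasurableSpace Ω} {mΩ : MeasurableSpace Ω} {μ : Measure Ω}

/-- Fubini's theorem for independent random elements: the second one may be replaced by an
independent copy. -/
theorem lintegral_eq_lintegral_lintegral_of_indep {α β : Type*} [MeasurableSpace α]
    [MeasurableSpace β] [IsProbabilityMeasure μ] (h₁ : m₁ ≤ mΩ)
    (h₂ : m₂ ≤ mΩ) (h : Indep m₁ m₂ μ) {X : Ω → α} {Y : Ω → β} (hX : Measurable[m₁] X)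
    (hY : Measurable[m₂] Y) {φ : α × β → ℝ≥0∞} (hφ : Measurable φ) :
    ∫⁻ ω, φ (X ω, Y ω) ∂μ = ∫⁻ ω, ∫⁻ ω', φ (X ω, Y ω') ∂μ ∂μ := by
  have hX' : Measurable X := hX.mono h₁ le_rfl
  have hY' : Measurable Y := hY.mono h₂ le_rfl
  have hXY : IndepFun X Y μ :=
    (IndepFun_iff_Indep X Y μ).2 (indep_of_indep_of_le h hX.comap_le hY.comap_le)
  have hpY : IsProbabilityMeasure (μ.map Y) := Measure.isProbabilityMeasure_map hY'.aemeasurable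
  rw [← lintegral_map (f := φ) (g := fun ω => (X ω, Y ω)) hφ (hX'.prodMk hY'),
    hXY.map_prod_eq_prod_map_map hX'.aemeasurable hY'.aemeasurable,
    lintegral_prod _ hφ.aemeasurable, lintegral_map hφ.lintegral_prod_right' hX']
  refine lintegral_congr fun ω => ?_
  rw [lintegral_map (f := fun y => φ (X ω, y)) (hφ.comp measurable_prodMk_left) hY']

/-- A bound on the mean over a fresh sample, uniform in the past, bounds the total mean. -/
theorem lintegral_le_of_indep {α Z : Type*} [MeasurableSpace α] [MeasurableSpace Z]
    [IsProbabilityMeasure μ] (h₁ : m₁ ≤ mΩ) {X : Ω → α} (hX : Measurable[m₁] X) {ζ : Ω → Z}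
    (hζ : Measurable ζ) (hind : Indep m₁ (MeasurableSpace.comap ζ inferInstance) μ)
    {φ : α → Z → ℝ≥0∞} (hφ : Measurable (Function.uncurry φ)) {g : α → ℝ≥0∞}
    (h : ∀ a, ∫⁻ z, φ a z ∂(μ.map ζ) ≤ g a) :
    ∫⁻ ω, φ (X ω) (ζ ω) ∂μ ≤ ∫⁻ ω, g (X ω) ∂μ := by
  have h2 := lintegral_eq_lintegral_lintegral_of_indep h₁ hζ.comap_le hind hX
    (comap_measurable ζ) hφ
  simp only [Function.uncurry] at h2
  rw [h2]
  refine lintegral_mono fun ω => ?_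
  refine le_trans (le_of_eq ?_) (h (X ω))
  rw [lintegral_map hφ.of_uncurry_left hζ]

theorem enorm_sq_eq_ofReal {E : Type*} [SeminormedAddCommGroup E] (v : E) :
    ‖v‖ₑ ^ 2 = ENNReal.ofReal (‖v‖ ^ 2) := by
  rw [← ofReal_norm, ENNReal.ofReal_pow (norm_nonneg _)]

/-- A bound on the second moment in `ℝ≥0∞` gives integrability of the square and a bound on its
expectation. -/
theorem integrable_norm_sq_of_lintegral_le {E : Type*} [SeminormedAddCommGroup E] {X : Ω → E}
    (hX : AEStronglyMeasurable X μ) {b : ℝ} (hb : 0 ≤ b)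
    (h : ∫⁻ ω, ‖X ω‖ₑ ^ 2 ∂μ ≤ ENNReal.ofReal b) :
    Integrable (fun ω => ‖X ω‖ ^ 2) μ ∧ ∫ ω, ‖X ω‖ ^ 2 ∂μ ≤ b := by
  simp only [enorm_sq_eq_ofReal] at h
  have hm : AEStronglyMeasurable (fun ω => ‖X ω‖ ^ 2) μ := hX.norm.pow 2
  have hnn : 0 ≤ᵐ[μ] fun ω => ‖X ω‖ ^ 2 := Filter.Eventually.of_forall fun ω => by positivity
  refine ⟨⟨hm, ?_⟩, ?_⟩
  · rw [hasFiniteIntegral_iff_ofReal hnn]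
    exact h.trans_lt ENNReal.ofReal_lt_top
  · rw [integral_eq_lintegral_of_nonneg_ae hnn hm]
    exact ENNReal.toReal_le_of_le_ofReal hb h

end Independence

theorem measurable_add_const_smul {α E : Type*} {_ : MeasurableSpace α} [NormedAddCommGroup E]
    [NormedSpace ℝ E] [MeasurableSpace E] [BorelSpace E] [SecondCountableTopology E] {f g : α → E}
    (hf : Measurable f) (hg : Measurable g) (t : ℝ) : Measurable fun a => f a + t • g a :=
  hf.add (hg.const_smul t)

/-! ### The noise of the stochastic gradients -/

section Noise
open scoped ENNReal
variable {d N : ℕ} {Z : Type*} [MeasurableSpace Z]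
  {F : EuclideanSpace ℝ (Fin d) → Z → ℝ} {D : Fin N → Measure Z} {L σ : ℝ}

/-- The error `∇F(x; z) - ∇f_i(x)` of the stochastic gradient of client `i`. -/
def gradientNoise (F : EuclideanSpace ℝ (Fin d) → Z → ℝ) (D : Fin N → Measure Z) (i : Fin N)
    (x : EuclideanSpace ℝ (Fin d)) (z : Z) : EuclideanSpace ℝ (Fin d) :=
  sampleGradient F x z - gradient (localObjective F D i) x

theorem StandardSmoothness.measurable_gradient (hS : StandardSmoothness F D L) (hL : 0 < L)
    (i : Fin N) : Measurable (gradient (localObjective F D i)) := by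
  have : LipschitzWith L.toNNReal (gradient (localObjective F D i)) :=
    LipschitzWith.of_dist_le_mul fun x y => by
      rw [dist_eq_norm, dist_eq_norm, Real.coe_toNNReal _ hL.le]
      exact (hS i).2 x y
  exact this.continuous.measurable

theorem WellPosed.measurable_sampleGradient_comp (hW : WellPosed F D) {α : Type*}
    {_ : MeasurableSpace α} {y : α → EuclideanSpace ℝ (Fin d)} {ζ : α → Z} (hy : Measurable y)
    (hζ : Measurable ζ) : Measurable (fun a => sampleGradient F (y a) (ζ a)) := by
  have := hW.measurable_gradient.comp (hy.prodMk hζ)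
  exact this

theorem measurable_gradientNoise_comp (hW : WellPosed F D) (hS : StandardSmoothness F D L)
    (hL : 0 < L) (i : Fin N) {α : Type*} {_ : MeasurableSpace α}
    {y : α → EuclideanSpace ℝ (Fin d)} {ζ : α → Z} (hy : Measurable y)
    (hζ : Measurable ζ) : Measurable (fun a => gradientNoise F D i (y a) (ζ a)) := by
  have := (hW.measurable_sampleGradient_comp hy hζ).sub ((hS.measurable_gradient hL i).comp hy)
  exact this

/-- The noise of one stochastic gradient is centered with variance at most `σ ^ 2`, so it is
orthogonal to any fixed vector `a`. -/
theorem lintegral_add_smul_gradientNoise_le (hW : WellPosed F D) (hV : BoundedVariance F D σ)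
    (i : Fin N) (a x : EuclideanSpace ℝ (Fin d)) (t : ℝ) :
    ∫⁻ z, ‖a + t • gradientNoise F D i x z‖ₑ ^ 2 ∂(D i) ≤
      ‖a‖ₑ ^ 2 + ENNReal.ofReal (t ^ 2 * σ ^ 2) := by
  have := hW.isProbabilityMeasure i
  obtain ⟨h1, h2, h3, h4⟩ := hV i x
  have hn : Integrable (gradientNoise F D i x) (D i) := h1.sub (integrable_const _)
  have hn0 : ∫ z, gradientNoise F D i x z ∂(D i) = 0 := by
    unfold gradientNoise
    rw [integral_sub h1 (integrable_const _), h2]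
    simp
  have hexp : ∀ z, ‖a + t • gradientNoise F D i x z‖ ^ 2 =
      ‖a‖ ^ 2 + (2 * t * inner ℝ a (gradientNoise F D i x z) +
        t ^ 2 * ‖gradientNoise F D i x z‖ ^ 2) := by
    intro z
    rw [norm_add_sq_real, inner_smul_right, norm_smul, mul_pow, Real.norm_eq_abs, sq_abs]
    ring
  have hi1 : Integrable (fun z => 2 * t * inner ℝ a (gradientNoise F D i x z)) (D i) :=
    (hn.const_inner a).const_mul _
  have hi2 : Integrable (fun z => t ^ 2 * ‖gradientNoise F D i x z‖ ^ 2) (D i) :=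
    h3.const_mul _
  have hi12 : Integrable (fun z => 2 * t * inner ℝ a (gradientNoise F D i x z) +
      t ^ 2 * ‖gradientNoise F D i x z‖ ^ 2) (D i) := hi1.add hi2
  have hint : Integrable (fun z => ‖a + t • gradientNoise F D i x z‖ ^ 2) (D i) := by
    simp only [hexp]
    exact (integrable_const _).add hi12
  simp only [enorm_sq_eq_ofReal]
  rw [← ofReal_integral_eq_lintegral_ofReal hint
      (Filter.Eventually.of_forall fun z => by positivity),
    ← ENNReal.ofReal_add (by positivity) (by positivity)]
  refine ENNReal.ofReal_le_ofReal ?_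
  simp only [hexp]
  rw [integral_add (integrable_const _) hi12, integral_add hi1 hi2, integral_const_mul,
    integral_const_mul, integral_inner hn, hn0]
  simp only [integral_const, probReal_univ, inner_zero_right, smul_eq_mul, one_mul, mul_zero,
    zero_add]
  gcongr
  exact h4

variable {Ω : Type*} {m : MeasurableSpace Ω} {mΩ : MeasurableSpace Ω} {μ : Measure Ω}
  [IsProbabilityMeasure μ]

/-- A fresh data point contributes at most its variance to the second moment. -/
theorem lintegral_add_smul_gradientNoise_of_indep_le (hW : WellPosed F D)
    (hS : StandardSmoothness F D L) (hL : 0 < L) (hV : BoundedVariance F D σ) {i : Fin N}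
    (hm : m ≤ mΩ) {X y : Ω → EuclideanSpace ℝ (Fin d)}
    (hX : Measurable[m] X) (hy : Measurable[m] y) {ζ : Ω → Z} (hζ : Measurable ζ)
    (hlaw : μ.map ζ = D i) (hind : Indep m (MeasurableSpace.comap ζ inferInstance) μ) (t : ℝ) :
    ∫⁻ ω, ‖X ω + t • gradientNoise F D i (y ω) (ζ ω)‖ₑ ^ 2 ∂μ ≤
      ∫⁻ ω, ‖X ω‖ₑ ^ 2 ∂μ + ENNReal.ofReal (t ^ 2 * σ ^ 2) := by
  have hnoise : Measurable (fun p : (EuclideanSpace ℝ (Fin d) × EuclideanSpace ℝ (Fin d)) × Z =>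
      gradientNoise F D i p.1.2 p.2) :=
    measurable_gradientNoise_comp hW hS hL i (measurable_snd.comp measurable_fst) measurable_snd
  have h := lintegral_le_of_indep hm (hX.prodMk hy) hζ hind
    (φ := fun a z => ‖a.1 + t • gradientNoise F D i a.2 z‖ₑ ^ 2)
    (g := fun a => ‖a.1‖ₑ ^ 2 + ENNReal.ofReal (t ^ 2 * σ ^ 2))
    ((measurable_add_const_smul (measurable_fst.comp measurable_fst) hnoise t).enorm.pow_const 2)
    (fun a => by
      rw [hlaw]
      exact lintegral_add_smul_gradientNoise_le hW hV i a.1 a.2 t)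
  refine h.trans (le_of_eq ?_)
  rw [lintegral_add_right _ measurable_const, lintegral_const, measure_univ, mul_one]

/-- The gradient noise of successive steps is a martingale difference sequence, so its second
moments add up. -/
theorem lintegral_add_sum_gradientNoise_le (hW : WellPosed F D)
    (hS : StandardSmoothness F D L) (hL : 0 < L) (hV : BoundedVariance F D σ) {i : Fin N} {K : ℕ}
    {m : ℕ → MeasurableSpace Ω} (hmono : Monotone m) (hm : ∀ k, m k ≤ mΩ)
    {X : Ω → EuclideanSpace ℝ (Fin d)} (hX : Measurable[m 0] X)
    {y : ℕ → Ω → EuclideanSpace ℝ (Fin d)} (hy : ∀ k < K, Measurable[m k] (y k))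
    {ζ : ℕ → Ω → Z} (hζ : ∀ k < K, Measurable[m (k + 1)] (ζ k))
    (hlaw : ∀ k < K, μ.map (ζ k) = D i)
    (hind : ∀ k < K, Indep (m k) (MeasurableSpace.comap (ζ k) inferInstance) μ) (t : ℝ) :
    ∀ k ≤ K,
      Measurable[m k] (fun ω => X ω +
        t • ∑ j ∈ Finset.range k, gradientNoise F D i (y j ω) (ζ j ω)) ∧
      ∫⁻ ω, ‖X ω + t • ∑ j ∈ Finset.range k, gradientNoise F D i (y j ω) (ζ j ω)‖ₑ ^ 2 ∂μ ≤
        ∫⁻ ω, ‖X ω‖ₑ ^ 2 ∂μ + k * ENNReal.ofReal (t ^ 2 * σ ^ 2) := by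
  intro k
  induction k with
  | zero => intro _; simpa using hX
  | succ k ih =>
    intro hk
    obtain ⟨ih1, ih2⟩ := ih (by omega)
    have hk' : k < K := by omega
    obtain ⟨M, hM⟩ : ∃ M : Ω → EuclideanSpace ℝ (Fin d), ∀ ω, M ω = X ω +
      t • ∑ j ∈ Finset.range k, gradientNoise F D i (y j ω) (ζ j ω) := ⟨_, fun _ => rfl⟩
    have hrw : ∀ ω, X ω + t • ∑ j ∈ Finset.range (k + 1), gradientNoise F D i (y j ω) (ζ j ω) =
        M ω + t • gradientNoise F D i (y k ω) (ζ k ω) := by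
      intro ω
      rw [hM, Finset.sum_range_succ, smul_add, add_assoc]
    simp only [hrw]
    simp only [← hM] at ih1 ih2
    have h0 : Measurable[m (k + 1)] (fun ω => gradientNoise F D i (y k ω) (ζ k ω)) :=
      measurable_gradientNoise_comp hW hS hL i ((hy k hk').mono (hmono k.le_succ) le_rfl) (hζ k hk')
    have h1 : Measurable[m (k + 1)] (fun ω => M ω + t • gradientNoise F D i (y k ω) (ζ k ω)) :=
      measurable_add_const_smul (ih1.mono (hmono k.le_succ) le_rfl) h0 t
    have h2 : ∫⁻ ω, ‖M ω + t • gradientNoise F D i (y k ω) (ζ k ω)‖ₑ ^ 2 ∂μ ≤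
        ∫⁻ ω, ‖M ω‖ₑ ^ 2 ∂μ + ENNReal.ofReal (t ^ 2 * σ ^ 2) :=
      lintegral_add_smul_gradientNoise_of_indep_le (X := M) (y := y k) (ζ := ζ k) hW hS hL hV
        (hm k) ih1 (hy k hk') ((hζ k hk').mono (hm _) le_rfl) (hlaw k hk') (hind k hk') t
    refine ⟨h1, h2.trans ?_⟩
    rw [Nat.cast_succ, add_mul, one_mul, ← add_assoc]
    exact add_le_add ih2 le_rfl

/-- The local models depend only on the data points already used. -/
theorem measurable_localModel_of_adapted (hW : WellPosed F D) {m : ℕ → MeasurableSpace Ω}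
    (hmono : Monotone m) {K : ℕ} {ζ : ℕ → Ω → Z} (hζ : ∀ k < K, Measurable[m (k + 1)] (ζ k))
    (β η : ℝ) (s : State d N) (i : Fin N) :
    ∀ k ≤ K, Measurable[m k] (fun ω => localModel F β η s i (fun j => ζ j ω) k) := by
  intro k
  induction k with
  | zero => intro _; exact measurable_const
  | succ k ih =>
    intro hk
    have h1 := (ih (by omega)).mono (hmono k.le_succ) le_rfl
    have h2 : Measurable[m (k + 1)] (fun ω =>
        sampleGradient F (localModel F β η s i (fun j => ζ j ω) k) (ζ k ω)) :=
      hW.measurable_sampleGradient_comp h1 (hζ k (by omega))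
    exact h1.sub (((((h2.sub_const _).add_const _).const_smul β).add_const _).const_smul η)

end Noise

/-! ### The local steps of a round from a fixed state -/

section LocalSteps
variable {d N : ℕ} {Z : Type*} [MeasurableSpace Z]
  {F : EuclideanSpace ℝ (Fin d) → Z → ℝ} {D : Fin N → Measure Z} {L σ β η : ℝ} {K : ℕ}

/-- The mean gradient noise of client `i` over the local steps of a round. -/
def localNoise (F : EuclideanSpace ℝ (Fin d) → Z → ℝ) (D : Fin N → Measure Z) (β η : ℝ) (K : ℕ)
    (s : State d N) (i : Fin N) (ξ : ℕ → Z) : EuclideanSpace ℝ (Fin d) :=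
  (1 / (K : ℝ)) • ∑ k ∈ Finset.range K, gradientNoise F D i (localModel F β η s i ξ k) (ξ k)

/-- The mean difference between the gradients of client `i` along its local steps and at the
global model, caused by the drift of the local model. -/
def localBias (F : EuclideanSpace ℝ (Fin d) → Z → ℝ) (D : Fin N → Measure Z) (β η : ℝ) (K : ℕ)
    (s : State d N) (i : Fin N) (ξ : ℕ → Z) : EuclideanSpace ℝ (Fin d) :=
  (1 / (K : ℝ)) • ∑ k ∈ Finset.range K,
    (gradient (localObjective F D i) (localModel F β η s i ξ k) -
      gradient (localObjective F D i) s.x)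

/-- The part of a local step direction that is known when the round begins: the mean direction of
a local step taken at the global model. -/
def driftDirection (F : EuclideanSpace ℝ (Fin d) → Z → ℝ) (D : Fin N → Measure Z) (β : ℝ)
    (s : State d N) (i : Fin N) : EuclideanSpace ℝ (Fin d) :=
  β • (gradient (localObjective F D i) s.x - s.ctrl i + s.serverCtrl) + (1 - β) • s.g

/-- The new control variable of a client is its gradient at the global model, up to noise and
bias. -/
theorem newCtrl_eq (hK : 1 ≤ K) (s : State d N) (i : Fin N) (ξ : ℕ → Z) :
    newCtrl F β η K s i ξ = gradient (localObjective F D i) s.x +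
      (localNoise F D β η K s i ξ + localBias F D β η K s i ξ) := by
  have hK' : (K : ℝ) ≠ 0 := by positivity
  unfold newCtrl localNoise localBias gradientNoise
  rw [← smul_add, ← Finset.sum_add_distrib]
  simp only [sub_add_sub_cancel]
  rw [Finset.sum_sub_distrib, Finset.sum_const, Finset.card_range, smul_sub,
    ← Nat.cast_smul_eq_nsmul ℝ, smul_smul, one_div_mul_cancel hK', one_smul, add_sub_cancel]

omit [MeasurableSpace Z] in
theorem sub_localModel_eq (hK : 1 ≤ K) (s : State d N) (i : Fin N) (ξ : ℕ → Z) :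
    s.x - localModel F β η s i ξ K =
      (η * K) • (β • (newCtrl F β η K s i ξ - s.ctrl i + s.serverCtrl) + (1 - β) • s.g) := by
  have hK' : (K : ℝ) ≠ 0 := by positivity
  have h : ∀ k : ℕ, s.x - localModel F β η s i ξ k =
      η • (β • (∑ j ∈ Finset.range k, sampleGradient F (localModel F β η s i ξ j) (ξ j)
        + (k : ℝ) • (s.serverCtrl - s.ctrl i)) + (k : ℝ) • (1 - β) • s.g) := by
    intro k
    induction k with
    | zero => simp [localModel]
    | succ k ih =>
      have : s.x - localModel F β η s i ξ (k + 1) = (s.x - localModel F β η s i ξ k) +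
        η • (β • (sampleGradient F (localModel F β η s i ξ k) (ξ k) - s.ctrl i + s.serverCtrl) +
          (1 - β) • s.g) := by
        rw [localModel]; abel
      rw [this, ih, Finset.sum_range_succ]
      push_cast
      module
  have h2 : ∑ j ∈ Finset.range K, sampleGradient F (localModel F β η s i ξ j) (ξ j) =
      (K : ℝ) • newCtrl F β η K s i ξ := by
    rw [newCtrl, smul_smul, mul_one_div_cancel hK', one_smul]
  rw [h K, h2]
  module

omit [MeasurableSpace Z] in
/-- The aggregated direction is a SCAFFOLD step mixed with the momentum; the local step size `η`
cancels. -/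
theorem newDirection_eq (hK : 1 ≤ K) (hη : 0 < η) {S : ℕ} (hS : 1 ≤ S) (s : State d N)
    {A : Finset (Fin N)} (hA : A.card = S) (ξ : Fin N → ℕ → Z) :
    newDirection F β η S K s A ξ =
      β • ((1 / (S : ℝ)) • ∑ i ∈ A, (newCtrl F β η K s i (ξ i) - s.ctrl i) + s.serverCtrl) +
        (1 - β) • s.g := by
  have hK' : (K : ℝ) ≠ 0 := by positivity
  have hS' : (S : ℝ) ≠ 0 := by positivity
  unfold newDirection
  simp only [sub_localModel_eq hK]
  rw [← Finset.smul_sum, Finset.sum_add_distrib, ← Finset.smul_sum, Finset.sum_add_distrib,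
    Finset.sum_const, Finset.sum_const, hA, ← Nat.cast_smul_eq_nsmul ℝ S,
    ← Nat.cast_smul_eq_nsmul ℝ S, smul_smul]
  have : 1 / (η * S * K) * (η * K) = 1 / (S : ℝ) := by field_simp
  rw [this]
  generalize ∑ i ∈ A, (newCtrl F β η K s i (ξ i) - s.ctrl i) = M
  have h1 : ∀ v : EuclideanSpace ℝ (Fin d), (1 / (S : ℝ)) • (S : ℝ) • v = v := fun v => by
    rw [smul_smul, one_div_mul_cancel hS', one_smul]
  calc (1 / (S : ℝ)) • (β • (M + (S : ℝ) • s.serverCtrl) + (S : ℝ) • (1 - β) • s.g)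
      = β • ((1 / (S : ℝ)) • M + (1 / (S : ℝ)) • (S : ℝ) • s.serverCtrl) +
        (1 / (S : ℝ)) • (S : ℝ) • (1 - β) • s.g := by module
    _ = _ := by rw [h1, h1]

variable {Ω : Type*} {m : MeasurableSpace Ω} {mΩ : MeasurableSpace Ω} {μ : Measure Ω}

/-- The data points `ζ i k` of a round: independent, those of client `i` with law `D i`. -/
structure IndepSamples (μ : Measure Ω) (D : Fin N → Measure Z) (K : ℕ)
    (ζ : Fin N → ℕ → Ω → Z) : Prop where
  measurable : ∀ i, ∀ k < K, Measurable (ζ i k)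
  law : ∀ i, ∀ k < K, μ.map (ζ i k) = D i
  indep : iIndep (fun p : Fin N × Fin K => MeasurableSpace.comap (ζ p.1 p.2) inferInstance) μ

/-- The `σ`-algebra of all data points of the clients in `A` and the first `k` data points of
client `i`. Taking the clients one after the other, with `A` the set of those already treated, turns
all the data points of a round into a single sequence. -/
abbrev pastSigma (K : ℕ) (ζ : Fin N → ℕ → Ω → Z) (A : Finset (Fin N)) (i : Fin N) (k : ℕ) :
    MeasurableSpace Ω :=
  ⨆ p ∈ {p : Fin N × Fin K | p.1 ∈ A ∨ (p.1 = i ∧ (p.2 : ℕ) < k)},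
    MeasurableSpace.comap (ζ p.1 p.2) inferInstance

variable {ζ : Fin N → ℕ → Ω → Z}

theorem pastSigma_le (hζ : IndepSamples μ D K ζ) (A : Finset (Fin N)) (i : Fin N) (k : ℕ) :
    pastSigma K ζ A i k ≤ mΩ :=
  iSup₂_le fun p _ => (hζ.measurable p.1 p.2 p.2.2).comap_le

theorem pastSigma_mono (K : ℕ) (ζ : Fin N → ℕ → Ω → Z) (A : Finset (Fin N)) (i : Fin N) :
    Monotone (pastSigma K ζ A i) := fun _ _ hkl =>
  biSup_mono fun _ hp => hp.imp_right fun h => ⟨h.1, h.2.trans_le hkl⟩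

theorem measurable_pastSigma (K : ℕ) (ζ : Fin N → ℕ → Ω → Z) {A : Finset (Fin N)} {i j : Fin N}
    {k l : ℕ} (hl : l < K) (h : j ∈ A ∨ (j = i ∧ l < k)) :
    Measurable[pastSigma K ζ A i k] (ζ j l) := by
  have hle : MeasurableSpace.comap (ζ j l) inferInstance ≤ pastSigma K ζ A i k :=
    le_iSup₂_of_le (⟨j, ⟨l, hl⟩⟩ : Fin N × Fin K) h le_rfl
  exact (comap_measurable (ζ j l)).mono hle le_rfl

/-- The next data point of a client not yet treated is independent of the past. -/
theorem indep_pastSigma (hζ : IndepSamples μ D K ζ) {A : Finset (Fin N)} {i : Fin N}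
    (hi : i ∉ A) {k : ℕ} (hk : k < K) :
    Indep (pastSigma K ζ A i k) (MeasurableSpace.comap (ζ i k) inferInstance) μ := by
  have h := indep_iSup_of_disjoint (fun p => (hζ.measurable p.1 p.2 p.2.2).comap_le) hζ.indep
    (S := {p : Fin N × Fin K | p.1 ∈ A ∨ (p.1 = i ∧ (p.2 : ℕ) < k)}) (T := {(i, ⟨k, hk⟩)})
    (by
      rw [Set.disjoint_singleton_right]
      rintro (h | h)
      · exact hi h
      · exact lt_irrefl _ h.2)
  simpa [pastSigma] using h

theorem measurable_localModel (hW : WellPosed F D) (hζ : IndepSamples μ D K ζ) (s : State d N)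
    (i : Fin N) {k : ℕ} (hk : k ≤ K) :
    Measurable (fun ω => localModel F β η s i (fun j => ζ i j ω) k) :=
  measurable_localModel_of_adapted hW (m := fun _ => mΩ) monotone_const (hζ.measurable i) β η s i
    k hk

variable [IsProbabilityMeasure μ]

/-- Noises of different clients and different steps are uncorrelated, so that each of them adds only
its own variance to the second moment. -/
theorem lintegral_add_sum_localNoise_le (hW : WellPosed F D)
    (hS : StandardSmoothness F D L) (hL : 0 < L) (hV : BoundedVariance F D σ)
    (hζ : IndepSamples μ D K ζ) (s : State d N) (a : EuclideanSpace ℝ (Fin d)) (t : ℝ)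
    (A : Finset (Fin N)) :
    ∫⁻ ω, ‖a + t • ∑ i ∈ A, ∑ k ∈ Finset.range K,
      gradientNoise F D i (localModel F β η s i (fun j => ζ i j ω) k) (ζ i k ω)‖ₑ ^ 2 ∂μ ≤
    ‖a‖ₑ ^ 2 + A.card * (K * ENNReal.ofReal (t ^ 2 * σ ^ 2)) := by
  have hmeas : ∀ (B : Finset (Fin N)) (i j : Fin N), j ∈ B → ∀ k, k < K →
      Measurable[pastSigma K ζ B i 0] (fun ω =>
        gradientNoise F D j (localModel F β η s j (fun l => ζ j l ω) k) (ζ j k ω)) := by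
    intro B i j hj k hk
    refine measurable_gradientNoise_comp hW hS hL j ?_
      (measurable_pastSigma K ζ hk (Or.inl hj))
    exact measurable_localModel_of_adapted hW (m := fun _ => pastSigma K ζ B i 0)
      monotone_const (fun l hl => measurable_pastSigma K ζ hl (Or.inl hj)) β η s j k hk.le
  induction A using Finset.induction_on with
  | empty => simp
  | insert i A hi ih =>
    obtain ⟨M, hM⟩ : ∃ M : Ω → EuclideanSpace ℝ (Fin d), ∀ ω, M ω = a + t • ∑ i ∈ A,
      ∑ k ∈ Finset.range K, gradientNoise F D i (localModel F β η s i (fun j => ζ i j ω) k)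
        (ζ i k ω) := ⟨_, fun _ => rfl⟩
    have hMm : Measurable[pastSigma K ζ A i 0] M := by
      rw [funext hM]
      refine measurable_add_const_smul measurable_const ?_ t
      exact Finset.measurable_sum _ fun j hj => Finset.measurable_sum _ fun k hk =>
        hmeas A i j hj k (Finset.mem_range.1 hk)
    have hrw : ∀ ω, a + t • ∑ i ∈ insert i A, ∑ k ∈ Finset.range K,
        gradientNoise F D i (localModel F β η s i (fun j => ζ i j ω) k) (ζ i k ω) =
      M ω + t • ∑ k ∈ Finset.range K,
        gradientNoise F D i (localModel F β η s i (fun j => ζ i j ω) k) (ζ i k ω) := by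
      intro ω
      rw [hM, Finset.sum_insert hi, smul_add]
      abel
    simp only [← hM] at ih
    simp only [hrw]
    have hζm : ∀ k < K, Measurable[pastSigma K ζ A i (k + 1)] (ζ i k) := fun k hk =>
      measurable_pastSigma K ζ hk (Or.inr ⟨rfl, k.lt_succ_self⟩)
    have h := (lintegral_add_sum_gradientNoise_le hW hS hL hV (pastSigma_mono K ζ A i)
      (pastSigma_le hζ A i) hMm
      (fun k hk => measurable_localModel_of_adapted hW (pastSigma_mono K ζ A i) hζm β η s i k hk.le)
      hζm (hζ.law i) (fun k hk => indep_pastSigma hζ hi hk) t K le_rfl).2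
    refine h.trans ((add_le_add ih le_rfl).trans (le_of_eq ?_))
    rw [Finset.card_insert_of_notMem hi, Nat.cast_succ, add_mul, one_mul, add_assoc]

theorem one_add_two_div_pow_le {K k : ℕ} (hk : k ≤ K) : (1 + 2 / (K : ℝ)) ^ k ≤ 8 := by
  rcases Nat.eq_zero_or_pos K with h0 | hpos
  · subst h0
    obtain rfl : k = 0 := by omega
    norm_num
  have hK : (0 : ℝ) < K := by exact_mod_cast hpos
  calc (1 + 2 / (K : ℝ)) ^ k ≤ (1 + 2 / (K : ℝ)) ^ K :=
        pow_le_pow_right₀ (by have : 0 ≤ 2 / (K : ℝ) := by positivity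
                              linarith) hk
    _ ≤ (Real.exp (2 / K)) ^ K := by
        gcongr
        linarith [Real.add_one_le_exp (2 / (K : ℝ))]
    _ = Real.exp 1 ^ 2 := by
        rw [← Real.exp_nat_mul, ← Real.exp_nat_mul]
        congr 1
        field_simp
        norm_num
    _ ≤ 2.7182818286 ^ 2 := by
        gcongr
        exact Real.exp_one_lt_d9.le
    _ ≤ 8 := by norm_num

/-- Drift of a local model. One step expands the distance to the global model by at most
`1 + 2 / K`, up to the known direction and the variance of the fresh gradient. -/
theorem lintegral_localModel_sub_le (hW : WellPosed F D)
    (hS : StandardSmoothness F D L) (hL : 0 < L) (hV : BoundedVariance F D σ)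
    (hζ : IndepSamples μ D K ζ) (hβ0 : 0 ≤ β) (hβ1 : β ≤ 1) (hη : 0 < η)
    (hηL : η * K * L ≤ 1 / 8) (s : State d N) (i : Fin N) {P : ℝ}
    (hP : P = (1 + K) * η ^ 2 * ‖driftDirection F D β s i‖ ^ 2 + η ^ 2 * β ^ 2 * σ ^ 2) :
    ∀ k ≤ K, ∫⁻ ω, ‖localModel F β η s i (fun j => ζ i j ω) k - s.x‖ₑ ^ 2 ∂μ ≤
      ENNReal.ofReal (k * (1 + 2 / (K : ℝ)) ^ k * P) := by
  have hP0 : 0 ≤ P := by rw [hP]; positivity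
  intro k
  induction k with
  | zero => intro _; simp [localModel]
  | succ k ih =>
    intro hk
    have hk' : k < K := by omega
    have hKpos : (0 : ℝ) < K := by exact_mod_cast (by omega : 0 < K)
    have hκ : 1 / (K : ℝ) ≤ 1 := by
      rw [div_le_one hKpos]; exact_mod_cast (by omega : 1 ≤ K)
    have hκ0 : 0 < 1 / (K : ℝ) := by positivity
    -- `κ = 1 / K` is the parameter of Young's inequality that keeps `(1 + 2 κ) ^ K` bounded
    set κ := 1 / (K : ℝ) with hκdef
    have h2K : 2 / (K : ℝ) = 2 * κ := by rw [hκdef]; ring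
    have hηL' : η * L ≤ κ / 8 := by
      rw [hκdef, div_div, le_div_iff₀ (by positivity)]
      nlinarith
    obtain ⟨X, hX⟩ : ∃ X : Ω → EuclideanSpace ℝ (Fin d), ∀ ω, X ω =
      ((localModel F β η s i (fun j => ζ i j ω) k - s.x) -
        (η * β) • (gradient (localObjective F D i) (localModel F β η s i (fun j => ζ i j ω) k) -
          gradient (localObjective F D i) s.x)) + (-η) • driftDirection F D β s i :=
      ⟨_, fun _ => rfl⟩
    have hrw : ∀ ω, localModel F β η s i (fun j => ζ i j ω) (k + 1) - s.x =
        X ω + (-(η * β)) • gradientNoise F D i (localModel F β η s i (fun j => ζ i j ω) k)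
          (ζ i k ω) := by
      intro ω
      rw [hX, localModel, gradientNoise, driftDirection]
      module
    have hζm : ∀ k < K, Measurable[pastSigma K ζ ∅ i (k + 1)] (ζ i k) := fun k hk =>
      measurable_pastSigma K ζ hk (Or.inr ⟨rfl, k.lt_succ_self⟩)
    have hy := measurable_localModel_of_adapted hW (pastSigma_mono K ζ ∅ i) hζm β η s i k hk'.le
    have hXm : Measurable[pastSigma K ζ ∅ i k] X := by
      rw [funext hX]
      have h1 := ((hS.measurable_gradient hL i).comp hy).sub_const
        (gradient (localObjective F D i) s.x)
      exact ((hy.sub_const s.x).sub (h1.const_smul (η * β))).add_const _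
    have hstep := lintegral_add_smul_gradientNoise_of_indep_le (X := X)
      (y := fun ω => localModel F β η s i (fun j => ζ i j ω) k) (ζ := ζ i k) hW hS hL hV
      (pastSigma_le hζ ∅ i k) hXm hy (hζ.measurable i k hk') (hζ.law i k hk')
      (indep_pastSigma hζ (Finset.notMem_empty i) hk') (-(η * β))
    have hXle : ∀ ω, ‖X ω‖ₑ ^ 2 ≤ ENNReal.ofReal (1 + 2 * κ) *
        ‖localModel F β η s i (fun j => ζ i j ω) k - s.x‖ₑ ^ 2 +
        ENNReal.ofReal ((1 + K) * η ^ 2 * ‖driftDirection F D β s i‖ ^ 2) := by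
      intro ω
      rw [enorm_sq_eq_ofReal, enorm_sq_eq_ofReal, ← ENNReal.ofReal_mul (by positivity),
        ← ENNReal.ofReal_add (by positivity) (by positivity)]
      refine ENNReal.ofReal_le_ofReal ?_
      rw [hX]
      generalize localModel F β η s i (fun j => ζ i j ω) k = y
      refine (norm_add_sq_le_young _ _ hκ0).trans ?_
      have h1 : ‖(y - s.x) - (η * β) • (gradient (localObjective F D i) y -
          gradient (localObjective F D i) s.x)‖ ≤ (1 + κ / 8) * ‖y - s.x‖ := by
        refine (norm_sub_le _ _).trans ?_
        rw [norm_smul, Real.norm_eq_abs, abs_of_nonneg (by positivity)]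
        have h2 := (hS i).2 y s.x
        have h3 : η * β * ‖gradient (localObjective F D i) y -
            gradient (localObjective F D i) s.x‖ ≤ η * 1 * (L * ‖y - s.x‖) := by gcongr
        have h4 : η * L * ‖y - s.x‖ ≤ κ / 8 * ‖y - s.x‖ := by gcongr
        nlinarith
      have h5 : (1 + κ) * (1 + κ / 8) ^ 2 ≤ 1 + 2 * κ := by nlinarith [mul_nonneg hκ0.le hκ0.le]
      rw [norm_smul, mul_pow, Real.norm_eq_abs, sq_abs, neg_sq]
      have h6 : 1 / κ = K := by rw [hκdef, one_div_one_div]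
      rw [h6]
      calc _ ≤ (1 + κ) * ((1 + κ / 8) * ‖y - s.x‖) ^ 2 +
            (1 + K) * (η ^ 2 * ‖driftDirection F D β s i‖ ^ 2) := by gcongr
        _ = ((1 + κ) * (1 + κ / 8) ^ 2) * ‖y - s.x‖ ^ 2 +
            (1 + K) * η ^ 2 * ‖driftDirection F D β s i‖ ^ 2 := by ring
        _ ≤ _ := by gcongr
    simp only [hrw]
    refine hstep.trans ?_
    have hint : ∫⁻ ω, ‖X ω‖ₑ ^ 2 ∂μ ≤ ENNReal.ofReal (1 + 2 * κ) *
        ENNReal.ofReal (k * (1 + 2 / (K : ℝ)) ^ k * P) +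
        ENNReal.ofReal ((1 + K) * η ^ 2 * ‖driftDirection F D β s i‖ ^ 2) := by
      refine (lintegral_mono hXle).trans ?_
      rw [lintegral_add_right _ measurable_const, lintegral_const, measure_univ, mul_one,
        lintegral_const_mul' _ _ ENNReal.ofReal_ne_top]
      gcongr
      exact ih hk'.le
    refine (add_le_add hint le_rfl).trans ?_
    rw [← ENNReal.ofReal_mul (by positivity), ← ENNReal.ofReal_add (by positivity) (by positivity),
      ← ENNReal.ofReal_add (by positivity) (by positivity)]
    refine ENNReal.ofReal_le_ofReal ?_
    rw [h2K, Nat.cast_succ, pow_succ]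
    have hpow : 1 ≤ (1 + 2 * κ) ^ k * (1 + 2 * κ) := by
      rw [← pow_succ]; exact one_le_pow₀ (by linarith)
    calc _ = k * ((1 + 2 * κ) ^ k * (1 + 2 * κ)) * P + 1 * P := by rw [hP]; ring
      _ ≤ k * ((1 + 2 * κ) ^ k * (1 + 2 * κ)) * P + ((1 + 2 * κ) ^ k * (1 + 2 * κ)) * P := by
        gcongr
      _ = _ := by ring

omit [IsProbabilityMeasure μ] in
theorem measurable_localBias (hW : WellPosed F D) (hS : StandardSmoothness F D L) (hL : 0 < L)
    (hζ : IndepSamples μ D K ζ) (s : State d N) (i : Fin N) :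
    Measurable (fun ω => localBias F D β η K s i (fun j => ζ i j ω)) := by
  have h : ∀ k ∈ Finset.range K, Measurable (fun ω =>
      gradient (localObjective F D i) (localModel F β η s i (fun j => ζ i j ω) k) -
        gradient (localObjective F D i) s.x) := fun k hk =>
    ((hS.measurable_gradient hL i).comp
      (measurable_localModel hW hζ s i (Finset.mem_range.1 hk).le)).sub_const _
  exact (Finset.measurable_fun_sum _ h).const_smul (1 / (K : ℝ))

omit [IsProbabilityMeasure μ] in
theorem measurable_localNoise (hW : WellPosed F D) (hS : StandardSmoothness F D L) (hL : 0 < L)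
    (hζ : IndepSamples μ D K ζ) (s : State d N) (i : Fin N) :
    Measurable (fun ω => localNoise F D β η K s i (fun j => ζ i j ω)) := by
  have h : ∀ k ∈ Finset.range K, Measurable (fun ω =>
      gradientNoise F D i (localModel F β η s i (fun j => ζ i j ω) k) (ζ i k ω)) := fun k hk =>
    measurable_gradientNoise_comp hW hS hL i
      (measurable_localModel hW hζ s i (Finset.mem_range.1 hk).le)
      (hζ.measurable i k (Finset.mem_range.1 hk))
  exact (Finset.measurable_fun_sum _ h).const_smul (1 / (K : ℝ))

/-- The second moment of the bias of a client is at most `L ^ 2` times the mean squared drift of its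
local models. -/
theorem integral_localBias_sq_le (hW : WellPosed F D)
    (hS : StandardSmoothness F D L) (hL : 0 < L) (hV : BoundedVariance F D σ)
    (hζ : IndepSamples μ D K ζ) (hK : 1 ≤ K) (hβ0 : 0 ≤ β) (hβ1 : β ≤ 1) (hη : 0 < η)
    (hηL : η * K * L ≤ 1 / 8) (s : State d N) (i : Fin N) :
    Integrable (fun ω => ‖localBias F D β η K s i (fun j => ζ i j ω)‖ ^ 2) μ ∧
    ∫ ω, ‖localBias F D β η K s i (fun j => ζ i j ω)‖ ^ 2 ∂μ ≤
      8 * (η * K * L) ^ 2 * (2 * ‖driftDirection F D β s i‖ ^ 2 + β ^ 2 * σ ^ 2 / K) := by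
  have hKpos : (0 : ℝ) < K := by exact_mod_cast hK
  have hK1 : (1 : ℝ) ≤ K := by exact_mod_cast hK
  set P := (1 + K) * η ^ 2 * ‖driftDirection F D β s i‖ ^ 2 + η ^ 2 * β ^ 2 * σ ^ 2 with hP
  have hP0 : 0 ≤ P := by positivity
  have hdrift : ∀ k ∈ Finset.range K,
      Integrable (fun ω => ‖localModel F β η s i (fun j => ζ i j ω) k - s.x‖ ^ 2) μ ∧
      ∫ ω, ‖localModel F β η s i (fun j => ζ i j ω) k - s.x‖ ^ 2 ∂μ ≤ 8 * K * P := by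
    intro k hk
    have hk' := Finset.mem_range.1 hk
    refine integrable_norm_sq_of_lintegral_le
      ((measurable_localModel hW hζ s i hk'.le).sub_const _).aestronglyMeasurable
      (by positivity) ?_
    refine (lintegral_localModel_sub_le hW hS hL hV hζ hβ0 hβ1 hη hηL s i hP k hk'.le).trans ?_
    refine ENNReal.ofReal_le_ofReal ?_
    have h1 := one_add_two_div_pow_le hk'.le
    have h2 : (k : ℝ) ≤ K := by exact_mod_cast hk'.le
    calc (k : ℝ) * (1 + 2 / (K : ℝ)) ^ k * P ≤ K * 8 * P := by gcongr
      _ = _ := by ring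
  have hpt : ∀ ω, ‖localBias F D β η K s i (fun j => ζ i j ω)‖ ^ 2 ≤
      (1 / (K : ℝ)) * ∑ k ∈ Finset.range K,
        L ^ 2 * ‖localModel F β η s i (fun j => ζ i j ω) k - s.x‖ ^ 2 := by
    intro ω
    refine (norm_mean_sq_le _ (Finset.card_range K) _).trans ?_
    gcongr with k hk
    rw [← mul_pow]
    gcongr
    exact (hS i).2 _ _
  have hint : Integrable (fun ω => (1 / (K : ℝ)) * ∑ k ∈ Finset.range K,
        L ^ 2 * ‖localModel F β η s i (fun j => ζ i j ω) k - s.x‖ ^ 2) μ :=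
    (integrable_finsetSum _ fun k hk => (hdrift k hk).1.const_mul _).const_mul _
  have hint' : Integrable (fun ω => ‖localBias F D β η K s i (fun j => ζ i j ω)‖ ^ 2) μ :=
    hint.mono' ((measurable_localBias hW hS hL hζ s i).norm.pow_const 2).aestronglyMeasurable
      (Filter.Eventually.of_forall fun ω => by
        rw [Real.norm_eq_abs, abs_of_nonneg (by positivity)]; exact hpt ω)
  refine ⟨hint', (integral_mono hint' hint hpt).trans ?_⟩
  rw [integral_const_mul, integral_finsetSum _ fun k hk => (hdrift k hk).1.const_mul _]
  simp only [integral_const_mul]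
  calc (1 / (K : ℝ)) * ∑ k ∈ Finset.range K,
        L ^ 2 * ∫ ω, ‖localModel F β η s i (fun j => ζ i j ω) k - s.x‖ ^ 2 ∂μ
      ≤ (1 / (K : ℝ)) * ∑ k ∈ Finset.range K, L ^ 2 * (8 * K * P) := by
        gcongr with k hk
        exact (hdrift k hk).2
    _ = 8 * (η * K * L) ^ 2 * (((1 + K) / K) * ‖driftDirection F D β s i‖ ^ 2 +
          β ^ 2 * σ ^ 2 / K) := by
        rw [Finset.sum_const, Finset.card_range, nsmul_eq_mul, hP]
        field_simp
    _ ≤ _ := by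
        gcongr
        rw [div_le_iff₀ hKpos]
        linarith

/-- Second moment of the noise part of the aggregated direction. -/
theorem integral_add_smul_sum_localNoise_sq_le (hW : WellPosed F D)
    (hS : StandardSmoothness F D L) (hL : 0 < L) (hV : BoundedVariance F D σ)
    (hζ : IndepSamples μ D K ζ) (hK : 1 ≤ K) (s : State d N) (a : EuclideanSpace ℝ (Fin d))
    (t : ℝ) (A : Finset (Fin N)) :
    Integrable (fun ω => ‖a + t • ∑ i ∈ A, localNoise F D β η K s i (fun j => ζ i j ω)‖ ^ 2) μ ∧
    ∫ ω, ‖a + t • ∑ i ∈ A, localNoise F D β η K s i (fun j => ζ i j ω)‖ ^ 2 ∂μ ≤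
      ‖a‖ ^ 2 + A.card * (t ^ 2 * σ ^ 2 / K) := by
  have hKpos : (0 : ℝ) < K := by exact_mod_cast hK
  refine integrable_norm_sq_of_lintegral_le
    (measurable_add_const_smul measurable_const (Finset.measurable_sum _ fun i _ =>
      measurable_localNoise hW hS hL hζ s i) t).aestronglyMeasurable (by positivity) ?_
  have h := lintegral_add_sum_localNoise_le (β := β) (η := η) hW hS hL hV hζ s a (t * (1 / K)) A
  simp only [localNoise, ← Finset.smul_sum, smul_smul]
  refine h.trans (le_of_eq ?_)
  rw [enorm_sq_eq_ofReal, ← ENNReal.ofReal_natCast, ← ENNReal.ofReal_natCast,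
    ← ENNReal.ofReal_mul (by positivity), ← ENNReal.ofReal_mul (by positivity),
    ← ENNReal.ofReal_add (by positivity) (by positivity)]
  congr 2
  field_simp

end LocalSteps

/-! ### The global objective -/

section Objective
variable {d N : ℕ} {Z : Type*} [MeasurableSpace Z]
  {F : EuclideanSpace ℝ (Fin d) → Z → ℝ} {D : Fin N → Measure Z} {L : ℝ}

theorem hasGradientAt_globalObjective (hS : StandardSmoothness F D L)
    (x : EuclideanSpace ℝ (Fin d)) :
    HasGradientAt (globalObjective F D)
      ((1 / (N : ℝ)) • ∑ i, gradient (localObjective F D i) x) x := by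
  rw [hasGradientAt_iff_hasFDerivAt, map_smul, map_sum]
  have h := HasFDerivAt.fun_sum (u := Finset.univ) fun (i : Fin N) _ =>
    (hasGradientAt_iff_hasFDerivAt.1 ((hS i).1 x).hasGradientAt)
  exact h.const_mul (1 / (N : ℝ))

theorem gradient_globalObjective (hS : StandardSmoothness F D L)
    (x : EuclideanSpace ℝ (Fin d)) :
    gradient (globalObjective F D) x =
      (1 / (N : ℝ)) • ∑ i, gradient (localObjective F D i) x :=
  (hasGradientAt_globalObjective hS x).gradient

theorem differentiable_globalObjective (hS : StandardSmoothness F D L) :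
    Differentiable ℝ (globalObjective F D) := fun x =>
  (hasGradientAt_globalObjective hS x).differentiableAt

theorem norm_gradient_globalObjective_sub_le (hS : StandardSmoothness F D L) (hN : 1 ≤ N)
    (x y : EuclideanSpace ℝ (Fin d)) :
    ‖gradient (globalObjective F D) x - gradient (globalObjective F D) y‖ ≤ L * ‖x - y‖ := by
  have hN' : (0 : ℝ) < N := by exact_mod_cast hN
  rw [gradient_globalObjective hS, gradient_globalObjective hS, ← smul_sub,
    ← Finset.sum_sub_distrib, norm_smul, Real.norm_eq_abs, abs_of_nonneg (by positivity)]
  calc (1 / (N : ℝ)) * ‖∑ i, (gradient (localObjective F D i) x -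
        gradient (localObjective F D i) y)‖
      ≤ (1 / (N : ℝ)) * ∑ _i : Fin N, L * ‖x - y‖ := by
        gcongr
        exact norm_sum_le_of_le _ fun i _ => (hS i).2 x y
    _ = L * ‖x - y‖ := by
        rw [Finset.sum_const, Finset.card_univ, Fintype.card_fin, nsmul_eq_mul]
        field_simp

end Objective

/-! ### The Lyapunov function and deterministic bounds for a round -/

section Round
variable {d N : ℕ} {Z : Type*} [MeasurableSpace Z]
  {F : EuclideanSpace ℝ (Fin d) → Z → ℝ} {D : Fin N → Measure Z} {L σ β γ η fmin : ℝ} {K S : ℕ}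

/-- The error `∇f_i(x) - c_i` of the control variable of client `i`. -/
def ctrlError (F : EuclideanSpace ℝ (Fin d) → Z → ℝ) (D : Fin N → Measure Z) (s : State d N)
    (i : Fin N) : EuclideanSpace ℝ (Fin d) :=
  gradient (localObjective F D i) s.x - s.ctrl i

/-- The mean squared error of the control variables. -/
def ctrlVariance (F : EuclideanSpace ℝ (Fin d) → Z → ℝ) (D : Fin N → Measure Z)
    (s : State d N) : ℝ :=
  (1 / (N : ℝ)) * ∑ i, ‖ctrlError F D s i‖ ^ 2

/-- The squared error of the momentum direction as an estimate of the gradient at the previous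
model, which is `x + γ g` since `x` was obtained from it by a step `-γ g`. In the initial state
`g = 0`, and the formula gives `‖∇f(x⁰)‖²`. -/
def directionError (F : EuclideanSpace ℝ (Fin d) → Z → ℝ) (D : Fin N → Measure Z) (γ : ℝ)
    (s : State d N) : ℝ :=
  ‖s.g - gradient (globalObjective F D) (s.x + γ • s.g)‖ ^ 2

/-- The Lyapunov function of SCAFFOLD-M. The weight of the control variance is chosen so that its
decrease in a round outweighs the sampling error of the direction. -/
def lyapunov (F : EuclideanSpace ℝ (Fin d) → Z → ℝ) (D : Fin N → Measure Z) (fmin β γ : ℝ)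
    (S : ℕ) (s : State d N) : ℝ :=
  (globalObjective F D s.x - fmin) + γ / β * directionError F D γ s +
    12 * γ * β * N / S ^ 2 * ctrlVariance F D s

/-- The error of the new direction: the damped old error and the sampling error, which are known
once the clients are drawn, then the noise, then the bias. -/
theorem newDirection_sub_gradient_eq (hSm : StandardSmoothness F D L) (hK : 1 ≤ K) (hη : 0 < η)
    (hS : 1 ≤ S) {s : State d N} (hs : s.serverCtrl = (1 / (N : ℝ)) • ∑ i, s.ctrl i)
    {A : Finset (Fin N)} (hA : A.card = S) (ξ : Fin N → ℕ → Z) :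
    newDirection F β η S K s A ξ - gradient (globalObjective F D) s.x =
      (((1 - β) • (s.g - gradient (globalObjective F D) s.x) +
        β • ((1 / (S : ℝ)) • ∑ i ∈ A, ctrlError F D s i -
          (1 / (N : ℝ)) • ∑ i, ctrlError F D s i)) +
        (β / S) • ∑ i ∈ A, localNoise F D β η K s i (ξ i)) +
      β • ((1 / (S : ℝ)) • ∑ i ∈ A, localBias F D β η K s i (ξ i)) := by
  rw [newDirection_eq hK hη hS s hA]
  have h1 : ∑ i ∈ A, (newCtrl F β η K s i (ξ i) - s.ctrl i) = ∑ i ∈ A, ctrlError F D s i +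
      (∑ i ∈ A, localNoise F D β η K s i (ξ i) + ∑ i ∈ A, localBias F D β η K s i (ξ i)) := by
    rw [← Finset.sum_add_distrib, ← Finset.sum_add_distrib]
    refine Finset.sum_congr rfl fun i _ => ?_
    rw [newCtrl_eq (D := D) hK, ctrlError]
    abel
  have h2 : (1 / (N : ℝ)) • ∑ i, ctrlError F D s i =
      gradient (globalObjective F D) s.x - s.serverCtrl := by
    rw [hs, gradient_globalObjective hSm, ← smul_sub, ← Finset.sum_sub_distrib]
    rfl
  rw [h1, h2]
  module

/-- The decrease of the objective in an inexact gradient step. -/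
theorem globalObjective_sub_smul_le (hSm : StandardSmoothness F D L) (hN : 1 ≤ N) (hγ0 : 0 ≤ γ)
    (hγL : γ * L ≤ 1 / 24) (x g : EuclideanSpace ℝ (Fin d)) :
    globalObjective F D (x - γ • g) ≤ globalObjective F D x -
      11 / 24 * γ * ‖gradient (globalObjective F D) x‖ ^ 2 +
      13 / 24 * γ * ‖g - gradient (globalObjective F D) x‖ ^ 2 := by
  have h := le_quadratic_of_lipschitz_gradient (differentiable_globalObjective hSm)
    (norm_gradient_globalObjective_sub_le hSm hN) x (-(γ • g))
  rw [← sub_eq_add_neg] at h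
  set h0 := gradient (globalObjective F D) x
  obtain ⟨e, he⟩ : ∃ e, e = g - h0 := ⟨_, rfl⟩
  have hg : g = h0 + e := by rw [he]; abel
  rw [norm_neg, norm_smul, mul_pow, Real.norm_eq_abs, sq_abs, inner_neg_right, inner_smul_right,
    hg, inner_add_right, real_inner_self_eq_norm_sq] at h
  rw [← he, hg]
  have h1 := norm_add_sq_le_two h0 e
  have h2 : -(inner ℝ h0 e) ≤ (‖h0‖ ^ 2 + ‖e‖ ^ 2) / 2 := by
    have := norm_add_sq_real h0 e
    nlinarith [sq_nonneg ‖h0 + e‖]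
  have h3 : L / 2 * (γ ^ 2 * ‖h0 + e‖ ^ 2) ≤ γ / 48 * (2 * ‖h0‖ ^ 2 + 2 * ‖e‖ ^ 2) := by
    calc L / 2 * (γ ^ 2 * ‖h0 + e‖ ^ 2) = γ / 2 * (γ * L) * ‖h0 + e‖ ^ 2 := by ring
      _ ≤ γ / 2 * (1 / 24) * (2 * ‖h0‖ ^ 2 + 2 * ‖e‖ ^ 2) := by gcongr
      _ = _ := by ring
  nlinarith [mul_le_mul_of_nonneg_left h2 hγ0]

/-- The control variance after a round. A participating client replaces its old error by noise and
bias; the motion of the model from `x` to `x - γ g⁺` adds a multiple of `(γL)² ‖g⁺‖²`. -/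
theorem ctrlVariance_oneRound_le (hSm : StandardSmoothness F D L) (hK : 1 ≤ K) (hS1 : 1 ≤ S)
    (hSN : S ≤ N) (hL : 0 < L) (hγ : γ = β / (24 * L)) (s : State d N) (A : Finset (Fin N))
    (ξ : Fin N → ℕ → Z) :
    ctrlVariance F D (oneRound F β γ η S K s A ξ) ≤
      (1 + (S : ℝ) / (2 * N)) * ((1 / (N : ℝ)) * (∑ i, ‖ctrlError F D s i‖ ^ 2 +
        ∑ i ∈ A, (2 * ‖localNoise F D β η K s i (ξ i)‖ ^ 2 +
          2 * ‖localBias F D β η K s i (ξ i)‖ ^ 2 - ‖ctrlError F D s i‖ ^ 2))) +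
      N * β ^ 2 / (96 * S) * (‖gradient (globalObjective F D) s.x‖ ^ 2 +
        ‖newDirection F β η S K s A ξ - gradient (globalObjective F D) s.x‖ ^ 2) := by
  have hS0 : (0 : ℝ) < S := by exact_mod_cast hS1
  have hSN' : (S : ℝ) ≤ N := by exact_mod_cast hSN
  have hN0 : (0 : ℝ) < N := hS0.trans_le hSN'
  set g' := newDirection F β η S K s A ξ with hg'
  set G := gradient (globalObjective F D) s.x with hG
  -- Young's inequality with parameter `S / (2N)` loses half of the contraction by `1 - S / N`
  set t : ℝ := (S : ℝ) / (2 * N) with ht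
  have ht0 : 0 < t := by positivity
  have hterm : ∀ i, ‖ctrlError F D (oneRound F β γ η S K s A ξ) i‖ ^ 2 ≤
      (1 + t) * (‖ctrlError F D s i‖ ^ 2 + if i ∈ A then
        (2 * ‖localNoise F D β η K s i (ξ i)‖ ^ 2 +
          2 * ‖localBias F D β η K s i (ξ i)‖ ^ 2 - ‖ctrlError F D s i‖ ^ 2) else 0) +
      N * β ^ 2 / (96 * S) * (‖G‖ ^ 2 + ‖g' - G‖ ^ 2) := by
    intro i
    have hsplit : ctrlError F D (oneRound F β γ η S K s A ξ) i =
        (gradient (localObjective F D i) s.x - (oneRound F β γ η S K s A ξ).ctrl i) +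
        (gradient (localObjective F D i) (s.x - γ • g') - gradient (localObjective F D i) s.x) := by
      simp only [ctrlError, oneRound, ← hg']
      abel
    rw [hsplit]
    refine (norm_add_sq_le_young _ _ ht0).trans ?_
    have h1 : ‖gradient (localObjective F D i) s.x - (oneRound F β γ η S K s A ξ).ctrl i‖ ^ 2 ≤
        ‖ctrlError F D s i‖ ^ 2 + if i ∈ A then
        (2 * ‖localNoise F D β η K s i (ξ i)‖ ^ 2 +
          2 * ‖localBias F D β η K s i (ξ i)‖ ^ 2 - ‖ctrlError F D s i‖ ^ 2) else 0 := by
      simp only [oneRound]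
      split_ifs with hi
      · rw [newCtrl_eq (D := D) hK, sub_add_cancel_left, norm_neg]
        linarith [norm_add_sq_le_two (localNoise F D β η K s i (ξ i))
          (localBias F D β η K s i (ξ i))]
      · simp [ctrlError]
    have h2 : ‖gradient (localObjective F D i) (s.x - γ • g') -
        gradient (localObjective F D i) s.x‖ ^ 2 ≤ β ^ 2 / 576 * ‖g'‖ ^ 2 := by
      have h3 := (hSm i).2 (s.x - γ • g') s.x
      rw [sub_sub_cancel_left, norm_neg, norm_smul, Real.norm_eq_abs] at h3
      calc _ ≤ (L * (|γ| * ‖g'‖)) ^ 2 := by gcongr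
        _ = L ^ 2 * γ ^ 2 * ‖g'‖ ^ 2 := by rw [mul_pow, mul_pow, sq_abs]; ring
        _ = _ := by rw [hγ]; field_simp; ring
    have h3 : ‖g'‖ ^ 2 ≤ 2 * ‖G‖ ^ 2 + 2 * ‖g' - G‖ ^ 2 := by
      have := norm_add_sq_le_two G (g' - G)
      rwa [add_sub_cancel] at this
    have h4 : 1 + 1 / t ≤ 3 * N / S := by
      rw [ht, one_div_div, le_div_iff₀ hS0]
      field_simp
      linarith
    have h5 : (1 + 1 / t) * ‖gradient (localObjective F D i) (s.x - γ • g') -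
        gradient (localObjective F D i) s.x‖ ^ 2 ≤
        N * β ^ 2 / (96 * S) * (‖G‖ ^ 2 + ‖g' - G‖ ^ 2) := by
      calc _ ≤ 3 * N / S * (β ^ 2 / 576 * (2 * ‖G‖ ^ 2 + 2 * ‖g' - G‖ ^ 2)) := by
            gcongr
            exact h2.trans (by gcongr)
        _ = _ := by field_simp; ring
    have h6 := mul_le_mul_of_nonneg_left h1 (by positivity : 0 ≤ 1 + t)
    exact add_le_add h6 h5
  unfold ctrlVariance
  calc (1 / (N : ℝ)) * ∑ i, ‖ctrlError F D (oneRound F β γ η S K s A ξ) i‖ ^ 2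
      ≤ (1 / (N : ℝ)) * ∑ i, ((1 + t) * (‖ctrlError F D s i‖ ^ 2 + if i ∈ A then
        (2 * ‖localNoise F D β η K s i (ξ i)‖ ^ 2 +
          2 * ‖localBias F D β η K s i (ξ i)‖ ^ 2 - ‖ctrlError F D s i‖ ^ 2) else 0) +
      N * β ^ 2 / (96 * S) * (‖G‖ ^ 2 + ‖g' - G‖ ^ 2)) := by
        gcongr with i
        exact hterm i
    _ = _ := by
        rw [Finset.sum_add_distrib, ← Finset.mul_sum, Finset.sum_add_distrib, Finset.sum_const,
          Finset.card_univ, Fintype.card_fin, nsmul_eq_mul, Finset.sum_ite_mem, Finset.univ_inter]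
        field_simp

/-- The squared momentum direction in terms of the current gradient. -/
theorem norm_direction_sq_le (hSm : StandardSmoothness F D L) (hN : 1 ≤ N) (hγ0 : 0 ≤ γ)
    (hγL : γ * L ≤ 1 / 24) (s : State d N) :
    ‖s.g‖ ^ 2 ≤ 11 / 5 * (directionError F D γ s + ‖gradient (globalObjective F D) s.x‖ ^ 2) := by
  unfold directionError
  set e := s.g - gradient (globalObjective F D) (s.x + γ • s.g) with he
  set G := gradient (globalObjective F D) s.x with hG
  have h1 : ‖gradient (globalObjective F D) (s.x + γ • s.g) - G‖ ≤ 1 / 24 * ‖s.g‖ := by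
    have h := norm_gradient_globalObjective_sub_le hSm hN (s.x + γ • s.g) s.x
    rw [add_sub_cancel_left, norm_smul, Real.norm_eq_abs, abs_of_nonneg hγ0] at h
    calc _ ≤ L * (γ * ‖s.g‖) := h
      _ = γ * L * ‖s.g‖ := by ring
      _ ≤ _ := by gcongr
  have h2 : ‖s.g‖ ≤ ‖e‖ + ‖gradient (globalObjective F D) (s.x + γ • s.g) - G‖ + ‖G‖ := by
    have : s.g = e + (gradient (globalObjective F D) (s.x + γ • s.g) - G) + G := by
      rw [he]; abel
    calc ‖s.g‖ = ‖e + (gradient (globalObjective F D) (s.x + γ • s.g) - G) + G‖ := by rw [← this]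
      _ ≤ _ := norm_add₃_le
  have h3 : ‖s.g‖ ≤ 24 / 23 * (‖e‖ + ‖G‖) := by linarith
  calc ‖s.g‖ ^ 2 ≤ (24 / 23 * (‖e‖ + ‖G‖)) ^ 2 := by gcongr
    _ ≤ _ := by nlinarith [sq_nonneg (‖e‖ - ‖G‖), sq_nonneg ‖e‖, sq_nonneg ‖G‖]

/-- The momentum contracts the direction error, up to the change of the gradient in one round. -/
theorem norm_smul_direction_sub_gradient_sq_le (hSm : StandardSmoothness F D L) (hN : 1 ≤ N)
    (hL : 0 < L) (hβ0 : 0 < β) (hβ1 : β ≤ 1) (hγ : γ = β / (24 * L)) (s : State d N) :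
    (1 + β / 4) * ‖(1 - β) • (s.g - gradient (globalObjective F D) s.x)‖ ^ 2 ≤
      (1 - β) * directionError F D γ s + β / 80 *
        (directionError F D γ s + ‖gradient (globalObjective F D) s.x‖ ^ 2) := by
  have hγ0 : 0 ≤ γ := by rw [hγ]; positivity
  have hγL : γ * L = β / 24 := by rw [hγ]; field_simp
  have hg := norm_direction_sq_le hSm hN hγ0 (by rw [hγL]; linarith) s
  unfold directionError at hg ⊢
  set e := s.g - gradient (globalObjective F D) (s.x + γ • s.g) with he
  set G := gradient (globalObjective F D) s.x with hG
  have h1 : ‖gradient (globalObjective F D) (s.x + γ • s.g) - G‖ ^ 2 ≤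
      β ^ 2 / 576 * ‖s.g‖ ^ 2 := by
    have h := norm_gradient_globalObjective_sub_le hSm hN (s.x + γ • s.g) s.x
    rw [add_sub_cancel_left, norm_smul, Real.norm_eq_abs, abs_of_nonneg hγ0] at h
    calc _ ≤ (L * (γ * ‖s.g‖)) ^ 2 := by gcongr
      _ = (γ * L) ^ 2 * ‖s.g‖ ^ 2 := by ring
      _ = _ := by rw [hγL]; ring
  have h2 : s.g - G = e + (gradient (globalObjective F D) (s.x + γ • s.g) - G) := by
    rw [he]; abel
  rw [norm_smul, mul_pow, Real.norm_eq_abs, sq_abs, h2]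
  have h3 := norm_add_sq_le_young e (gradient (globalObjective F D) (s.x + γ • s.g) - G)
    (by positivity : 0 < β / 2)
  -- one factor `1 - β` absorbs the losses of Young's inequality with parameters `β / 4`, `β / 2`
  have hc1 : (1 + β / 4) * (1 - β) ^ 2 * (1 + β / 2) ≤ 1 - β := by
    have : (1 + β / 4) * (1 - β) * (1 + β / 2) ≤ 1 := by nlinarith [mul_pos hβ0 hβ0]
    nlinarith
  have hc2 : (1 + β / 4) * (1 - β) ^ 2 * (1 + 1 / (β / 2)) ≤ 3 / β := by
    rw [le_div_iff₀ hβ0]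
    have h4 : (1 + β / 4) * (1 - β) ^ 2 * (1 + 1 / (β / 2)) * β =
      ((1 + β / 4) * (1 - β)) * ((1 - β) * (β + 2)) := by field_simp
    rw [h4]
    have h5 : (1 + β / 4) * (1 - β) ≤ 1 := by nlinarith
    have h6 : (1 - β) * (β + 2) ≤ 3 := by nlinarith
    have h7 : 0 ≤ (1 - β) * (β + 2) := mul_nonneg (by linarith) (by linarith)
    nlinarith
  have hcc : 0 ≤ (1 + β / 4) * (1 - β) ^ 2 := by positivity
  calc (1 + β / 4) * ((1 - β) ^ 2 *
        ‖e + (gradient (globalObjective F D) (s.x + γ • s.g) - G)‖ ^ 2)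
      = ((1 + β / 4) * (1 - β) ^ 2) *
        ‖e + (gradient (globalObjective F D) (s.x + γ • s.g) - G)‖ ^ 2 := by ring
    _ ≤ ((1 + β / 4) * (1 - β) ^ 2) * ((1 + β / 2) * ‖e‖ ^ 2 + (1 + 1 / (β / 2)) *
        ‖gradient (globalObjective F D) (s.x + γ • s.g) - G‖ ^ 2) := by gcongr
    _ = (1 + β / 4) * (1 - β) ^ 2 * (1 + β / 2) * ‖e‖ ^ 2 +
        (1 + β / 4) * (1 - β) ^ 2 * (1 + 1 / (β / 2)) *
          ‖gradient (globalObjective F D) (s.x + γ • s.g) - G‖ ^ 2 := by ring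
    _ ≤ (1 - β) * ‖e‖ ^ 2 + 3 / β * (β ^ 2 / 576 * (11 / 5 * (‖e‖ ^ 2 + ‖G‖ ^ 2))) := by
        gcongr
        exact h1.trans (by gcongr)
    _ = (1 - β) * ‖e‖ ^ 2 + β / 80 * (11 / 12) * (‖e‖ ^ 2 + ‖G‖ ^ 2) := by field_simp; ring
    _ ≤ _ := by
        have : 0 ≤ β * (‖e‖ ^ 2 + ‖G‖ ^ 2) := by positivity
        linarith

/-- Mean squared drift direction of the clients. The control variables cancel the heterogeneity of
the gradients, up to the control variance. -/
theorem mean_driftDirection_sq_le (hSm : StandardSmoothness F D L) (hN : 1 ≤ N) (hγ0 : 0 ≤ γ)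
    (hγL : γ * L ≤ 1 / 24) (hβ0 : 0 ≤ β) (hβ1 : β ≤ 1) {s : State d N}
    (hs : s.serverCtrl = (1 / (N : ℝ)) • ∑ i, s.ctrl i) :
    (1 / (N : ℝ)) * ∑ i, ‖driftDirection F D β s i‖ ^ 2 ≤
      8 * β ^ 2 * ctrlVariance F D s + 13 * ‖gradient (globalObjective F D) s.x‖ ^ 2 +
        9 * directionError F D γ s := by
  have hN0 : (0 : ℝ) < N := by exact_mod_cast hN
  have hg := norm_direction_sq_le hSm hN hγ0 hγL s
  set G := gradient (globalObjective F D) s.x with hG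
  set v := ctrlError F D s with hv
  have hmean : (1 / (N : ℝ)) • ∑ i, v i = G - s.serverCtrl := by
    rw [hs, hG, gradient_globalObjective hSm, ← smul_sub, ← Finset.sum_sub_distrib]
    rfl
  have hvbar : ‖(1 / (N : ℝ)) • ∑ i, v i‖ ^ 2 ≤ ctrlVariance F D s :=
    norm_mean_sq_le Finset.univ (by simp) v
  set w := (1 / (N : ℝ)) • ∑ i, v i with hw
  have hterm : ∀ i, ‖driftDirection F D β s i‖ ^ 2 ≤
      4 * β ^ 2 * ‖v i‖ ^ 2 + (4 * β ^ 2 * ‖w‖ ^ 2 + 4 * ‖G‖ ^ 2 + 4 * ‖s.g‖ ^ 2) := by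
    intro i
    have heq : driftDirection F D β s i =
        (β • v i + (-β) • w) + (β • G + (1 - β) • s.g) := by
      have hc : s.serverCtrl = G - w := by rw [hmean]; abel
      simp only [driftDirection, hv, ctrlError, hc]
      module
    rw [heq]
    have h1 := norm_add_sq_le_two (β • v i + (-β) • w) (β • G + (1 - β) • s.g)
    have h2 := norm_add_sq_le_two (β • v i) ((-β) • w)
    have h3 := norm_add_sq_le_two (β • G) ((1 - β) • s.g)
    simp only [norm_smul, mul_pow, Real.norm_eq_abs, sq_abs, neg_sq] at h2 h3
    have h4 : β ^ 2 * ‖G‖ ^ 2 ≤ 1 * ‖G‖ ^ 2 := by gcongr; nlinarith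
    have h5 : (1 - β) ^ 2 * ‖s.g‖ ^ 2 ≤ 1 * ‖s.g‖ ^ 2 := by gcongr; nlinarith
    linarith
  calc (1 / (N : ℝ)) * ∑ i, ‖driftDirection F D β s i‖ ^ 2
      ≤ (1 / (N : ℝ)) * ∑ i, (4 * β ^ 2 * ‖v i‖ ^ 2 +
          (4 * β ^ 2 * ‖w‖ ^ 2 + 4 * ‖G‖ ^ 2 + 4 * ‖s.g‖ ^ 2)) := by
        gcongr with i
        exact hterm i
    _ = 4 * β ^ 2 * ctrlVariance F D s +
          (4 * β ^ 2 * ‖w‖ ^ 2 + 4 * ‖G‖ ^ 2 + 4 * ‖s.g‖ ^ 2) := by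
        rw [Finset.sum_add_distrib, ← Finset.mul_sum, Finset.sum_const, Finset.card_univ,
          Fintype.card_fin, nsmul_eq_mul, ctrlVariance, hv]
        field_simp
    _ ≤ 4 * β ^ 2 * ctrlVariance F D s + (4 * β ^ 2 * ctrlVariance F D s + 4 * ‖G‖ ^ 2 +
          4 * (11 / 5 * (directionError F D γ s + ‖G‖ ^ 2))) := by gcongr
    _ ≤ _ := by
        have h1 : 0 ≤ directionError F D γ s := sq_nonneg _
        have h2 : 0 ≤ ‖G‖ ^ 2 := sq_nonneg _
        linarith

end Round

/-! ### Measurability of a round -/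

section StateMeasurability

/-- The `σ`-algebra on states for which the four components are measurable. -/
instance State.instMeasurableSpace {d N : ℕ} : MeasurableSpace (State d N) :=
  MeasurableSpace.comap (fun s => (s.x, s.g, s.ctrl, s.serverCtrl)) inferInstance

/-- The sets of clients form a discrete measurable space. -/
instance instMeasurableSpaceFinsetFin {N : ℕ} : MeasurableSpace (Finset (Fin N)) := ⊤

instance instDiscreteMeasurableSpaceFinsetFin {N : ℕ} :
    DiscreteMeasurableSpace (Finset (Fin N)) := ⟨fun _ => trivial⟩

variable {d N : ℕ} {Z : Type*} [MeasurableSpace Z]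
  {F : EuclideanSpace ℝ (Fin d) → Z → ℝ} {D : Fin N → Measure Z} {L β γ η fmin : ℝ} {K S : ℕ}

theorem State.measurable_components : Measurable
    (fun s : State d N => (s.x, s.g, s.ctrl, s.serverCtrl)) := comap_measurable _

theorem State.measurable_x : Measurable (State.x : State d N → _) :=
  measurable_fst.comp State.measurable_components

theorem State.measurable_g : Measurable (State.g : State d N → _) :=
  (measurable_fst.comp measurable_snd).comp State.measurable_components

theorem State.measurable_ctrl (i : Fin N) : Measurable (fun s : State d N => s.ctrl i) :=
  (measurable_pi_apply i).comp
    ((measurable_fst.comp (measurable_snd.comp measurable_snd)).comp State.measurable_components)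

theorem State.measurable_serverCtrl : Measurable (State.serverCtrl : State d N → _) :=
  (measurable_snd.comp (measurable_snd.comp measurable_snd)).comp State.measurable_components

theorem State.measurable_of_components {α : Type*} {_ : MeasurableSpace α} {f : α → State d N}
    (hx : Measurable fun a => (f a).x) (hg : Measurable fun a => (f a).g)
    (hc : ∀ i, Measurable fun a => (f a).ctrl i) (hs : Measurable fun a => (f a).serverCtrl) :
    Measurable f :=
  measurable_comap_iff.2 (hx.prodMk (hg.prodMk ((measurable_pi_lambda _ hc).prodMk hs)))

theorem measurable_localModel_comp (hW : WellPosed F D) {α : Type*} {_ : MeasurableSpace α}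
    {s : α → State d N} {ξ : α → ℕ → Z} (hs : Measurable s) (hξ : Measurable ξ) (i : Fin N) :
    ∀ k, Measurable fun a => localModel F β η (s a) i (ξ a) k := by
  intro k
  induction k with
  | zero => exact State.measurable_x.comp hs
  | succ k ih =>
    have h2 := hW.measurable_sampleGradient_comp ih ((measurable_pi_apply k).comp hξ)
    exact ih.sub (((((h2.sub ((State.measurable_ctrl i).comp hs)).add
      (State.measurable_serverCtrl.comp hs)).const_smul β).add
      ((State.measurable_g.comp hs).const_smul (1 - β))).const_smul η)

theorem measurable_newCtrl_comp (hW : WellPosed F D) {α : Type*} {_ : MeasurableSpace α}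
    {s : α → State d N} {ξ : α → ℕ → Z} (hs : Measurable s) (hξ : Measurable ξ) (i : Fin N) :
    Measurable fun a => newCtrl F β η K (s a) i (ξ a) := by
  have h : ∀ k ∈ Finset.range K, Measurable fun a =>
      sampleGradient F (localModel F β η (s a) i (ξ a) k) (ξ a k) := fun k _ =>
    hW.measurable_sampleGradient_comp (measurable_localModel_comp hW hs hξ i k)
      ((measurable_pi_apply k).comp hξ)
  exact (Finset.measurable_fun_sum _ h).const_smul (1 / (K : ℝ))

theorem measurable_newDirection_comp (hW : WellPosed F D) {α : Type*} {_ : MeasurableSpace α}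
    {s : α → State d N} {ξ : α → Fin N → ℕ → Z} (hs : Measurable s) (hξ : Measurable ξ)
    (A : Finset (Fin N)) :
    Measurable fun a => newDirection F β η S K (s a) A (ξ a) := by
  have h : ∀ i ∈ A, Measurable fun a =>
      (s a).x - localModel F β η (s a) i (ξ a i) K := fun i _ =>
    (State.measurable_x.comp hs).sub
      (measurable_localModel_comp hW hs ((measurable_pi_apply i).comp hξ) i K)
  exact (Finset.measurable_fun_sum _ h).const_smul (1 / (η * S * K))

theorem measurable_oneRound_comp_of_clients (hW : WellPosed F D) {α : Type*} {_ : MeasurableSpace α}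
    {s : α → State d N} {ξ : α → Fin N → ℕ → Z} (hs : Measurable s) (hξ : Measurable ξ)
    (A : Finset (Fin N)) :
    Measurable fun a => oneRound F β γ η S K (s a) A (ξ a) := by
  have hd := measurable_newDirection_comp (S := S) (K := K) (β := β) (η := η) hW hs hξ A
  have hc : ∀ i, Measurable fun a => newCtrl F β η K (s a) i (ξ a i) := fun i =>
    measurable_newCtrl_comp hW hs ((measurable_pi_apply i).comp hξ) i
  refine State.measurable_of_components ?_ hd (fun i => ?_) ?_
  · exact (State.measurable_x.comp hs).sub (hd.const_smul γ)
  · by_cases hi : i ∈ A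
    · simpa only [oneRound, hi, if_true] using hc i
    · have h := (State.measurable_ctrl i).comp hs
      simp only [oneRound, hi, if_false]
      exact h
  · have h : ∀ i ∈ A, Measurable fun a => newCtrl F β η K (s a) i (ξ a i) - (s a).ctrl i :=
      fun i _ => (hc i).sub ((State.measurable_ctrl i).comp hs)
    exact (State.measurable_serverCtrl.comp hs).add
      ((Finset.measurable_fun_sum _ h).const_smul (1 / (N : ℝ)))

/-- A round is jointly measurable in the state, the set of clients, and the data points. -/
theorem measurable_oneRound_comp (hW : WellPosed F D) {α : Type*} {_ : MeasurableSpace α}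
    {s : α → State d N} {T : α → Finset (Fin N)} {ξ : α → Fin N → ℕ → Z} (hs : Measurable s)
    (hT : Measurable T) (hξ : Measurable ξ) :
    Measurable fun a => oneRound F β γ η S K (s a) (T a) (ξ a) := by
  have h : Measurable fun p : Finset (Fin N) × (State d N × (Fin N → ℕ → Z)) =>
      oneRound F β γ η S K p.2.1 p.1 p.2.2 :=
    measurable_from_prod_countable_right fun A =>
      measurable_oneRound_comp_of_clients hW measurable_fst measurable_snd A
  exact h.comp (hT.prodMk (hs.prodMk hξ))

theorem measurable_gradient_globalObjective (hSm : StandardSmoothness F D L) (hL : 0 < L) :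
    Measurable (gradient (globalObjective F D)) := by
  rw [funext (gradient_globalObjective hSm)]
  exact (Finset.measurable_fun_sum _ fun i _ => hSm.measurable_gradient hL i).const_smul
    (1 / (N : ℝ))

theorem measurable_lyapunov (hSm : StandardSmoothness F D L) (hL : 0 < L) :
    Measurable (lyapunov F D fmin β γ S) := by
  have hf : Measurable (globalObjective F D) :=
    (differentiable_globalObjective hSm).continuous.measurable
  have h1 : Measurable fun s : State d N => globalObjective F D s.x - fmin :=
    (hf.comp State.measurable_x).sub_const fmin
  have h2 : Measurable (directionError F D γ : State d N → ℝ) :=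
    (State.measurable_g.sub ((measurable_gradient_globalObjective hSm hL).comp
      (State.measurable_x.add (State.measurable_g.const_smul γ)))).norm.pow_const 2
  have h3 : Measurable (ctrlVariance F D : State d N → ℝ) :=
    (Finset.measurable_fun_sum _ fun i _ =>
      ((((hSm.measurable_gradient hL i).comp State.measurable_x).sub
        (State.measurable_ctrl i)).norm.pow_const 2)).const_mul _
  exact (h1.add (h2.const_mul _)).add (h3.const_mul _)

end StateMeasurability

/-! ### Expectation over the data points of a round -/

section RoundExpectation
variable {d N : ℕ} {Z : Type*} [MeasurableSpace Z]
  {F : EuclideanSpace ℝ (Fin d) → Z → ℝ} {D : Fin N → Measure Z} {L σ β γ η fmin : ℝ} {K S : ℕ}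

/-- A bound on the second moment of the drift bias of client `i` in a round. -/
def biasBound (F : EuclideanSpace ℝ (Fin d) → Z → ℝ) (D : Fin N → Measure Z) (L σ β η : ℝ)
    (K : ℕ) (s : State d N) (i : Fin N) : ℝ :=
  8 * (η * K * L) ^ 2 * (2 * ‖driftDirection F D β s i‖ ^ 2 + β ^ 2 * σ ^ 2 / K)

/-- A bound on the expected Lyapunov function after a round from state `s` with participating
clients `A`: the descent lemma, the error of the new direction, and the control variance, with noise
and bias replaced by bounds on their second moments. -/
def roundBound (F : EuclideanSpace ℝ (Fin d) → Z → ℝ) (D : Fin N → Measure Z)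
    (L σ β γ η fmin : ℝ) (K S : ℕ) (s : State d N) (A : Finset (Fin N)) : ℝ :=
  (globalObjective F D s.x - fmin) - 11 / 24 * γ * ‖gradient (globalObjective F D) s.x‖ ^ 2 +
  12 * γ * β * N / S ^ 2 * (N * β ^ 2 / (96 * S) * ‖gradient (globalObjective F D) s.x‖ ^ 2) +
  (13 / 24 * γ + γ / β + 12 * γ * β * N / S ^ 2 * (N * β ^ 2 / (96 * S))) *
    ((1 + β / 4) * (‖(1 - β) • (s.g - gradient (globalObjective F D) s.x) +
        β • ((1 / (S : ℝ)) • ∑ i ∈ A, ctrlError F D s i -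
          (1 / (N : ℝ)) • ∑ i, ctrlError F D s i)‖ ^ 2 + β ^ 2 * σ ^ 2 / (S * K)) +
      (β ^ 2 + 4 * β) * ((1 / (S : ℝ)) * ∑ i ∈ A, biasBound F D L σ β η K s i)) +
  12 * γ * β * N / S ^ 2 * ((1 + (S : ℝ) / (2 * N)) * ((1 / (N : ℝ)) *
    (∑ i, ‖ctrlError F D s i‖ ^ 2 + ∑ i ∈ A, (2 * (σ ^ 2 / K) +
      2 * biasBound F D L σ β η K s i - ‖ctrlError F D s i‖ ^ 2))))

variable {Ω : Type*} {mΩ : MeasurableSpace Ω} {μ : Measure Ω} {ζ : Fin N → ℕ → Ω → Z}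

theorem lyapunov_nonneg (hβ0 : 0 ≤ β) (hγ0 : 0 ≤ γ) (hmin : ∀ x, fmin ≤ globalObjective F D x)
    (s : State d N) : 0 ≤ lyapunov F D fmin β γ S s := by
  have h1 : 0 ≤ globalObjective F D s.x - fmin := sub_nonneg.2 (hmin _)
  have h2 : 0 ≤ directionError F D γ s := sq_nonneg _
  have h3 : 0 ≤ ctrlVariance F D s :=
    mul_nonneg (by positivity) (Finset.sum_nonneg fun _ _ => sq_nonneg _)
  have h4 : 0 ≤ 12 * γ * β * N / (S : ℝ) ^ 2 := by positivity
  exact add_nonneg (add_nonneg h1 (mul_nonneg (div_nonneg hγ0 hβ0) h2)) (mul_nonneg h4 h3)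

/-- The expectation over the data points of a round, for fixed participating clients. -/
theorem lintegral_lyapunov_oneRound_le_roundBound [IsProbabilityMeasure μ] (hW : WellPosed F D)
    (hSm : StandardSmoothness F D L) (hL : 0 < L) (hV : BoundedVariance F D σ)
    (hζ : IndepSamples μ D K ζ) (hK : 1 ≤ K) (hS1 : 1 ≤ S) (hSN : S ≤ N) (hβ0 : 0 < β)
    (hβ1 : β ≤ 1) (hη : 0 < η) (hηL : η * K * L ≤ 1 / 8) (hγ : γ = β / (24 * L))
    (hmin : ∀ x, fmin ≤ globalObjective F D x) {s : State d N}
    (hs : s.serverCtrl = (1 / (N : ℝ)) • ∑ i, s.ctrl i) {A : Finset (Fin N)} (hA : A.card = S) :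
    0 ≤ roundBound F D L σ β γ η fmin K S s A ∧
    ∫⁻ ω, ENNReal.ofReal (lyapunov F D fmin β γ S
      (oneRound F β γ η S K s A (fun i k => ζ i k ω))) ∂μ ≤
      ENNReal.ofReal (roundBound F D L σ β γ η fmin K S s A) := by
  have hS0 : (0 : ℝ) < S := by exact_mod_cast hS1
  have hN0 : (0 : ℝ) < N := hS0.trans_le (by exact_mod_cast hSN)
  have hK0 : (0 : ℝ) < K := by exact_mod_cast hK
  have hγ0 : 0 ≤ γ := by rw [hγ]; positivity
  have hγL : γ * L ≤ 1 / 24 := by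
    have : γ * L = β / 24 := by rw [hγ]; field_simp
    rw [this]; linarith
  set G := gradient (globalObjective F D) s.x with hG
  set a := (1 - β) • (s.g - G) + β • ((1 / (S : ℝ)) • ∑ i ∈ A, ctrlError F D s i -
          (1 / (N : ℝ)) • ∑ i, ctrlError F D s i) with ha
  -- the noise and the bias of the clients
  set nz : Fin N → Ω → EuclideanSpace ℝ (Fin d) := fun i ω =>
    localNoise F D β η K s i (fun k => ζ i k ω) with hnz
  set bs : Fin N → Ω → EuclideanSpace ℝ (Fin d) := fun i ω =>
    localBias F D β η K s i (fun k => ζ i k ω) with hbs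
  have hbias : ∀ i, Integrable (fun ω => ‖bs i ω‖ ^ 2) μ ∧
      ∫ ω, ‖bs i ω‖ ^ 2 ∂μ ≤ biasBound F D L σ β η K s i := fun i =>
    integral_localBias_sq_le hW hSm hL hV hζ hK hβ0.le hβ1 hη hηL s i
  have hnoise : ∀ i, Integrable (fun ω => ‖nz i ω‖ ^ 2) μ ∧
      ∫ ω, ‖nz i ω‖ ^ 2 ∂μ ≤ σ ^ 2 / K := fun i => by
    have h := integral_add_smul_sum_localNoise_sq_le (β := β) (η := η) hW hSm hL hV hζ hK s 0 1 {i}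
    simpa using h
  have hsum : Integrable (fun ω => ‖a + (β / S) • ∑ i ∈ A, nz i ω‖ ^ 2) μ ∧
      ∫ ω, ‖a + (β / S) • ∑ i ∈ A, nz i ω‖ ^ 2 ∂μ ≤ ‖a‖ ^ 2 + β ^ 2 * σ ^ 2 / (S * K) := by
    have h := integral_add_smul_sum_localNoise_sq_le (β := β) (η := η) hW hSm hL hV hζ hK s a
      (β / S) A
    refine ⟨h.1, h.2.trans (le_of_eq ?_)⟩
    rw [hA]
    field_simp
  set c₀ := 12 * γ * β * N / (S : ℝ) ^ 2 with hc₀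
  set q := 13 / 24 * γ + γ / β + c₀ * (N * β ^ 2 / (96 * S)) with hq
  have hc₀0 : 0 ≤ c₀ := by positivity
  have hq0 : 0 ≤ q := by positivity
  -- `Q` is `roundBound` before taking expectations, and dominates the Lyapunov function pathwise
  set Q : Ω → ℝ := fun ω =>
    ((globalObjective F D s.x - fmin) - 11 / 24 * γ * ‖G‖ ^ 2 +
      c₀ * (N * β ^ 2 / (96 * S) * ‖G‖ ^ 2)) +
    q * ((1 + β / 4) * ‖a + (β / S) • ∑ i ∈ A, nz i ω‖ ^ 2 +
      (β ^ 2 + 4 * β) * ((1 / (S : ℝ)) * ∑ i ∈ A, ‖bs i ω‖ ^ 2)) +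
    c₀ * ((1 + (S : ℝ) / (2 * N)) * ((1 / (N : ℝ)) * (∑ i, ‖ctrlError F D s i‖ ^ 2 +
      ∑ i ∈ A, (2 * ‖nz i ω‖ ^ 2 + 2 * ‖bs i ω‖ ^ 2 - ‖ctrlError F D s i‖ ^ 2)))) with hQ
  have hpt : ∀ ω, lyapunov F D fmin β γ S
      (oneRound F β γ η S K s A (fun i k => ζ i k ω)) ≤ Q ω := by
    intro ω
    set g' := newDirection F β η S K s A (fun i k => ζ i k ω) with hg'
    have h1 := globalObjective_sub_smul_le hSm (hS1.trans hSN) hγ0 hγL s.x g'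
    have h2 := ctrlVariance_oneRound_le (η := η) hSm hK hS1 hSN hL hγ s A (fun i k => ζ i k ω)
    have h3 : directionError F D γ (oneRound F β γ η S K s A (fun i k => ζ i k ω)) =
        ‖g' - G‖ ^ 2 := by
      simp only [directionError, oneRound, ← hg', sub_add_cancel, hG]
    have h4 : ‖g' - G‖ ^ 2 ≤ (1 + β / 4) * ‖a + (β / S) • ∑ i ∈ A, nz i ω‖ ^ 2 +
      (β ^ 2 + 4 * β) * ((1 / (S : ℝ)) * ∑ i ∈ A, ‖bs i ω‖ ^ 2) := by
      have h5 := newDirection_sub_gradient_eq (β := β) hSm hK hη hS1 hs hA (fun i k => ζ i k ω)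
      rw [hg', hG, h5]
      -- only the bias is not centered; splitting it off costs a factor `1 + β / 4`
      refine (norm_add_sq_le_young _ _ (by positivity : 0 < β / 4)).trans ?_
      rw [norm_smul, mul_pow, Real.norm_eq_abs, sq_abs]
      have h6 : ‖(1 / (S : ℝ)) • ∑ i ∈ A, bs i ω‖ ^ 2 ≤ (1 / (S : ℝ)) * ∑ i ∈ A, ‖bs i ω‖ ^ 2 :=
        norm_mean_sq_le A hA _
      have h7 : (1 + 1 / (β / 4)) * (β ^ 2 * ‖(1 / (S : ℝ)) • ∑ i ∈ A, bs i ω‖ ^ 2) =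
          (β ^ 2 + 4 * β) * ‖(1 / (S : ℝ)) • ∑ i ∈ A, bs i ω‖ ^ 2 := by
        field_simp
      refine add_le_add le_rfl (h7.le.trans ?_)
      gcongr
    rw [← hg', ← hG] at h2
    rw [← hG] at h1
    unfold lyapunov
    rw [h3]
    have h8 : globalObjective F D (oneRound F β γ η S K s A (fun i k => ζ i k ω)).x =
      globalObjective F D (s.x - γ • g') := rfl
    rw [h8]
    have h9 := mul_le_mul_of_nonneg_left h2 hc₀0
    have h10 := mul_le_mul_of_nonneg_left h4 hq0
    simp only [hQ]
    rw [hq] at h10 ⊢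
    linarith
  have hi1 : Integrable (fun ω => (1 + β / 4) * ‖a + (β / S) • ∑ i ∈ A, nz i ω‖ ^ 2) μ :=
    hsum.1.const_mul _
  have hi2 : Integrable (fun ω => (β ^ 2 + 4 * β) * ((1 / (S : ℝ)) * ∑ i ∈ A, ‖bs i ω‖ ^ 2)) μ :=
    ((integrable_finsetSum _ fun i _ => (hbias i).1).const_mul _).const_mul _
  have hi3 : ∀ i, Integrable (fun ω => 2 * ‖nz i ω‖ ^ 2 + 2 * ‖bs i ω‖ ^ 2 -
      ‖ctrlError F D s i‖ ^ 2) μ := fun i =>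
    (((hnoise i).1.const_mul 2).add ((hbias i).1.const_mul 2)).sub (integrable_const _)
  have hi4 : Integrable (fun ω => ∑ i, ‖ctrlError F D s i‖ ^ 2 +
      ∑ i ∈ A, (2 * ‖nz i ω‖ ^ 2 + 2 * ‖bs i ω‖ ^ 2 - ‖ctrlError F D s i‖ ^ 2)) μ :=
    (integrable_const _).add (integrable_finsetSum _ fun i _ => hi3 i)
  have hi5 : Integrable (fun ω => q * ((1 + β / 4) * ‖a + (β / S) • ∑ i ∈ A, nz i ω‖ ^ 2 +
      (β ^ 2 + 4 * β) * ((1 / (S : ℝ)) * ∑ i ∈ A, ‖bs i ω‖ ^ 2))) μ :=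
    (hi1.add hi2).const_mul q
  have hi6 : Integrable (fun ω => c₀ * ((1 + (S : ℝ) / (2 * N)) * ((1 / (N : ℝ)) *
      (∑ i, ‖ctrlError F D s i‖ ^ 2 +
      ∑ i ∈ A, (2 * ‖nz i ω‖ ^ 2 + 2 * ‖bs i ω‖ ^ 2 - ‖ctrlError F D s i‖ ^ 2))))) μ :=
    ((hi4.const_mul _).const_mul _).const_mul _
  have hi7 : Integrable (fun ω => ((globalObjective F D s.x - fmin) - 11 / 24 * γ * ‖G‖ ^ 2 +
      c₀ * (N * β ^ 2 / (96 * S) * ‖G‖ ^ 2)) +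
    q * ((1 + β / 4) * ‖a + (β / S) • ∑ i ∈ A, nz i ω‖ ^ 2 +
      (β ^ 2 + 4 * β) * ((1 / (S : ℝ)) * ∑ i ∈ A, ‖bs i ω‖ ^ 2))) μ :=
    (integrable_const _).add hi5
  have hQi : Integrable Q μ := hi7.add hi6
  have hQle : ∫ ω, Q ω ∂μ ≤ roundBound F D L σ β γ η fmin K S s A := by
    simp only [hQ]
    rw [integral_add hi7 hi6, integral_add (integrable_const _) hi5, integral_const_mul,
      integral_add hi1 hi2, integral_const_mul, integral_const_mul, integral_const_mul,
      integral_finsetSum _ (fun i _ => (hbias i).1), integral_const_mul, integral_const_mul,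
      integral_const_mul,
      integral_add (integrable_const _) (integrable_finsetSum _ fun i _ => hi3 i),
      integral_finsetSum _ (fun i _ => hi3 i)]
    simp only [integral_const, probReal_univ, one_smul]
    have h3 : ∀ i, ∫ ω, (2 * ‖nz i ω‖ ^ 2 + 2 * ‖bs i ω‖ ^ 2 - ‖ctrlError F D s i‖ ^ 2) ∂μ ≤
        2 * (σ ^ 2 / K) + 2 * biasBound F D L σ β η K s i - ‖ctrlError F D s i‖ ^ 2 := by
      intro i
      have hj : Integrable (fun ω => 2 * ‖nz i ω‖ ^ 2 + 2 * ‖bs i ω‖ ^ 2) μ :=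
        ((hnoise i).1.const_mul 2).add ((hbias i).1.const_mul 2)
      rw [integral_sub hj (integrable_const _),
        integral_add ((hnoise i).1.const_mul 2) ((hbias i).1.const_mul 2), integral_const_mul,
        integral_const_mul]
      simp only [integral_const, probReal_univ, one_smul]
      linarith [(hnoise i).2, (hbias i).2]
    unfold roundBound
    rw [← hG, ← ha, ← hc₀, ← hq]
    gcongr
    · exact hsum.2
    · exact (hbias _).2
    · exact h3 _
  have hΦ0 : ∀ ω, 0 ≤ lyapunov F D fmin β γ S
      (oneRound F β γ η S K s A (fun i k => ζ i k ω)) := fun ω =>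
    lyapunov_nonneg hβ0.le hγ0 hmin _
  have hQ0 : ∀ ω, 0 ≤ Q ω := fun ω => (hΦ0 ω).trans (hpt ω)
  refine ⟨(integral_nonneg hQ0).trans hQle, ?_⟩
  calc _ ≤ ∫⁻ ω, ENNReal.ofReal (Q ω) ∂μ :=
        lintegral_mono fun ω => ENNReal.ofReal_le_ofReal (hpt ω)
    _ = ENNReal.ofReal (∫ ω, Q ω ∂μ) :=
        (ofReal_integral_eq_lintegral_ofReal hQi (Filter.Eventually.of_forall hQ0)).symm
    _ ≤ _ := ENNReal.ofReal_le_ofReal hQle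

end RoundExpectation

/-! ### Decrease of the Lyapunov function in a round -/

section RoundDecrease

theorem measurable_pi_pi {α ι κ Z : Type*} {_ : MeasurableSpace α} [MeasurableSpace Z]
    {ζ : ι → κ → α → Z} (h : ∀ i k, Measurable (ζ i k)) : Measurable fun a i k => ζ i k a :=
  measurable_pi_lambda _ fun i => measurable_pi_lambda _ fun k => h i k

/-- The arithmetic of one round. Here `n`, `s`, `k` are the numbers of clients, of participating
clients and of local steps, `v` is the variance of a sample, `G` the squared gradient, `E` the
direction error, `V` the control variance, `B` the mean squared bias, and `a` the squared damped
direction error. -/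
theorem round_decrease_arith {n s k β γ v G E V B a : ℝ} (hs1 : 1 ≤ s) (hsn : s ≤ n)
    (hk : 1 ≤ k) (hβ0 : 0 < β) (hβ1 : β ≤ 1) (hγ0 : 0 ≤ γ) (hv : 0 ≤ v) (hG : 0 ≤ G) (hE : 0 ≤ E)
    (hV : 0 ≤ V) (hB0 : 0 ≤ B) (hρ : β ^ 3 * n ^ 2 ≤ s ^ 3)
    (ha : (1 + β / 4) * a ≤ (1 - β) * E + β / 80 * (E + G))
    (hB : B ≤ 1 / (1000 * s) * (β ^ 2 * V + G + E + β ^ 2 * v / k)) :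
    -(11 / 24 * γ * G) + 12 * γ * β * n / s ^ 2 * (n * β ^ 2 / (96 * s) * G) +
      (13 / 24 * γ + γ / β + 12 * γ * β * n / s ^ 2 * (n * β ^ 2 / (96 * s))) *
        ((1 + β / 4) * (a + β ^ 2 / s * V + β ^ 2 * v / (s * k)) + (β ^ 2 + 4 * β) * B) +
      12 * γ * β * n / s ^ 2 * ((1 + s / (2 * n)) * (V + s / n * (2 * (v / k) + 2 * B - V))) ≤
    γ / β * E + 12 * γ * β * n / s ^ 2 * V - γ / 4 * G + 42 * γ * β * v / (s * k) := by
  have hs0 : 0 < s := by linarith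
  have hn0 : 0 < n := by linarith
  have hk0 : 0 < k := by linarith
  -- `r ≤ 1` is the cost of the motion of the model, and `γ p / β` is the weight of the new error
  obtain ⟨r, hr⟩ : ∃ r, r = β ^ 3 * n ^ 2 / s ^ 3 := ⟨_, rfl⟩
  have hr0 : 0 ≤ r := by rw [hr]; positivity
  have hr1 : r ≤ 1 := by rw [hr]; exact (div_le_one (by positivity)).2 hρ
  obtain ⟨u, hu⟩ : ∃ u, u = V / s := ⟨_, rfl⟩
  obtain ⟨w, hw⟩ : ∃ w, w = v / (s * k) := ⟨_, rfl⟩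
  obtain ⟨x, hx⟩ : ∃ x, x = s / n := ⟨_, rfl⟩
  have hu0 : 0 ≤ u := by rw [hu]; positivity
  have hw0 : 0 ≤ w := by rw [hw]; positivity
  have hx0 : 0 < x := by rw [hx]; positivity
  have hx1 : x ≤ 1 := by rw [hx]; exact (div_le_one hn0).2 hsn
  obtain ⟨p, hp⟩ : ∃ p, p = 1 + β * (13 / 24 + r / 8) := ⟨_, rfl⟩
  have hp0 : 0 ≤ p := by rw [hp]; positivity
  have hp1 : p ≤ 5 / 3 := by
    rw [hp]
    nlinarith
  have hβr : β * r ≤ r := by nlinarith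
  have hBle : B ≤ 1 / 1000 * (β * u + G + E + β * w) := by
    refine hB.trans ?_
    have h1 : 1 / (1000 * s) * (β ^ 2 * V + G + E + β ^ 2 * v / k) =
        1 / 1000 * (β ^ 2 * u + (G + E) * (1 / s) + β ^ 2 * w) := by
      rw [hu, hw]; field_simp; ring
    rw [h1]
    have h2 : 1 / s ≤ 1 := (div_le_one hs0).2 hs1
    have h3 : (G + E) * (1 / s) ≤ (G + E) * 1 := by gcongr
    have h4 : β ^ 2 ≤ β := by nlinarith
    have h5 : β ^ 2 * u ≤ β * u := by gcongr
    have h6 : β ^ 2 * w ≤ β * w := by gcongr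
    linarith
  -- the four groups of terms, divided by `γ`
  have t1 : p / β * ((1 + β / 4) * a) ≤ E / β - E / 3 + 1 / 48 * (E + G) := by
    have h1 : p / β * ((1 + β / 4) * a) ≤ p / β * ((1 - β) * E + β / 80 * (E + G)) := by gcongr
    have h2 : p / β * ((1 - β) * E + β / 80 * (E + G)) =
        (p * (1 - β)) / β * E + p / 80 * (E + G) := by field_simp
    have h3 : p * (1 - β) ≤ 1 - β / 3 := by
      rw [hp]
      have h7 : β * (13 / 24 + r / 8) ≤ β * (2 / 3) := by gcongr; linarith
      have h8 : 0 ≤ β * (13 / 24 + r / 8) * β := by positivity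
      linarith
    have h4 : (p * (1 - β)) / β * E ≤ (1 - β / 3) / β * E := by gcongr
    have h5 : (1 - β / 3) / β * E = E / β - E / 3 := by field_simp
    have h6 : p / 80 * (E + G) ≤ 5 / 3 / 80 * (E + G) := by gcongr
    linarith
  have t2 : p / β * ((1 + β / 4) * (β ^ 2 / s * V + β ^ 2 * v / (s * k))) ≤
      25 / 12 * β * (u + w) := by
    have h1 : p / β * ((1 + β / 4) * (β ^ 2 / s * V + β ^ 2 * v / (s * k))) =
        p * (1 + β / 4) * (β * (u + w)) := by rw [hu, hw]; field_simp
    rw [h1]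
    have h2 : p * (1 + β / 4) ≤ 5 / 3 * (5 / 4) := by
      have : 1 + β / 4 ≤ 5 / 4 := by linarith
      gcongr
    have h3 : 0 ≤ β * (u + w) := by positivity
    have h4 := mul_le_mul_of_nonneg_right h2 h3
    linarith
  have t3 : p / β * ((β ^ 2 + 4 * β) * B) ≤ 25 / 3 * B := by
    have h1 : p / β * ((β ^ 2 + 4 * β) * B) = p * (β + 4) * B := by field_simp
    rw [h1]
    have h2 : p * (β + 4) ≤ 5 / 3 * 5 := by
      have : β + 4 ≤ 5 := by linarith
      gcongr
    have h3 := mul_le_mul_of_nonneg_right h2 hB0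
    linarith
  have t4 : 12 * β * n / s ^ 2 * ((1 + s / (2 * n)) * (V + s / n * (2 * (v / k) + 2 * B - V))) ≤
      12 * β * n / s ^ 2 * V - 6 * β * u + 36 * β * w + 36 * B := by
    have h1 : 12 * β * n / s ^ 2 *
          ((1 + s / (2 * n)) * (V + s / n * (2 * (v / k) + 2 * B - V))) =
        12 * β * n / s ^ 2 * V - 6 * β * u - 6 * β * u * x + (1 + x / 2) * (24 * β * w) +
          (1 + x / 2) * (24 * (β / s) * B) := by
      rw [hu, hw, hx]; field_simp; ring
    rw [h1]
    have h2 : 0 ≤ 6 * β * u * x := by positivity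
    have h3 : (1 + x / 2) * (24 * β * w) ≤ 3 / 2 * (24 * β * w) := by
      have : 1 + x / 2 ≤ 3 / 2 := by linarith
      gcongr
    have h4 : (1 + x / 2) * (24 * (β / s) * B) ≤ 3 / 2 * (24 * 1 * B) := by
      have h5 : 1 + x / 2 ≤ 3 / 2 := by linarith
      have h6 : β / s ≤ 1 := (div_le_one hs0).2 (by linarith)
      gcongr
    linarith
  have e1 : 12 * γ * β * n / s ^ 2 * (n * β ^ 2 / (96 * s) * G) = γ * (r / 8 * G) := by
    rw [hr]; field_simp; ring
  have e2 : 13 / 24 * γ + γ / β + 12 * γ * β * n / s ^ 2 * (n * β ^ 2 / (96 * s)) =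
      γ * (p / β) := by
    rw [hp, hr]; field_simp; ring
  have e3 : ∀ y, 12 * γ * β * n / s ^ 2 * y = γ * (12 * β * n / s ^ 2 * y) := fun y => by ring
  have e4 : 42 * γ * β * v / (s * k) = γ * (42 * β * w) := by rw [hw]; ring
  have e5 : γ / β * E = γ * (E / β) := by ring
  rw [e1, e2, e3, e3, e4, e5]
  have hrG : r / 8 * G ≤ 1 / 8 * G := by gcongr
  have hfinal : -(11 / 24 * G) + r / 8 * G + p / β * ((1 + β / 4) *
      (a + β ^ 2 / s * V + β ^ 2 * v / (s * k)) + (β ^ 2 + 4 * β) * B) +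
      12 * β * n / s ^ 2 * ((1 + s / (2 * n)) * (V + s / n * (2 * (v / k) + 2 * B - V))) ≤
      E / β + 12 * β * n / s ^ 2 * V - 1 / 4 * G + 42 * β * w := by
    have h1 : p / β * ((1 + β / 4) *
      (a + β ^ 2 / s * V + β ^ 2 * v / (s * k)) + (β ^ 2 + 4 * β) * B) =
      p / β * ((1 + β / 4) * a) + p / β * ((1 + β / 4) * (β ^ 2 / s * V + β ^ 2 * v / (s * k))) +
      p / β * ((β ^ 2 + 4 * β) * B) := by ring
    rw [h1]
    have h2 : 0 ≤ β * u := by positivity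
    have h3 : 0 ≤ β * w := by positivity
    linarith
  have := mul_le_mul_of_nonneg_left hfinal hγ0
  linarith

variable {d N : ℕ} {Z : Type*} [MeasurableSpace Z]
  {F : EuclideanSpace ℝ (Fin d) → Z → ℝ} {D : Fin N → Measure Z} {L σ β γ η fmin : ℝ} {K S : ℕ}

/-- For small `η K L √S` the mean squared bias is a small multiple of the terms of the Lyapunov
function, the squared gradient, and the variance of the samples. -/
theorem mean_biasBound_le (hSm : StandardSmoothness F D L) (hK : 1 ≤ K) (hS1 : 1 ≤ S)
    (hSN : S ≤ N) (hL : 0 < L) (hβ0 : 0 ≤ β) (hβ1 : β ≤ 1)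
    (hηS : (η * K * L) ^ 2 * S ≤ 1 / 250000) (hγ : γ = β / (24 * L)) {s : State d N}
    (hs : s.serverCtrl = (1 / (N : ℝ)) • ∑ i, s.ctrl i) :
    (1 / (N : ℝ)) * ∑ i, biasBound F D L σ β η K s i ≤ 1 / (1000 * S) *
      (β ^ 2 * ctrlVariance F D s + ‖gradient (globalObjective F D) s.x‖ ^ 2 +
        directionError F D γ s + β ^ 2 * σ ^ 2 / K) := by
  have hS0 : (0 : ℝ) < S := by exact_mod_cast hS1
  have hN0 : (0 : ℝ) < N := hS0.trans_le (by exact_mod_cast hSN)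
  have hγ0 : 0 ≤ γ := by rw [hγ]; positivity
  have hγL : γ * L ≤ 1 / 24 := by
    have : γ * L = β / 24 := by rw [hγ]; field_simp
    rw [this]; linarith
  have hd := mean_driftDirection_sq_le hSm (hS1.trans hSN) hγ0 hγL hβ0 hβ1 hs
  have hV : 0 ≤ ctrlVariance F D s :=
    mul_nonneg (by positivity) (Finset.sum_nonneg fun _ _ => sq_nonneg _)
  have hE : 0 ≤ directionError F D γ s := sq_nonneg _
  set V := ctrlVariance F D s
  set E := directionError F D γ s
  set G := ‖gradient (globalObjective F D) s.x‖ ^ 2 with hG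
  have hG0 : 0 ≤ G := sq_nonneg _
  have hθ : (η * K * L) ^ 2 ≤ 1 / (250000 * S) := by
    rw [le_div_iff₀ (by positivity)]
    linarith
  have heq : (1 / (N : ℝ)) * ∑ i, biasBound F D L σ β η K s i = 8 * (η * K * L) ^ 2 *
      (2 * ((1 / (N : ℝ)) * ∑ i, ‖driftDirection F D β s i‖ ^ 2) + β ^ 2 * σ ^ 2 / K) := by
    unfold biasBound
    rw [← Finset.mul_sum, Finset.sum_add_distrib, ← Finset.mul_sum, Finset.sum_const,
      Finset.card_univ, Fintype.card_fin, nsmul_eq_mul]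
    field_simp
  have hH : 0 ≤ (1 / (N : ℝ)) * ∑ i, ‖driftDirection F D β s i‖ ^ 2 :=
    mul_nonneg (by positivity) (Finset.sum_nonneg fun _ _ => sq_nonneg _)
  rw [heq]
  generalize (1 / (N : ℝ)) * ∑ i, ‖driftDirection F D β s i‖ ^ 2 = H at hd hH
  clear_value V E G
  have hw : 0 ≤ β ^ 2 * σ ^ 2 / K := by positivity
  have hV' : 0 ≤ β ^ 2 * V := by positivity
  calc 8 * (η * K * L) ^ 2 * (2 * H + β ^ 2 * σ ^ 2 / K)
      ≤ 8 * (1 / (250000 * S)) * (26 * (β ^ 2 * V + G + E + β ^ 2 * σ ^ 2 / K)) := by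
        gcongr
        linarith
    _ = 208 / 250 * (1 / (1000 * S) * (β ^ 2 * V + G + E + β ^ 2 * σ ^ 2 / K)) := by
        field_simp; ring
    _ ≤ _ := by
        have : 0 ≤ 1 / (1000 * S) * (β ^ 2 * V + G + E + β ^ 2 * σ ^ 2 / K) := by positivity
        linarith

/-- Averaged over the participating clients, the bound for one round shows that the Lyapunov
function decreases by a multiple of the squared gradient, up to the variance of the samples. -/
theorem subsetMean_roundBound_le (hSm : StandardSmoothness F D L) (hK : 1 ≤ K) (hS1 : 1 ≤ S)
    (hSN : S ≤ N) (hL : 0 < L) (hβ0 : 0 < β) (hβ1 : β ≤ 1)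
    (hηS : (η * K * L) ^ 2 * S ≤ 1 / 250000) (hβN : β ^ 3 * (N : ℝ) ^ 2 ≤ (S : ℝ) ^ 3)
    (hγ : γ = β / (24 * L)) {s : State d N}
    (hs : s.serverCtrl = (1 / (N : ℝ)) • ∑ i, s.ctrl i) :
    subsetMean (Fin N) S (roundBound F D L σ β γ η fmin K S s) ≤
      lyapunov F D fmin β γ S s - γ / 4 * ‖gradient (globalObjective F D) s.x‖ ^ 2 +
        42 * γ * β * σ ^ 2 / (S * K) := by
  have hS0 : (0 : ℝ) < S := by exact_mod_cast hS1
  have hSN' : (S : ℝ) ≤ N := by exact_mod_cast hSN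
  have hN0 : (0 : ℝ) < N := hS0.trans_le hSN'
  have hK0 : (0 : ℝ) < K := by exact_mod_cast hK
  have hγ0 : 0 ≤ γ := by rw [hγ]; positivity
  have hbm := mean_biasBound_le (σ := σ) hSm hK hS1 hSN hL hβ0.le hβ1 hηS hγ hs
  have hdir := norm_smul_direction_sub_gradient_sq_le hSm (hS1.trans hSN) hL hβ0 hβ1 hγ s
  have hV : 0 ≤ ctrlVariance F D s :=
    mul_nonneg (by positivity) (Finset.sum_nonneg fun _ _ => sq_nonneg _)
  have hE : 0 ≤ directionError F D γ s := sq_nonneg _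
  have hbias0 : ∀ i, 0 ≤ biasBound F D L σ β η K s i := fun i =>
    mul_nonneg (by positivity) (add_nonneg (mul_nonneg zero_le_two (sq_nonneg _)) (by positivity))
  have hne : Nonempty (Fin N) := ⟨⟨0, by omega⟩⟩
  have hcard : Fintype.card (Fin N) = N := Fintype.card_fin N
  have hScard : S ≤ Fintype.card (Fin N) := by rw [hcard]; exact hSN
  set G := gradient (globalObjective F D) s.x with hG
  set a := (1 - β) • (s.g - G) with ha
  set bB := biasBound F D L σ β η K s with hbB
  set V := ctrlVariance F D s with hVdef
  set Bm := (1 / (N : ℝ)) * ∑ i, bB i with hBm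
  set c₀ := 12 * γ * β * N / (S : ℝ) ^ 2 with hc₀
  set q := 13 / 24 * γ + γ / β + c₀ * (N * β ^ 2 / (96 * S)) with hq
  have hc₀0 : 0 ≤ c₀ := by positivity
  have hq0 : 0 ≤ q := by positivity
  set c₁ := (globalObjective F D s.x - fmin) - 11 / 24 * γ * ‖G‖ ^ 2 +
    c₀ * (N * β ^ 2 / (96 * S) * ‖G‖ ^ 2) + q * ((1 + β / 4) * (β ^ 2 * σ ^ 2 / (S * K))) +
    c₀ * ((1 + (S : ℝ) / (2 * N)) * V) with hc₁
  set φ : Fin N → ℝ := fun i => q * ((β ^ 2 + 4 * β) * ((1 / (S : ℝ)) * bB i)) +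
    c₀ * ((1 + (S : ℝ) / (2 * N)) * ((1 / (N : ℝ)) *
      (2 * (σ ^ 2 / K) + 2 * bB i - ‖ctrlError F D s i‖ ^ 2))) with hφ
  -- as a function of `A`, the bound is a constant, a squared sampling error, and a sum over `A`
  have hround : ∀ A : Finset (Fin N), roundBound F D L σ β γ η fmin K S s A =
      c₁ + (q * (1 + β / 4) * ‖a + β • ((1 / (S : ℝ)) • ∑ i ∈ A, ctrlError F D s i -
          (1 / (Fintype.card (Fin N) : ℝ)) • ∑ i, ctrlError F D s i)‖ ^ 2 + ∑ i ∈ A, φ i) := by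
    intro A
    unfold roundBound
    rw [← hG, ← ha, ← hbB, ← hc₀, ← hq, hcard]
    simp only [hφ, hc₁, hVdef, ctrlVariance, Finset.sum_add_distrib, ← Finset.mul_sum]
    ring
  have hsamp := subsetMean_norm_add_sampling_sq_le hS1 hScard a β (ctrlError F D s)
  have hφsum : (S : ℝ) / N * ∑ i, φ i = q * ((β ^ 2 + 4 * β) * Bm) +
      c₀ * ((1 + (S : ℝ) / (2 * N)) * (S / N * (2 * (σ ^ 2 / K) + 2 * Bm - V))) := by
    simp only [hφ, Finset.sum_add_distrib, Finset.sum_sub_distrib, ← Finset.mul_sum,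
      Finset.sum_const, Finset.card_univ, Fintype.card_fin, nsmul_eq_mul, hBm, hVdef, ctrlVariance]
    field_simp
  have harith := round_decrease_arith (n := N) (s := S) (k := K) (β := β) (γ := γ) (v := σ ^ 2)
    (G := ‖G‖ ^ 2) (E := directionError F D γ s) (V := V) (B := Bm) (a := ‖a‖ ^ 2)
    (by exact_mod_cast hS1) hSN' (by exact_mod_cast hK) hβ0 hβ1 hγ0 (sq_nonneg _) (sq_nonneg _)
    hE hV (mul_nonneg (by positivity) (Finset.sum_nonneg fun i _ => hbias0 i)) hβN hdir hbm
  rw [← hc₀, ← hq] at harith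
  have hmean : subsetMean (Fin N) S (roundBound F D L σ β γ η fmin K S s) ≤
      c₁ + (q * (1 + β / 4) * (‖a‖ ^ 2 + β ^ 2 / S * V) + (q * ((β ^ 2 + 4 * β) * Bm) +
      c₀ * ((1 + (S : ℝ) / (2 * N)) * (S / N * (2 * (σ ^ 2 / K) + 2 * Bm - V))))) := by
    rw [funext hround, subsetMean_add, subsetMean_const hScard, subsetMean_add,
      subsetMean_const_mul, subsetMean_sum hScard, ← hφsum, hcard]
    rw [hcard] at hsamp
    gcongr
    exact hsamp
  refine hmean.trans ?_
  unfold lyapunov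
  rw [← hVdef, ← hc₀, hc₁]
  linarith

variable {Ω : Type*} {mζ : MeasurableSpace Ω} {mΩ : MeasurableSpace Ω} {μ : Measure Ω}
  {ζ : Fin N → ℕ → Ω → Z}

/-- The decrease of the Lyapunov function in one round from a fixed state, in expectation over the
clients and the data points. -/
theorem lintegral_lyapunov_oneRound_le [IsProbabilityMeasure μ] (hW : WellPosed F D)
    (hSm : StandardSmoothness F D L) (hL : 0 < L) (hV : BoundedVariance F D σ)
    (hζ : IndepSamples μ D K ζ) (hK : 1 ≤ K) (hS1 : 1 ≤ S) (hSN : S ≤ N) (hβ0 : 0 < β)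
    (hβ1 : β ≤ 1) (hη : 0 < η) (hηS : (η * K * L) ^ 2 * S ≤ 1 / 250000)
    (hβN : β ^ 3 * (N : ℝ) ^ 2 ≤ (S : ℝ) ^ 3) (hγ : γ = β / (24 * L))
    (hmin : ∀ x, fmin ≤ globalObjective F D x) {s : State d N}
    (hs : s.serverCtrl = (1 / (N : ℝ)) • ∑ i, s.ctrl i) {T : Ω → Finset (Fin N)}
    (hT : Measurable T) (hTcard : ∀ ω, (T ω).card = S)
    (hTunif : ∀ A : Finset (Fin N), A.card = S → μ {ω | T ω = A} = ((N.choose S : ENNReal))⁻¹)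
    (hmζ : mζ ≤ mΩ) (hζm : ∀ i k, Measurable[mζ] (ζ i k))
    (hind : Indep (MeasurableSpace.comap T ⊤) mζ μ) :
    ∫⁻ ω, ENNReal.ofReal (lyapunov F D fmin β γ S
      (oneRound F β γ η S K s (T ω) (fun i k => ζ i k ω))) ∂μ +
      ENNReal.ofReal (γ / 4 * ‖gradient (globalObjective F D) s.x‖ ^ 2) ≤
    ENNReal.ofReal (lyapunov F D fmin β γ S s) +
      ENNReal.ofReal (42 * γ * β * σ ^ 2 / (S * K)) := by
  have hS0 : (0 : ℝ) < S := by exact_mod_cast hS1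
  have hγ0 : 0 ≤ γ := by rw [hγ]; positivity
  have hηL : η * K * L ≤ 1 / 8 := by
    have h1 : (1 : ℝ) ≤ S := by exact_mod_cast hS1
    have h2 : 0 ≤ η * K * L := by positivity
    have h3 : (η * K * L) ^ 2 ≤ (1 / 8) ^ 2 := by nlinarith [sq_nonneg (η * K * L)]
    exact le_of_sq_le_sq h3 (by norm_num)
  have hrb : ∀ A : Finset (Fin N), A.card = S → _ := fun A hA =>
    lintegral_lyapunov_oneRound_le_roundBound (fmin := fmin) hW hSm hL hV hζ hK hS1 hSN hβ0 hβ1 hη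
      hηL hγ hmin hs hA
  have hφ : Measurable fun p : Finset (Fin N) × (Fin N → ℕ → Z) =>
      ENNReal.ofReal (lyapunov F D fmin β γ S (oneRound F β γ η S K s p.1 p.2)) :=
    ((measurable_lyapunov hSm hL).comp (measurable_oneRound_comp hW measurable_const
      measurable_fst measurable_snd)).ennreal_ofReal
  have hζ' : Measurable[mζ] (fun ω i k => ζ i k ω) :=
    measurable_pi_pi hζm
  have hchoose : 0 < N.choose S := Nat.choose_pos hSN
  -- the clients are independent of the data points, and can be fixed first
  have hfub := lintegral_eq_lintegral_lintegral_of_indep (X := T) (Y := fun ω i k => ζ i k ω)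
    hT.comap_le hmζ hind (comap_measurable T) hζ' hφ
  have hmain : ∫⁻ ω, ENNReal.ofReal (lyapunov F D fmin β γ S
      (oneRound F β γ η S K s (T ω) (fun i k => ζ i k ω))) ∂μ ≤
      ENNReal.ofReal (subsetMean (Fin N) S (roundBound F D L σ β γ η fmin K S s)) := by
    refine hfub.le.trans ?_
    have hψ := lintegral_map (μ := μ) (f := fun A : Finset (Fin N) => ∫⁻ ω',
      ENNReal.ofReal (lyapunov F D fmin β γ S
        (oneRound F β γ η S K s A (fun i k => ζ i k ω'))) ∂μ) Measurable.of_discrete hT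
    rw [← hψ, lintegral_fintype]
    have hmass : ∀ A : Finset (Fin N), μ.map T {A} =
        if A.card = S then ((N.choose S : ENNReal))⁻¹ else 0 := by
      intro A
      rw [Measure.map_apply hT (measurableSet_singleton A)]
      split_ifs with h
      · exact hTunif A h
      · have : T ⁻¹' {A} = ∅ := by
          ext ω
          simp only [Set.mem_preimage, Set.mem_singleton_iff, Set.mem_empty_iff_false, iff_false]
          exact fun h' => h (h' ▸ hTcard ω)
        rw [this, measure_empty]
    simp only [hmass, mul_ite, mul_zero]
    rw [← Finset.sum_filter, ← Finset.sum_mul]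
    have hfilter : Finset.univ.filter (fun A : Finset (Fin N) => A.card = S) =
        Finset.powersetCard S Finset.univ := by
      ext A; simp
    rw [hfilter, subsetMean, Fintype.card_fin, mul_comm, ENNReal.ofReal_mul (by positivity),
      ENNReal.ofReal_inv_of_pos (by exact_mod_cast hchoose), ENNReal.ofReal_natCast,
      ENNReal.ofReal_sum_of_nonneg fun A hA => (hrb A (Finset.mem_powersetCard.1 hA).2).1]
    gcongr with A hA
    exact (hrb A (Finset.mem_powersetCard.1 hA).2).2
  have hdec := subsetMean_roundBound_le (σ := σ) (fmin := fmin) hSm hK hS1 hSN hL hβ0 hβ1 hηS hβN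
    hγ hs
  have hmean0 : 0 ≤ subsetMean (Fin N) S (roundBound F D L σ β γ η fmin K S s) :=
    mul_nonneg (by positivity)
      (Finset.sum_nonneg fun A hA => (hrb A (Finset.mem_powersetCard.1 hA).2).1)
  have hG : 0 ≤ γ / 4 * ‖gradient (globalObjective F D) s.x‖ ^ 2 :=
    mul_nonneg (by positivity) (sq_nonneg _)
  rw [← ENNReal.ofReal_add (lyapunov_nonneg hβ0.le hγ0 hmin s) (by positivity)]
  refine (add_le_add hmain le_rfl).trans ?_
  rw [← ENNReal.ofReal_add hmean0 hG]
  exact ENNReal.ofReal_le_ofReal (by linarith)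

end RoundDecrease

/-! ### Pathwise properties of a run -/

section Run
variable {d N : ℕ} {Z : Type*}
  {F : EuclideanSpace ℝ (Fin d) → Z → ℝ} {β γ η : ℝ} {K S B : ℕ}

theorem localModel_congr (s : State d N) (i : Fin N) {ξ ξ' : ℕ → Z}
    (h : ∀ k < K, ξ k = ξ' k) :
    ∀ k ≤ K, localModel F β η s i ξ k = localModel F β η s i ξ' k := by
  intro k
  induction k with
  | zero => intro _; rfl
  | succ k ih =>
    intro hk
    rw [localModel, localModel, ih (by omega), h k (by omega)]

theorem newCtrl_congr (s : State d N) (i : Fin N) {ξ ξ' : ℕ → Z} (h : ∀ k < K, ξ k = ξ' k) :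
    newCtrl F β η K s i ξ = newCtrl F β η K s i ξ' := by
  unfold newCtrl
  congr 1
  refine Finset.sum_congr rfl fun k hk => ?_
  have hk' := Finset.mem_range.1 hk
  rw [localModel_congr s i h k hk'.le, h k hk']

theorem oneRound_congr (s : State d N) (T : Finset (Fin N)) {ξ ξ' : Fin N → ℕ → Z}
    (h : ∀ i, ∀ k < K, ξ i k = ξ' i k) :
    oneRound F β γ η S K s T ξ = oneRound F β γ η S K s T ξ' := by
  unfold oneRound newDirection
  simp only [fun i => newCtrl_congr (F := F) (β := β) (η := η) s i (h i),
    fun i => localModel_congr (F := F) (β := β) (η := η) s i (h i) K le_rfl]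

theorem initialState_congr (x₀ : EuclideanSpace ℝ (Fin d)) {ξ ξ' : Fin N → ℕ → Z}
    (h : ∀ i, ∀ b < B, ξ i b = ξ' i b) :
    initialState F B x₀ ξ = initialState F B x₀ ξ' := by
  have h1 : ∀ i, ∑ b ∈ Finset.range B, sampleGradient F x₀ (ξ i b) =
      ∑ b ∈ Finset.range B, sampleGradient F x₀ (ξ' i b) := fun i =>
    Finset.sum_congr rfl fun b hb => by rw [h i b (Finset.mem_range.1 hb)]
  unfold initialState
  simp only [h1]

/-- The run depends only on the first `B` initial data points and the first `K` data points of
each round. -/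
theorem run_congr (x₀ : EuclideanSpace ℝ (Fin d)) {ξ₀ ξ₀' : Fin N → ℕ → Z}
    {T : ℕ → Finset (Fin N)} {ξ ξ' : ℕ → Fin N → ℕ → Z} (h₀ : ∀ i, ∀ b < B, ξ₀ i b = ξ₀' i b)
    (h : ∀ r i, ∀ k < K, ξ r i k = ξ' r i k) (r : ℕ) :
    run F β γ η S K B x₀ ξ₀ T ξ r = run F β γ η S K B x₀ ξ₀' T ξ' r := by
  induction r with
  | zero => exact initialState_congr x₀ h₀
  | succ r ih => rw [run, run, ih, oneRound_congr _ _ (h r)]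

/-- The server control variable is always the mean of the client control variables. -/
theorem run_serverCtrl (x₀ : EuclideanSpace ℝ (Fin d)) (ξ₀ : Fin N → ℕ → Z)
    (T : ℕ → Finset (Fin N)) (ξ : ℕ → Fin N → ℕ → Z) (r : ℕ) :
    (run F β γ η S K B x₀ ξ₀ T ξ r).serverCtrl =
      (1 / (N : ℝ)) • ∑ i, (run F β γ η S K B x₀ ξ₀ T ξ r).ctrl i := by
  induction r with
  | zero => rfl
  | succ r ih =>
    rw [run]
    simp only [oneRound]
    rw [ih, ← smul_add]
    congr 1
    generalize run F β γ η S K B x₀ ξ₀ T ξ r = s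
    have h : ∀ i, (if i ∈ T r then newCtrl F β η K s i (ξ r i) else s.ctrl i) =
        s.ctrl i + if i ∈ T r then newCtrl F β η K s i (ξ r i) - s.ctrl i else 0 := by
      intro i
      split_ifs <;> abel
    simp only [h, Finset.sum_add_distrib, Finset.sum_ite_mem, Finset.univ_inter]

/-- With server step size `0` the model never moves. -/
theorem run_x_of_gamma_eq_zero (x₀ : EuclideanSpace ℝ (Fin d)) (ξ₀ : Fin N → ℕ → Z)
    (T : ℕ → Finset (Fin N)) (ξ : ℕ → Fin N → ℕ → Z) (r : ℕ) :
    (run F β 0 η S K B x₀ ξ₀ T ξ r).x = x₀ := by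
  induction r with
  | zero => rfl
  | succ r ih => simp [run, oneRound, ih]

end Run

/-! ### The draws of a run and their independence -/

section Draws
variable {d N : ℕ} {Z Ω : Type*} [MeasurableSpace Z] {mΩ : MeasurableSpace Ω} {μ : Measure Ω}
  {F : EuclideanSpace ℝ (Fin d) → Z → ℝ} {D : Fin N → Measure Z} {β γ η : ℝ} {K S R B : ℕ}
  {ξ₀ : Fin N → ℕ → Ω → Z} {T : ℕ → Ω → Finset (Fin N)} {ξ : ℕ → Fin N → ℕ → Ω → Z}

/-- The `σ`-algebra generated by a single draw: an initial data point, a data point of a local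
step, or a set of clients. This is the family whose independence `Draws` asserts. -/
abbrev drawSigma (R K B : ℕ) (ξ₀ : Fin N → ℕ → Ω → Z) (T : ℕ → Ω → Finset (Fin N))
    (ξ : ℕ → Fin N → ℕ → Ω → Z) :
    (Fin N × Fin B) ⊕ ((Fin R × Fin N × Fin K) ⊕ Fin R) → MeasurableSpace Ω
  | .inl (i, b) => MeasurableSpace.comap (ξ₀ i b) inferInstance
  | .inr (.inl (r, i, k)) => MeasurableSpace.comap (ξ r i k) inferInstance
  | .inr (.inr r) => MeasurableSpace.comap (T r) ⊤

theorem Draws.iIndep_drawSigma (hD : Draws μ D S K R B ξ₀ T ξ) :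
    iIndep (drawSigma R K B ξ₀ T ξ) μ := by
  convert hD.indep using 2 with j
  rcases j with ⟨i, b⟩ | ⟨r, i, k⟩ | r <;> rfl

theorem Draws.measurable_T (hD : Draws μ D S K R B ξ₀ T ξ) {r : ℕ} (hr : r < R) :
    Measurable (T r) := by
  refine measurable_to_countable' fun A => ?_
  exact hD.measurable_clients r hr A

theorem Draws.drawSigma_le (hD : Draws μ D S K R B ξ₀ T ξ)
    (j : (Fin N × Fin B) ⊕ ((Fin R × Fin N × Fin K) ⊕ Fin R)) :
    drawSigma R K B ξ₀ T ξ j ≤ mΩ := by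
  rcases j with ⟨i, b⟩ | ⟨r, i, k⟩ | r
  · exact (hD.measurable_init i b b.2).comap_le
  · exact (hD.measurable_step r r.2 i k k.2).comap_le
  · exact (hD.measurable_T r.2).comap_le

/-- The draws made before round `r`. -/
def pastDraws (N R K B r : ℕ) : Set ((Fin N × Fin B) ⊕ ((Fin R × Fin N × Fin K) ⊕ Fin R)) :=
  {j | Sum.elim (fun _ => True)
    (Sum.elim (fun p : Fin R × Fin N × Fin K => (p.1 : ℕ) < r) (fun r' : Fin R => (r' : ℕ) < r)) j}

/-- The data points drawn in round `r`. -/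
def roundSamples (N R K B r : ℕ) : Set ((Fin N × Fin B) ⊕ ((Fin R × Fin N × Fin K) ⊕ Fin R)) :=
  {j | Sum.elim (fun _ => False)
    (Sum.elim (fun p : Fin R × Fin N × Fin K => (p.1 : ℕ) = r) (fun _ => False)) j}

/-- The draws made in round `r`. -/
def roundDraws (N R K B r : ℕ) : Set ((Fin N × Fin B) ⊕ ((Fin R × Fin N × Fin K) ⊕ Fin R)) :=
  {j | Sum.elim (fun _ => False)
    (Sum.elim (fun p : Fin R × Fin N × Fin K => (p.1 : ℕ) = r) (fun r' : Fin R => (r' : ℕ) = r)) j}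

/-- The `σ`-algebra generated by a set of draws. -/
abbrev drawsSigma (ξ₀ : Fin N → ℕ → Ω → Z) (T : ℕ → Ω → Finset (Fin N))
    (ξ : ℕ → Fin N → ℕ → Ω → Z)
    (J : Set ((Fin N × Fin B) ⊕ ((Fin R × Fin N × Fin K) ⊕ Fin R))) : MeasurableSpace Ω :=
  ⨆ j ∈ J, drawSigma R K B ξ₀ T ξ j

theorem Draws.drawsSigma_le (hD : Draws μ D S K R B ξ₀ T ξ)
    (J : Set ((Fin N × Fin B) ⊕ ((Fin R × Fin N × Fin K) ⊕ Fin R))) :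
    drawsSigma ξ₀ T ξ J ≤ mΩ := iSup₂_le fun j _ => hD.drawSigma_le j

theorem Draws.indep_drawsSigma (hD : Draws μ D S K R B ξ₀ T ξ)
    {I J : Set ((Fin N × Fin B) ⊕ ((Fin R × Fin N × Fin K) ⊕ Fin R))} (hIJ : Disjoint I J) :
    Indep (drawsSigma ξ₀ T ξ I) (drawsSigma ξ₀ T ξ J) μ :=
  indep_iSup_of_disjoint hD.drawSigma_le hD.iIndep_drawSigma hIJ

theorem measurable_init_drawsSigma
    {J : Set ((Fin N × Fin B) ⊕ ((Fin R × Fin N × Fin K) ⊕ Fin R))} {i : Fin N} {b : ℕ}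
    (hb : b < B) (h : .inl (i, ⟨b, hb⟩) ∈ J) : Measurable[drawsSigma ξ₀ T ξ J] (ξ₀ i b) :=
  (comap_measurable (ξ₀ i b)).mono (le_biSup (drawSigma R K B ξ₀ T ξ) h) le_rfl

theorem measurable_step_drawsSigma
    {J : Set ((Fin N × Fin B) ⊕ ((Fin R × Fin N × Fin K) ⊕ Fin R))} {r : ℕ} {i : Fin N} {k : ℕ}
    (hr : r < R) (hk : k < K) (h : .inr (.inl (⟨r, hr⟩, i, ⟨k, hk⟩)) ∈ J) :
    Measurable[drawsSigma ξ₀ T ξ J] (ξ r i k) :=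
  (comap_measurable (ξ r i k)).mono (le_biSup (drawSigma R K B ξ₀ T ξ) h) le_rfl

theorem measurable_clients_drawsSigma
    {J : Set ((Fin N × Fin B) ⊕ ((Fin R × Fin N × Fin K) ⊕ Fin R))} {r : ℕ}
    (hr : r < R) (h : .inr (.inr ⟨r, hr⟩) ∈ J) :
    Measurable[drawsSigma ξ₀ T ξ J] (T r) :=
  (comap_measurable (T r)).mono (le_biSup (drawSigma R K B ξ₀ T ξ) h) le_rfl

theorem Draws.indepSamples_init (hD : Draws μ D S K R B ξ₀ T ξ) : IndepSamples μ D B ξ₀ where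
  measurable := hD.measurable_init
  law := hD.law_init
  indep := hD.iIndep_drawSigma.precomp (g := Sum.inl) Sum.inl_injective

theorem Draws.indepSamples_round (hD : Draws μ D S K R B ξ₀ T ξ) {r : ℕ} (hr : r < R) :
    IndepSamples μ D K (ξ r) where
  measurable := hD.measurable_step r hr
  law := hD.law_step r hr
  indep := by
    have hinj : Function.Injective (fun p : Fin N × Fin K =>
        (Sum.inr (Sum.inl (⟨r, hr⟩, p.1, p.2)) :
          (Fin N × Fin B) ⊕ ((Fin R × Fin N × Fin K) ⊕ Fin R))) := fun p q h => by
      simpa [Prod.ext_iff] using h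
    have h := hD.iIndep_drawSigma.precomp hinj
    exact h

/-- Only the initial data points with `b < B` and the data points with `k < K` matter for
`Draws`. -/
theorem Draws.congr {ξ₀' : Fin N → ℕ → Ω → Z} {ξ' : ℕ → Fin N → ℕ → Ω → Z}
    (hD : Draws μ D S K R B ξ₀ T ξ) (h₀ : ∀ i, ∀ b < B, ξ₀' i b = ξ₀ i b)
    (h : ∀ r i, ∀ k < K, ξ' r i k = ξ r i k) : Draws μ D S K R B ξ₀' T ξ' where
  measurable_init i b hb := by rw [h₀ i b hb]; exact hD.measurable_init i b hb
  law_init i b hb := by rw [h₀ i b hb]; exact hD.law_init i b hb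
  measurable_step r hr i k hk := by rw [h r i k hk]; exact hD.measurable_step r hr i k hk
  law_step r hr i k hk := by rw [h r i k hk]; exact hD.law_step r hr i k hk
  measurable_clients := hD.measurable_clients
  card_clients := hD.card_clients
  uniform_clients := hD.uniform_clients
  indep := by
    convert hD.indep using 2 with j
    rcases j with ⟨i, b⟩ | ⟨r, i, k⟩ | r
    · simp only [h₀ i b b.2]
    · simp only [h r i k k.2]
    · rfl

theorem measurable_initialState_comp (hW : WellPosed F D) {α : Type*} {_ : MeasurableSpace α}
    (x₀ : EuclideanSpace ℝ (Fin d)) {ζ : Fin N → ℕ → α → Z}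
    (hζ : ∀ i, ∀ b < B, Measurable (ζ i b)) :
    Measurable fun a => initialState F B x₀ (fun i b => ζ i b a) := by
  have h1 : ∀ i, ∀ b ∈ Finset.range B, Measurable fun a => sampleGradient F x₀ (ζ i b a) :=
    fun i b hb => hW.measurable_sampleGradient_comp measurable_const
      (hζ i b (Finset.mem_range.1 hb))
  have h2 : ∀ i, Measurable fun a => (1 / (B : ℝ)) •
      ∑ b ∈ Finset.range B, sampleGradient F x₀ (ζ i b a) := fun i =>
    (Finset.measurable_fun_sum _ (h1 i)).const_smul (1 / (B : ℝ))
  exact State.measurable_of_components measurable_const measurable_const h2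
    ((Finset.measurable_fun_sum _ fun i _ => h2 i).const_smul (1 / (N : ℝ)))

/-- The state at the beginning of round `r` depends only on the draws made before. -/
theorem measurable_run (hW : WellPosed F D) (x₀ : EuclideanSpace ℝ (Fin d))
    (hξ : ∀ r < R, ∀ i k, Measurable[drawsSigma ξ₀ T ξ (roundSamples N R K B r)] (ξ r i k))
    {r : ℕ} (hr : r ≤ R) :
    Measurable[drawsSigma ξ₀ T ξ (pastDraws N R K B r)] fun ω =>
      run F β γ η S K B x₀ (fun i b => ξ₀ i b ω) (fun r => T r ω) (fun r i k => ξ r i k ω) r := by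
  induction r with
  | zero =>
    exact measurable_initialState_comp hW x₀ fun i b hb =>
      measurable_init_drawsSigma hb trivial
  | succ r ih =>
    have hr' : r < R := hr
    have hmono : drawsSigma ξ₀ T ξ (pastDraws N R K B r) ≤
        drawsSigma ξ₀ T ξ (pastDraws N R K B (r + 1)) := by
      refine biSup_mono fun j hj => ?_
      rcases j with j | j | j
      · trivial
      · exact Nat.lt_succ_of_lt hj
      · exact Nat.lt_succ_of_lt hj
    have hmono' : drawsSigma ξ₀ T ξ (roundSamples N R K B r) ≤
        drawsSigma ξ₀ T ξ (pastDraws N R K B (r + 1)) := by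
      refine biSup_mono fun j hj => ?_
      rcases j with j | j | j
      · trivial
      · exact Nat.lt_succ_of_le (le_of_eq hj)
      · exact hj.elim
    have hs := (ih hr'.le).mono hmono le_rfl
    have hT : Measurable[drawsSigma ξ₀ T ξ (pastDraws N R K B (r + 1))] (T r) :=
      measurable_clients_drawsSigma hr' (Nat.lt_succ_self r)
    have hξr : Measurable[drawsSigma ξ₀ T ξ (pastDraws N R K B (r + 1))]
        (fun ω i k => ξ r i k ω) :=
      measurable_pi_pi fun i k => (hξ r hr' i k).mono hmono' le_rfl
    exact measurable_oneRound_comp hW hs hT hξr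

end Draws

/-! ### Summation over the rounds -/

section Convergence
variable {d N : ℕ} {Z Ω : Type*} [MeasurableSpace Z] {mΩ : MeasurableSpace Ω} {μ : Measure Ω}
  [IsProbabilityMeasure μ]
  {F : EuclideanSpace ℝ (Fin d) → Z → ℝ} {D : Fin N → Measure Z} {L σ β γ η fmin : ℝ}
  {K S R B : ℕ}
  {ξ₀ : Fin N → ℕ → Ω → Z} {T : ℕ → Ω → Finset (Fin N)} {ξ : ℕ → Fin N → ℕ → Ω → Z}

/-- The initial control variables have variance `σ ^ 2 / B`, and the initial direction error is
the squared gradient at the initial model. -/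
theorem lintegral_lyapunov_initialState_le (hW : WellPosed F D) (hSm : StandardSmoothness F D L)
    (hL : 0 < L) (hV : BoundedVariance F D σ) (hζ : IndepSamples μ D B ξ₀) (hB : 1 ≤ B)
    (hN : 1 ≤ N) (hβ0 : 0 ≤ β) (hγ0 : 0 ≤ γ) (hmin : ∀ x, fmin ≤ globalObjective F D x)
    (x₀ : EuclideanSpace ℝ (Fin d)) :
    ∫⁻ ω, ENNReal.ofReal (lyapunov F D fmin β γ S
      (initialState F B x₀ (fun i b => ξ₀ i b ω))) ∂μ ≤
    ENNReal.ofReal ((globalObjective F D x₀ - fmin) +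
      γ / β * (2 * L * (globalObjective F D x₀ - fmin)) +
      12 * γ * β * N / S ^ 2 * (σ ^ 2 / B)) := by
  have hB0 : (B : ℝ) ≠ 0 := by positivity
  have hN0 : (0 : ℝ) < N := by exact_mod_cast hN
  set s : State d N := ⟨x₀, 0, fun _ => 0, 0⟩ with hs
  -- with `β = η = 0` the local models stay at the initial model
  have hloc : ∀ (i : Fin N) (ζ : ℕ → Z) (k : ℕ), localModel F 0 0 s i ζ k = x₀ := by
    intro i ζ k
    induction k with
    | zero => rfl
    | succ k ih => rw [localModel, ih, zero_smul, sub_zero]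
  have hctrl : ∀ ω i, ctrlError F D (initialState F B x₀ (fun i b => ξ₀ i b ω)) i =
      -localNoise F D 0 0 B s i (fun b => ξ₀ i b ω) := by
    intro ω i
    simp only [ctrlError, initialState, localNoise, hloc, gradientNoise]
    rw [Finset.sum_sub_distrib, Finset.sum_const, Finset.card_range, smul_sub,
      ← Nat.cast_smul_eq_nsmul ℝ, smul_smul, one_div_mul_cancel hB0, one_smul, neg_sub]
  have hnoise : ∀ i, Integrable (fun ω => ‖localNoise F D 0 0 B s i (fun b => ξ₀ i b ω)‖ ^ 2) μ ∧
      ∫ ω, ‖localNoise F D 0 0 B s i (fun b => ξ₀ i b ω)‖ ^ 2 ∂μ ≤ σ ^ 2 / B := fun i => by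
    have h := integral_add_smul_sum_localNoise_sq_le (β := 0) (η := 0) hW hSm hL hV hζ hB s 0 1 {i}
    simpa using h
  have hgrad := norm_gradient_sq_le hL (differentiable_globalObjective hSm)
    (norm_gradient_globalObjective_sub_le hSm hN) hmin x₀
  have heq : ∀ ω, lyapunov F D fmin β γ S (initialState F B x₀ (fun i b => ξ₀ i b ω)) =
      ((globalObjective F D x₀ - fmin) + γ / β * ‖gradient (globalObjective F D) x₀‖ ^ 2) +
        12 * γ * β * N / S ^ 2 * ((1 / (N : ℝ)) *
          ∑ i, ‖localNoise F D 0 0 B s i (fun b => ξ₀ i b ω)‖ ^ 2) := by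
    intro ω
    have h1 : directionError F D γ (initialState F B x₀ (fun i b => ξ₀ i b ω)) =
        ‖gradient (globalObjective F D) x₀‖ ^ 2 := by
      simp only [directionError, initialState, smul_zero, add_zero, zero_sub, norm_neg]
    unfold lyapunov ctrlVariance
    rw [h1]
    simp only [hctrl, norm_neg]
    rfl
  have hi1 : Integrable (fun ω => 12 * γ * β * N / S ^ 2 * ((1 / (N : ℝ)) *
      ∑ i, ‖localNoise F D 0 0 B s i (fun b => ξ₀ i b ω)‖ ^ 2)) μ :=
    ((integrable_finsetSum _ fun i _ => (hnoise i).1).const_mul _).const_mul _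
  have hi : Integrable (fun ω =>
      ((globalObjective F D x₀ - fmin) + γ / β * ‖gradient (globalObjective F D) x₀‖ ^ 2) +
        12 * γ * β * N / S ^ 2 * ((1 / (N : ℝ)) *
          ∑ i, ‖localNoise F D 0 0 B s i (fun b => ξ₀ i b ω)‖ ^ 2)) μ :=
    (integrable_const _).add hi1
  have h0 : ∀ ω, 0 ≤ lyapunov F D fmin β γ S (initialState F B x₀ (fun i b => ξ₀ i b ω)) :=
    fun ω => lyapunov_nonneg hβ0 hγ0 hmin _
  simp only [heq] at h0 ⊢
  rw [← ofReal_integral_eq_lintegral_ofReal hi (Filter.Eventually.of_forall h0)]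
  refine ENNReal.ofReal_le_ofReal ?_
  rw [integral_add (integrable_const _) hi1, integral_const_mul, integral_const_mul,
    integral_finsetSum _ fun i _ => (hnoise i).1]
  simp only [integral_const, probReal_univ, one_smul]
  have hsum : (1 / (N : ℝ)) * ∑ i : Fin N,
      ∫ ω, ‖localNoise F D 0 0 B s i (fun b => ξ₀ i b ω)‖ ^ 2 ∂μ ≤ σ ^ 2 / B := by
    calc _ ≤ (1 / (N : ℝ)) * ∑ _i : Fin N, σ ^ 2 / B := by
          gcongr with i
          exact (hnoise i).2
      _ = _ := by
          rw [Finset.sum_const, Finset.card_univ, Fintype.card_fin, nsmul_eq_mul]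
          field_simp
  gcongr

/-- The expected squared gradients along a run, for data points `ξ r i k` that are measurable for
all `k`, so that the data of a round form one random element of `Fin N → ℕ → Z`. -/
theorem integral_gradient_sq_le_of_measurable (hW : WellPosed F D) (hSm : StandardSmoothness F D L)
    (hL : 0 < L) (hV : BoundedVariance F D σ) (hD : Draws μ D S K R B ξ₀ T ξ)
    (hK : 1 ≤ K) (hS1 : 1 ≤ S) (hSN : S ≤ N) (hB : 1 ≤ B) (hβ0 : 0 < β)
    (hβ1 : β ≤ 1) (hη : 0 < η) (hηS : (η * K * L) ^ 2 * S ≤ 1 / 250000)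
    (hβN : β ^ 3 * (N : ℝ) ^ 2 ≤ (S : ℝ) ^ 3) (hγ : γ = β / (24 * L))
    (hmin : ∀ x, fmin ≤ globalObjective F D x) (x₀ : EuclideanSpace ℝ (Fin d))
    (hξ : ∀ r < R, ∀ i k, Measurable[drawsSigma ξ₀ T ξ (roundSamples N R K B r)] (ξ r i k))
    {x : ℕ → Ω → EuclideanSpace ℝ (Fin d)}
    (hx : ∀ r ω, x r ω = (run F β γ η S K B x₀ (fun i b => ξ₀ i b ω) (fun r => T r ω)
      (fun r i k => ξ r i k ω) r).x) :
    (∀ r < R, Integrable (fun ω => ‖gradient (globalObjective F D) (x r ω)‖ ^ 2) μ) ∧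
    γ / 4 * ∑ r ∈ Finset.range R, ∫ ω, ‖gradient (globalObjective F D) (x r ω)‖ ^ 2 ∂μ ≤
      ((globalObjective F D x₀ - fmin) + γ / β * (2 * L * (globalObjective F D x₀ - fmin)) +
        12 * γ * β * N / S ^ 2 * (σ ^ 2 / B)) + R * (42 * γ * β * σ ^ 2 / (S * K)) := by
  have hN : 1 ≤ N := hS1.trans hSN
  have hγ0 : 0 < γ := by rw [hγ]; positivity
  obtain ⟨X, hX⟩ : ∃ X : ℕ → Ω → State d N, ∀ r ω, X r ω = run F β γ η S K B x₀
    (fun i b => ξ₀ i b ω) (fun r => T r ω) (fun r i k => ξ r i k ω) r := ⟨_, fun _ _ => rfl⟩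
  have hxX : ∀ r ω, x r ω = (X r ω).x := fun r ω => by rw [hx, hX]
  have hXm : ∀ r ≤ R, Measurable[drawsSigma ξ₀ T ξ (pastDraws N R K B r)] (X r) := fun r hr => by
    rw [funext (hX r)]
    exact measurable_run hW x₀ hξ hr
  have hXserver : ∀ r ω, (X r ω).serverCtrl = (1 / (N : ℝ)) • ∑ i, (X r ω).ctrl i :=
    fun r ω => by rw [hX]; exact run_serverCtrl _ _ _ _ _
  have hXsucc : ∀ r ω, X (r + 1) ω =
      oneRound F β γ η S K (X r ω) (T r ω) (fun i k => ξ r i k ω) := fun r ω => by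
    rw [hX, hX, run]
  have hlyap := measurable_lyapunov (fmin := fmin) (β := β) (γ := γ) (S := S) hSm hL
  have hgradm := measurable_gradient_globalObjective hSm hL
  have hgm : ∀ r < R, Measurable fun ω => ENNReal.ofReal
      (γ / 4 * ‖gradient (globalObjective F D) (X r ω).x‖ ^ 2) := fun r hr =>
    (((hgradm.comp (State.measurable_x.comp
      ((hXm r hr.le).mono (hD.drawsSigma_le _) le_rfl))).norm.pow_const 2).const_mul
        (γ / 4)).ennreal_ofReal
  -- one round, from the random state at its beginning
  have hround : ∀ r < R, ∫⁻ ω, ENNReal.ofReal (lyapunov F D fmin β γ S (X (r + 1) ω)) ∂μ +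
      ∫⁻ ω, ENNReal.ofReal (γ / 4 * ‖gradient (globalObjective F D) (X r ω).x‖ ^ 2) ∂μ ≤
      ∫⁻ ω, ENNReal.ofReal (lyapunov F D fmin β γ S (X r ω)) ∂μ +
        ENNReal.ofReal (42 * γ * β * σ ^ 2 / (S * K)) := by
    intro r hr
    have hφ : Measurable fun p : State d N × (Finset (Fin N) × (Fin N → ℕ → Z)) =>
        ENNReal.ofReal (lyapunov F D fmin β γ S (oneRound F β γ η S K p.1 p.2.1 p.2.2)) :=
      (hlyap.comp (measurable_oneRound_comp hW measurable_fst
        (measurable_fst.comp measurable_snd) (measurable_snd.comp measurable_snd))).ennreal_ofReal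
    have hle : drawsSigma ξ₀ T ξ (roundSamples N R K B r) ≤
        drawsSigma ξ₀ T ξ (roundDraws N R K B r) := by
      refine biSup_mono fun j hj => ?_
      rcases j with j | j | j
      · exact hj.elim
      · exact hj
      · exact hj.elim
    have hYT : Measurable[drawsSigma ξ₀ T ξ (roundDraws N R K B r)] (T r) :=
      measurable_clients_drawsSigma hr (show r = r from rfl)
    have hYξ : Measurable[drawsSigma ξ₀ T ξ (roundDraws N R K B r)] (fun ω i k => ξ r i k ω) :=
      measurable_pi_pi fun i k => (hξ r hr i k).mono hle le_rfl
    have hdisj : Disjoint (pastDraws N R K B r) (roundDraws N R K B r) := by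
      rw [Set.disjoint_left]
      rintro (j | j | j) h1 h2
      · exact h2
      · exact absurd h2 (ne_of_lt h1)
      · exact absurd h2 (ne_of_lt h1)
    have hfub := lintegral_eq_lintegral_lintegral_of_indep (hD.drawsSigma_le _)
      (hD.drawsSigma_le _) (hD.indep_drawsSigma hdisj) (hXm r hr.le) (hYT.prodMk hYξ) hφ
    have hTind : Indep (MeasurableSpace.comap (T r) ⊤)
        (drawsSigma ξ₀ T ξ (roundSamples N R K B r)) μ := by
      have hdisj' : Disjoint {Sum.inr (Sum.inr ⟨r, hr⟩)} (roundSamples N R K B r) := by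
        rw [Set.disjoint_singleton_left]
        exact fun h => h
      refine indep_of_indep_of_le_left (hD.indep_drawsSigma hdisj') ?_
      exact (measurable_clients_drawsSigma hr (Set.mem_singleton _)).comap_le
    simp only [hXsucc]
    rw [hfub, ← lintegral_add_right _ (hgm r hr)]
    calc _ ≤ ∫⁻ ω, (ENNReal.ofReal (lyapunov F D fmin β γ S (X r ω)) +
          ENNReal.ofReal (42 * γ * β * σ ^ 2 / (S * K))) ∂μ := by
          refine lintegral_mono fun ω => ?_
          exact lintegral_lyapunov_oneRound_le hW hSm hL hV (hD.indepSamples_round hr) hK hS1 hSN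
            hβ0 hβ1 hη hηS hβN hγ hmin (hXserver r ω) (hD.measurable_T hr) (hD.card_clients r hr)
            (hD.uniform_clients r hr) (hD.drawsSigma_le _) (hξ r hr) hTind
      _ = _ := by
          rw [lintegral_add_right _ measurable_const, lintegral_const, measure_univ, mul_one]
  -- summation of the bounds over the first `n` rounds
  have htel : ∀ n ≤ R, ∫⁻ ω, ENNReal.ofReal (lyapunov F D fmin β γ S (X n ω)) ∂μ +
      ∑ r ∈ Finset.range n,
        ∫⁻ ω, ENNReal.ofReal (γ / 4 * ‖gradient (globalObjective F D) (X r ω).x‖ ^ 2) ∂μ ≤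
      ∫⁻ ω, ENNReal.ofReal (lyapunov F D fmin β γ S (X 0 ω)) ∂μ +
        n * ENNReal.ofReal (42 * γ * β * σ ^ 2 / (S * K)) := by
    intro n
    induction n with
    | zero => intro _; simp
    | succ n ih =>
      intro hn
      rw [Finset.sum_range_succ, ← add_assoc, add_right_comm, Nat.cast_succ, add_mul, one_mul,
        ← add_assoc]
      refine (add_le_add (hround n hn) le_rfl).trans ?_
      rw [add_right_comm]
      exact add_le_add (ih (Nat.le_of_succ_le hn)) le_rfl
  have hinit : ∫⁻ ω, ENNReal.ofReal (lyapunov F D fmin β γ S (X 0 ω)) ∂μ ≤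
      ENNReal.ofReal ((globalObjective F D x₀ - fmin) +
        γ / β * (2 * L * (globalObjective F D x₀ - fmin)) +
        12 * γ * β * N / S ^ 2 * (σ ^ 2 / B)) := by
    simp only [hX]
    exact lintegral_lyapunov_initialState_le (S := S) (β := β) hW hSm hL hV
      hD.indepSamples_init hB hN hβ0.le hγ0.le hmin x₀
  have hΔ : 0 ≤ globalObjective F D x₀ - fmin := sub_nonneg.2 (hmin x₀)
  obtain ⟨Δ, hΔdef⟩ : ∃ Δ, Δ = globalObjective F D x₀ - fmin := ⟨_, rfl⟩
  rw [← hΔdef] at hinit hΔ ⊢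
  -- the Lyapunov function at the end is nonnegative and can be dropped
  have htot : ∑ r ∈ Finset.range R,
      ∫⁻ ω, ENNReal.ofReal (γ / 4 * ‖gradient (globalObjective F D) (X r ω).x‖ ^ 2) ∂μ ≤
      ENNReal.ofReal ((Δ + γ / β * (2 * L * Δ) + 12 * γ * β * N / S ^ 2 * (σ ^ 2 / B)) +
        R * (42 * γ * β * σ ^ 2 / (S * K))) := by
    rw [ENNReal.ofReal_add (by positivity) (by positivity), ENNReal.ofReal_mul (Nat.cast_nonneg R),
      ENNReal.ofReal_natCast]
    exact (le_add_self.trans (htel R le_rfl)).trans (add_le_add hinit le_rfl)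
  have hg0 : ∀ r ω, 0 ≤ γ / 4 * ‖gradient (globalObjective F D) (X r ω).x‖ ^ 2 := fun r ω =>
    mul_nonneg (by positivity) (sq_nonneg _)
  have hint : ∀ r < R, Integrable (fun ω => ‖gradient (globalObjective F D) (X r ω).x‖ ^ 2) μ := by
    intro r hr
    have hfin : ∫⁻ ω, ENNReal.ofReal
        (γ / 4 * ‖gradient (globalObjective F D) (X r ω).x‖ ^ 2) ∂μ < ⊤ :=
      ((Finset.single_le_sum (f := fun r => ∫⁻ ω, ENNReal.ofReal
        (γ / 4 * ‖gradient (globalObjective F D) (X r ω).x‖ ^ 2) ∂μ) (fun _ _ => zero_le)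
        (Finset.mem_range.2 hr)).trans htot).trans_lt ENNReal.ofReal_lt_top
    have hm : Measurable fun ω => ‖gradient (globalObjective F D) (X r ω).x‖ ^ 2 :=
      (hgradm.comp (State.measurable_x.comp
        ((hXm r hr.le).mono (hD.drawsSigma_le _) le_rfl))).norm.pow_const 2
    have h1 : Integrable (fun ω =>
        γ / 4 * ‖gradient (globalObjective F D) (X r ω).x‖ ^ 2) μ := by
      refine ⟨(hm.const_mul _).aestronglyMeasurable, ?_⟩
      rwa [hasFiniteIntegral_iff_ofReal (Filter.Eventually.of_forall (hg0 r))]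
    have h2 := h1.const_mul (γ / 4)⁻¹
    have h3 : γ / 4 ≠ 0 := by positivity
    simpa only [inv_mul_cancel_left₀ h3] using h2
  simp only [hxX]
  refine ⟨hint, ?_⟩
  have hconv : ∀ r ∈ Finset.range R,
      ∫⁻ ω, ENNReal.ofReal (γ / 4 * ‖gradient (globalObjective F D) (X r ω).x‖ ^ 2) ∂μ =
      ENNReal.ofReal (γ / 4 * ∫ ω, ‖gradient (globalObjective F D) (X r ω).x‖ ^ 2 ∂μ) := by
    intro r hr
    rw [← integral_const_mul, ofReal_integral_eq_lintegral_ofReal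
      ((hint r (Finset.mem_range.1 hr)).const_mul _) (Filter.Eventually.of_forall (hg0 r))]
  rw [Finset.sum_congr rfl hconv, ← ENNReal.ofReal_sum_of_nonneg fun r _ =>
    mul_nonneg (by positivity) (integral_nonneg fun ω => sq_nonneg _), ← Finset.mul_sum,
    ENNReal.ofReal_le_ofReal_iff (by positivity)] at htot
  exact htot

/-- The expected squared gradients along a run. -/
theorem integral_gradient_sq_le (hW : WellPosed F D) (hSm : StandardSmoothness F D L)
    (hL : 0 < L) (hV : BoundedVariance F D σ) (hD : Draws μ D S K R B ξ₀ T ξ)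
    (hK : 1 ≤ K) (hS1 : 1 ≤ S) (hSN : S ≤ N) (hB : 1 ≤ B) (hβ0 : 0 < β)
    (hβ1 : β ≤ 1) (hη : 0 < η) (hηS : (η * K * L) ^ 2 * S ≤ 1 / 250000)
    (hβN : β ^ 3 * (N : ℝ) ^ 2 ≤ (S : ℝ) ^ 3) (hγ : γ = β / (24 * L))
    (hmin : ∀ x, fmin ≤ globalObjective F D x) (x₀ : EuclideanSpace ℝ (Fin d))
    {x : ℕ → Ω → EuclideanSpace ℝ (Fin d)}
    (hx : ∀ r ω, x r ω = (run F β γ η S K B x₀ (fun i b => ξ₀ i b ω) (fun r => T r ω)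
      (fun r i k => ξ r i k ω) r).x) :
    (∀ r < R, Integrable (fun ω => ‖gradient (globalObjective F D) (x r ω)‖ ^ 2) μ) ∧
    γ / 4 * ∑ r ∈ Finset.range R, ∫ ω, ‖gradient (globalObjective F D) (x r ω)‖ ^ 2 ∂μ ≤
      ((globalObjective F D x₀ - fmin) + γ / β * (2 * L * (globalObjective F D x₀ - fmin)) +
        12 * γ * β * N / S ^ 2 * (σ ^ 2 / B)) + R * (42 * γ * β * σ ^ 2 / (S * K)) := by
  -- the draws with index `k ≥ K` are never used, and may be replaced by measurable ones
  have hcongr : ∀ r i, ∀ k < K, ξ r i (min k (K - 1)) = ξ r i k := fun r i k hk => by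
    rw [min_eq_left (by omega)]
  have hD' : Draws μ D S K R B ξ₀ T (fun r i k => ξ r i (min k (K - 1))) :=
    hD.congr (fun _ _ _ => rfl) hcongr
  refine integral_gradient_sq_le_of_measurable hW hSm hL hV hD' hK hS1 hSN hB hβ0 hβ1 hη hηS hβN hγ
    hmin x₀ (fun r hr i k => ?_) fun r ω => ?_
  · have hk : min k (K - 1) < K := by omega
    have h := measurable_step_drawsSigma (ξ₀ := ξ₀) (T := T)
      (ξ := fun r i k => ξ r i (min k (K - 1))) (J := roundSamples N R K B r) (i := i) hr hk rfl
    simpa using h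
  · rw [hx]
    exact congrArg State.x (run_congr x₀ (fun _ _ _ => rfl)
      (fun r i k hk => (congrFun (hcongr r i k hk) ω).symm) r)

end Convergence

/-! ### The choice of the momentum and of the initial batch -/

section Momentum

variable {c L Δ σ : ℝ} {N S K R : ℕ}

theorem momentum_le_min : momentum c L Δ σ N S K R ≤ min c (S / (N : ℝ) ^ (2 / 3 : ℝ)) := by
  unfold momentum
  split_ifs
  · exact le_rfl
  · exact min_le_left _ _

theorem momentum_nonneg (hc : 0 ≤ c) : 0 ≤ momentum c L Δ σ N S K R := by
  have h : 0 ≤ min c (S / (N : ℝ) ^ (2 / 3 : ℝ)) := le_min hc (by positivity)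
  unfold momentum
  split_ifs
  · exact h
  · exact le_min h (Real.sqrt_nonneg _)

theorem pow_three_rpow_two_thirds (N : ℕ) : ((N : ℝ) ^ (2 / 3 : ℝ)) ^ 3 = (N : ℝ) ^ 2 := by
  rw [← Real.rpow_natCast, ← Real.rpow_mul (Nat.cast_nonneg N), ← Real.rpow_natCast]
  norm_num

/-- The condition under which the control variance can follow the motion of the model. -/
theorem momentum_pow_three_mul_le (hc : 0 ≤ c) (hN : 0 < N) :
    momentum c L Δ σ N S K R ^ 3 * (N : ℝ) ^ 2 ≤ (S : ℝ) ^ 3 := by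
  have hN' : 0 < (N : ℝ) ^ (2 / 3 : ℝ) := Real.rpow_pos_of_pos (Nat.cast_pos.2 hN) _
  rw [← pow_three_rpow_two_thirds, ← mul_pow]
  refine pow_le_pow_left₀ (mul_nonneg (momentum_nonneg hc) hN'.le) ?_ 3
  rw [← le_div_iff₀ hN']
  exact momentum_le_min.trans (min_le_right _ _)

/-- The momentum vanishes only if the initial model is already optimal. -/
theorem nonpos_of_momentum_eq_zero (hc : 0 < c) (hL : 0 < L) (hN : 0 < N) (hS : 0 < S)
    (hK : 0 < K) (hR : 0 < R) (h : momentum c L Δ σ N S K R = 0) : Δ ≤ 0 := by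
  by_contra! hΔ
  have hpos : 0 < min c (S / (N : ℝ) ^ (2 / 3 : ℝ)) := lt_min hc (by positivity)
  have : 0 < momentum c L Δ σ N S K R := by
    unfold momentum
    split_ifs with hσ
    · exact hpos
    · exact lt_min hpos (by positivity)
  exact this.ne' h

/-- The momentum is so small that the noise it lets through is of the order of the statistical
rate. -/
theorem momentum_mul_sq_le (hΔ : 0 ≤ Δ) (hL : 0 < L) (hS : 0 < S) (hK : 0 < K)
    (hR : 0 < R) :
    momentum c L Δ σ N S K R * σ ^ 2 / (S * K) ≤ √(L * Δ * σ ^ 2 / (S * K * R)) := by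
  by_cases hσ : σ = 0
  · simp [hσ]
  have hm : momentum c L Δ σ N S K R ≤ √(L * Δ * S * K / (σ ^ 2 * R)) := by
    rw [momentum, if_neg hσ]
    exact min_le_right _ _
  have hS' : (0 : ℝ) < S := Nat.cast_pos.2 hS
  have hK' : (0 : ℝ) < K := Nat.cast_pos.2 hK
  have hR' : (0 : ℝ) < R := Nat.cast_pos.2 hR
  have hσ2 : 0 < σ ^ 2 := by positivity
  rw [mul_div_assoc]
  calc _ ≤ √(L * Δ * S * K / (σ ^ 2 * R)) * (σ ^ 2 / (S * K)) := by gcongr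
    _ = _ := by
      rw [← Real.sqrt_sq (show 0 ≤ σ ^ 2 / (S * K) by positivity), ← Real.sqrt_mul (by positivity)]
      congr 1
      field_simp

/-- The momentum is no smaller than needed for the optimization error `LΔ / (βR)` to be of the
order of the claimed rate. -/
theorem div_momentum_le (hc : 0 < c) (hc1 : c ≤ 1) (hΔ : 0 ≤ Δ) (hL : 0 < L) (hS : 0 < S)
    (hK : 0 < K) (hR : 0 < R) (hβ : 0 < momentum c L Δ σ N S K R) :
    L * Δ / R / momentum c L Δ σ N S K R ≤
      1 / c * (L * Δ / R * (1 + (N : ℝ) ^ (2 / 3 : ℝ) / S)) +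
        √(L * Δ * σ ^ 2 / (S * K * R)) := by
  have hS' : (0 : ℝ) < S := Nat.cast_pos.2 hS
  have hK' : (0 : ℝ) < K := Nat.cast_pos.2 hK
  have hR' : (0 : ℝ) < R := Nat.cast_pos.2 hR
  have hp : 0 ≤ (N : ℝ) ^ (2 / 3 : ℝ) / S := by positivity
  have hA : 0 ≤ L * Δ / R := by positivity
  have hW : 0 ≤ √(L * Δ * σ ^ 2 / (S * K * R)) := Real.sqrt_nonneg _
  have hc' : 1 ≤ 1 / c := by rwa [le_div_iff₀ hc, one_mul]
  have hcA : L * Δ / R ≤ 1 / c * (L * Δ / R) := le_mul_of_one_le_left hA hc'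
  have hmin : L * Δ / R / min c (S / (N : ℝ) ^ (2 / 3 : ℝ)) ≤
      1 / c * (L * Δ / R * (1 + (N : ℝ) ^ (2 / 3 : ℝ) / S)) := by
    rcases min_choice c (S / (N : ℝ) ^ (2 / 3 : ℝ)) with h | h <;> rw [h]
    · rw [div_eq_mul_one_div, mul_comm]
      gcongr
      exact le_mul_of_one_le_right hA (by linarith)
    · rw [div_div_eq_mul_div, mul_div_assoc]
      refine (mul_le_mul_of_nonneg_left (le_add_of_nonneg_left zero_le_one) hA).trans ?_
      exact le_mul_of_one_le_left (by positivity) hc'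
  by_cases hσ : σ = 0
  · have : momentum c L Δ σ N S K R = min c (S / (N : ℝ) ^ (2 / 3 : ℝ)) := by
      rw [momentum, if_pos hσ]
    rw [this]
    linarith
  · have hm : momentum c L Δ σ N S K R = min (min c (S / (N : ℝ) ^ (2 / 3 : ℝ)))
        √(L * Δ * S * K / (σ ^ 2 * R)) := by
      rw [momentum, if_neg hσ]
    rw [hm] at hβ ⊢
    rcases min_choice (min c (S / (N : ℝ) ^ (2 / 3 : ℝ))) √(L * Δ * S * K / (σ ^ 2 * R))
      with h | h
    · rw [h]
      linarith
    · rw [h] at hβ ⊢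
      have hσ2 : 0 < σ ^ 2 := by positivity
      have : L * Δ / R / √(L * Δ * S * K / (σ ^ 2 * R)) = √(L * Δ * σ ^ 2 / (S * K * R)) := by
        have hsq : L * Δ * σ ^ 2 / (S * K * R) * (L * Δ * S * K / (σ ^ 2 * R)) =
            (L * Δ / R) ^ 2 := by
          field_simp
        rw [div_eq_iff hβ.ne', ← Real.sqrt_mul (by positivity), hsq, Real.sqrt_sq hA]
      rw [this]
      have : 0 ≤ 1 / c * (L * Δ / R * (1 + (N : ℝ) ^ (2 / 3 : ℝ) / S)) := by positivity
      linarith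

end Momentum

theorem initialBatch_pos {N S K R : ℕ} (hN : 0 < N) (hS : 0 < S) (hK : 0 < K) (hR : 0 < R) :
    0 < initialBatch N S K R :=
  Nat.ceil_pos.2 (by positivity)

/-- The initial batch is large enough for the variance of the initial control variables to be
amortized over the `R` rounds. -/
theorem mul_le_initialBatch_mul {N S K R : ℕ} (hS : 0 < S) (hR : 0 < R) :
    (N : ℝ) * K ≤ initialBatch N S K R * (S * R) := by
  have h : (N : ℝ) * K / (S * R) ≤ initialBatch N S K R := Nat.le_ceil _
  rwa [div_le_iff₀ (by positivity)] at h

/-- The bound summed over the rounds, divided by the weight `γR / 4` of the averaged gradient. -/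
theorem average_le_of_weighted_sum_le {L Δ σ β A : ℝ} {N S K R B : ℕ} (hL : 0 < L) (hβ : 0 < β)
    (hS : 0 < S) (hK : 0 < K) (hR : 0 < R) (hB : 0 < B) (hNB : (N : ℝ) * K ≤ B * (S * R))
    (h : β / (24 * L) / 4 * A ≤ (Δ + β / (24 * L) / β * (2 * L * Δ) +
      12 * (β / (24 * L)) * β * N / S ^ 2 * (σ ^ 2 / B)) +
        R * (42 * (β / (24 * L)) * β * σ ^ 2 / (S * K))) :
    1 / (R : ℝ) * A ≤ 104 * (L * Δ / R / β) + 216 * (β * σ ^ 2 / (S * K)) := by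
  have hS' : (0 : ℝ) < S := Nat.cast_pos.2 hS
  have hK' : (0 : ℝ) < K := Nat.cast_pos.2 hK
  have hR' : (0 : ℝ) < R := Nat.cast_pos.2 hR
  have hB' : (0 : ℝ) < B := Nat.cast_pos.2 hB
  have hinit : (N : ℝ) / S ^ 2 / B / R ≤ 1 / (S * K) := by
    rw [div_div, div_div, div_le_div_iff₀ (by positivity) (by positivity)]
    calc (N : ℝ) * (S * K) = N * K * S := by ring
      _ ≤ B * (S * R) * S := by gcongr
      _ = 1 * (S ^ 2 * (B * R)) := by ring
  -- `96 L / (β R)` is `4 / (γ R)`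
  have hmul := mul_le_mul_of_nonneg_left hinit (show 0 ≤ 48 * β * σ ^ 2 by positivity)
  have hscale := mul_le_mul_of_nonneg_left h (show 0 ≤ 96 * L / (β * R) by positivity)
  calc 1 / (R : ℝ) * A = 96 * L / (β * R) * (β / (24 * L) / 4 * A) := by
        field_simp
        ring
    _ ≤ _ := hscale
    _ = 104 * (L * Δ / R / β) + 48 * β * σ ^ 2 * ((N : ℝ) / S ^ 2 / B / R) +
        168 * (β * σ ^ 2 / (S * K)) := by
        field_simp
        ring
    _ ≤ 104 * (L * Δ / R / β) + 48 * β * σ ^ 2 * (1 / (S * K)) +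
        168 * (β * σ ^ 2 / (S * K)) := by linarith
    _ = _ := by ring

end ScaffoldM

end

theorem theorem3 :
    ∃ c₁ : ℝ, 0 < c₁ ∧ ∀ c : ℝ, 0 < c → c ≤ 1 → ∃ C : ℝ, 0 < C ∧
      ∀ (d N S K R : ℕ), 1 ≤ S → S ≤ N → 1 ≤ K → 1 ≤ R →
      ∀ (Z : Type*) [MeasurableSpace Z] (F : EuclideanSpace ℝ (Fin d) → Z → ℝ)
        (D : Fin N → Measure Z) (L σ fmin : ℝ) (x₀ : EuclideanSpace ℝ (Fin d)),
        0 < L → 0 ≤ σ →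
        ScaffoldM.WellPosed F D →
        ScaffoldM.StandardSmoothness F D L →
        ScaffoldM.BoundedVariance F D σ →
        IsLeast (Set.range (ScaffoldM.globalObjective F D)) fmin →
      ∀ (Δ β γ η : ℝ),
        Δ = ScaffoldM.globalObjective F D x₀ - fmin →
        β = ScaffoldM.momentum c L Δ σ N S K R →
        γ = β / (24 * L) →
        -- `η K L ≤ c₁ min {S^{-1/2}, β⁻¹ K^{-1/4}, S^{1/2} / N}`
        0 < η →
        η * K * L * Real.sqrt S ≤ c₁ →
        η * K * L * (β * (K : ℝ) ^ (1 / 4 : ℝ)) ≤ c₁ →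
        η * K * L * N ≤ c₁ * Real.sqrt S →
      ∀ (Ω : Type*) [MeasurableSpace Ω] (μ : Measure Ω) [IsProbabilityMeasure μ]
        (ξ₀ : Fin N → ℕ → Ω → Z) (T : ℕ → Ω → Finset (Fin N)) (ξ : ℕ → Fin N → ℕ → Ω → Z)
        (x : ℕ → Ω → EuclideanSpace ℝ (Fin d)),
        ScaffoldM.Draws μ D S K R (ScaffoldM.initialBatch N S K R) ξ₀ T ξ →
        (∀ r ω, x r ω =
          (ScaffoldM.run F β γ η S K (ScaffoldM.initialBatch N S K R) x₀
            (fun i b => ξ₀ i b ω) (fun r => T r ω) (fun r i k => ξ r i k ω) r).x) →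
        (∀ r < R, Integrable
          (fun ω => ‖gradient (ScaffoldM.globalObjective F D) (x r ω)‖ ^ 2) μ) ∧
        (1 / (R : ℝ)) * ∑ r ∈ Finset.range R,
            ∫ ω, ‖gradient (ScaffoldM.globalObjective F D) (x r ω)‖ ^ 2 ∂μ ≤
          C * (Real.sqrt (L * Δ * σ ^ 2 / (S * K * R)) +
            L * Δ / R * (1 + (N : ℝ) ^ (2 / 3 : ℝ) / S)) := by
  -- `1 / 250000 = (1 / 500)²` bounds `(η K L)² S`; the constant `320` is `104 + 216`, the sum
  -- of the coefficients in `average_le_of_weighted_sum_le`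
  refine ⟨1 / 500, by norm_num, fun c hc hc1 => ⟨320 / c, by positivity, ?_⟩⟩
  intro d N S K R hS hSN hK hR Z _ F D L σ fmin x₀ hL hσ hW hSm hV hmin Δ β γ η hΔ hβ hγ hη
    hηS _ _ Ω _ μ _ ξ₀ T ξ x hD hx
  have hN : 1 ≤ N := hS.trans hSN
  have hmin' : ∀ y, fmin ≤ ScaffoldM.globalObjective F D y := fun y => hmin.2 ⟨y, rfl⟩
  have hΔ0 : 0 ≤ Δ := hΔ ▸ sub_nonneg.2 (hmin' x₀)
  have hβ0 : 0 ≤ β := hβ ▸ ScaffoldM.momentum_nonneg hc.le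
  rcases hβ0.eq_or_lt with hβz | hβ0
  · -- without momentum the iterates never leave `x₀`, which is then a minimizer
    have hΔz : Δ = 0 := le_antisymm
      (ScaffoldM.nonpos_of_momentum_eq_zero hc hL hN hS hK hR (hβ.symm.trans hβz.symm)) hΔ0
    have hγz : γ = 0 := by rw [hγ, ← hβz, zero_div]
    have hgrad : ‖gradient (ScaffoldM.globalObjective F D) x₀‖ ^ 2 = 0 := by
      refine le_antisymm ?_ (sq_nonneg _)
      have h := ScaffoldM.norm_gradient_sq_le hL (ScaffoldM.differentiable_globalObjective hSm)
        (ScaffoldM.norm_gradient_globalObjective_sub_le hSm hN) hmin' x₀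
      rwa [← hΔ, hΔz, mul_zero] at h
    have hx₀ : ∀ r ω, x r ω = x₀ := fun r ω => by
      rw [hx, hγz, ScaffoldM.run_x_of_gamma_eq_zero]
    simp only [hx₀, hgrad]
    exact ⟨fun _ _ => integrable_const _, by simp [hΔz]⟩
  have hβc : β ≤ c := by
    rw [hβ]
    exact ScaffoldM.momentum_le_min.trans (min_le_left _ _)
  have hβN : β ^ 3 * (N : ℝ) ^ 2 ≤ (S : ℝ) ^ 3 := by
    rw [hβ]
    exact ScaffoldM.momentum_pow_three_mul_le hc.le hN
  have hηS' : (η * K * L) ^ 2 * S ≤ 1 / 250000 := by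
    have h := pow_le_pow_left₀ (by positivity) hηS 2
    rw [mul_pow, Real.sq_sqrt (Nat.cast_nonneg S)] at h
    exact h.trans (by norm_num)
  have hB : 0 < ScaffoldM.initialBatch N S K R := ScaffoldM.initialBatch_pos hN hS hK hR
  obtain ⟨hint, hsum⟩ := ScaffoldM.integral_gradient_sq_le hW hSm hL hV hD hK hS hSN hB hβ0
    (hβc.trans hc1) hη hηS' hβN hγ hmin' x₀ hx
  refine ⟨hint, ?_⟩
  rw [← hΔ, hγ] at hsum
  have havg := ScaffoldM.average_le_of_weighted_sum_le hL hβ0 hS hK hR hB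
    (ScaffoldM.mul_le_initialBatch_mul hS hR) hsum
  have hopt := ScaffoldM.div_momentum_le hc hc1 hΔ0 hL hS hK hR (hβ ▸ hβ0)
  have hnoise := ScaffoldM.momentum_mul_sq_le (c := c) (σ := σ) (N := N) hΔ0 hL hS hK hR
  rw [← hβ] at hopt hnoise
  have hP : 0 ≤ 1 / c * (L * Δ / R * (1 + (N : ℝ) ^ (2 / 3 : ℝ) / S)) := by positivity
  have hWc : √(L * Δ * σ ^ 2 / (S * K * R)) ≤ 1 / c * √(L * Δ * σ ^ 2 / (S * K * R)) :=
    le_mul_of_one_le_left (Real.sqrt_nonneg _) (by rwa [le_div_iff₀ hc, one_mul])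
  have hsplit : 320 / c * (√(L * Δ * σ ^ 2 / (S * K * R)) +
      L * Δ / R * (1 + (N : ℝ) ^ (2 / 3 : ℝ) / S)) =
      320 * (1 / c * √(L * Δ * σ ^ 2 / (S * K * R))) +
        320 * (1 / c * (L * Δ / R * (1 + (N : ℝ) ^ (2 / 3 : ℝ) / S))) := by ring
  rw [hsplit]
  linarith
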